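/- Let $b,k_1,k_2,k_3,k_4>0$ and let $H^1_L(0,1)=\{f\in H^1(0,1): f(0)=0\}$ (complex-valued functions). Let $$\mathcal H=H^1_L(0,1)\times L^2(0,1)\times H^1_L(0,1)\times L^2(0,1)\times\mathbb C\times\mathbb C$$ with the inner product, for $U=(u,v,y,z,\eta,\gamma)$ and $U_1=(u_1,v_1,y_1,z_1,\eta_1,\gamma_1)$, $$\langle U,U_1\rangle=\int_0^1\Big(v\overline{v_1}+\tfrac1b z\overline{z_1}+\tfrac1b y_x\overline{y_{1x}}+(u_x+y)\overline{(u_{1x}+y_1)}\Big)dx+\tfrac1{k_1}\eta\overline{\eta_1}+\tfrac1{b\,k_3}\gamma\overline{\gamma_1}.$$ Let $\mathcal A$ be the operator in $\mathcal H$ with domain $$D(\mathcal A)=\{U\in\mathcal H: u,y\in H^2(0,1),\ v,z\in H^1_L(0,1),\ \eta=v(1),\ \gamma=z(1)\},$$ $$\mathcal AU=\big(v,\ (u_x+y)_x,\ z,\ y_{xx}-b(u_x+y),\ -k_1(u_x(1)+y(1))-k_2\eta,\ -k_3y_x(1)-k_4\gamma\big),$$ and let $\mathcal A_0$ be the operator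 with the same domain given by the same formula with $k_2=k_4=0$. (This is the Timoshenko beam with equal wave speeds, $a=1$.) Then there is $k_0\in\mathbb N$ such that the following holds. 1. (Spectrum of $\mathcal A_0$.) The operator $\mathcal A_0$ is skew-adjoint. Its spectrum is $\sigma_0=\sigma_0^1\cup\sigma_0^2$ with $\sigma_0^1=\{\kappa_i^0\}_{i\in I_0}$, $I_0$ finite, and $\sigma_0^2=\{\lambda_k^{j,0}\}_{j=1,2,\,k\in\mathbb Z,\,|k|\ge k_0}$, where all these numbers are pairwise distinct. Each $\kappa_i^0$ is an eigenvalue of finite multiplicity $m_{i,0}\ge1$ (algebraic and geometric), each $\lambda_k^{j,0}$ is an eigenvalue of multiplicity one, and $\lambda_k^{j,0}=ik\pi+o(1)$ as $|k|\to\infty$, $j=1,2$. 2. (Eigenvectors of $\mathcal A_0$.) There are eigenvectors $\tilde\phi_i^l$, $l=0,\dots,m_{i,0}-1$, for $\kappa_i^0$ ($i\in I_0$) and $\phi_k^j$ for $\lambda_k^{j,0}$ ($j=1,2$, $|k|\ge k_0$) such that the system $\{\tilde\phi_i^l\}\cup\{\phi_k^j\}$ is an orthonormal basis of $\mathcal H$.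 3. (Spectrum of $\mathcal A$.) The spectrum of $\mathcal A$ is $\sigma=\sigma^1\cup\sigma^2$ with $\sigma^1=\{\kappa_i\}_{i\in I}$, $I$ finite, and $\sigma^2=\{\lambda_k^{j}\}_{j=1,2,\,k\in\mathbb Z,\,|k|\ge k_0}$, where all these numbers are pairwise distinct. Each $\kappa_i$ is an eigenvalue of finite algebraic multiplicity $m_i$ and geometric multiplicity $n_i$, $1\le n_i\le m_i$, each $\lambda_k^j$ is an eigenvalue of algebraic multiplicity one, and $\lambda_k^{j}=ik\pi+o(1)$ as $|k|\to\infty$, $j=1,2$. 4. (Generalized eigenvectors of $\mathcal A$.) For each $i\in I$ there are integers $\delta_{ir}\ge1$, $r=1,\dots,n_i$, with $\sum_{r=1}^{n_i}\delta_{ir}=m_i$, and linearly independent vectors $\psi_{ir}^l\in D(\mathcal A)$, $r=1,\dots,n_i$, $l=1,\dots,\delta_{ir}$, with $(\mathcal A-\kappa_i)\psi_{ir}^l=\psi_{ir}^{l-1}$, where $\psi_{ir}^0=0$. For all $|k|\ge k_0$ and $j=1,2$ there is an eigenvector $\psi_k^j$ of $\mathcal A$ for $\lambda_k^j$ with $\|\psi_k^j\|_{\mathcal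 H}=1$. -/

import Mathlib

open MeasureTheory Filter Topology unitInterval
open scoped ContDiff

noncomputable section

namespace Timoshenko

/-! ### Sobolev spaces on the interval -/

/-- The space `L²(0,1)` of complex valued functions. -/
abbrev L2 : Type := Lp ℂ 2 (volume : Measure I)

/-- The class in `L²(0,1)` of a continuous function on `[0,1]`. -/
def toL2 : C(I, ℂ) →L[ℂ] L2 := ContinuousMap.toLp 2 (volume : Measure I) ℂ

/-- Test functions on the open interval `(0,1)`. -/
def IsTest (φ : ℝ → ℝ) : Prop := ContDiff ℝ ∞ φ ∧ tsupport φ ⊆ Set.Ioo 0 1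

/-- `g` is the weak derivative of `u` on `(0,1)`. -/
def HasWeakDeriv (u : C(I, ℂ)) (g : L2) : Prop :=
  ∀ φ : ℝ → ℝ, IsTest φ → ∫ x : I, deriv φ x • u x = -∫ x : I, φ x • g x

lemma integrable_smul_L2 {φ : ℝ → ℝ} (hφ : Continuous φ) (g : L2) :
    Integrable (fun x : I => φ x • g x) := by
  have hg : Integrable (fun x : I => g x) := (Lp.memLp g).integrable (by norm_num)
  obtain ⟨C, hC⟩ := (isCompact_univ (X := I)).exists_bound_of_continuousOn
    (f := fun x : I => φ x) (by fun_prop)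
  exact hg.bdd_smul C (by fun_prop) (ae_of_all _ fun x => hC x trivial)

lemma integrable_smul_cont {φ : ℝ → ℝ} (hφ : Continuous φ) (u : C(I, ℂ)) :
    Integrable (fun x : I => φ x • u x) :=
  Continuous.integrable_of_hasCompactSupport (by fun_prop) (HasCompactSupport.of_compactSpace _)

lemma IsTest.continuous {φ : ℝ → ℝ} (h : IsTest φ) : Continuous φ := h.1.continuous

lemma IsTest.continuous_deriv {φ : ℝ → ℝ} (h : IsTest φ) : Continuous (deriv φ) :=
  h.1.continuous_deriv (by simp)

/-- The Sobolev space `H¹(0,1)`. An element is a pair `(u, u')` of a function, given by its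
continuous representative on `[0,1]`, and its weak derivative in `L²(0,1)`; the second entry is
determined by the first one. -/
def H1 : Submodule ℂ (C(I, ℂ) × L2) where
  carrier := {p | HasWeakDeriv p.1 p.2}
  zero_mem' := by
    intro φ hφ
    have : (fun x : I => φ x • (0 : L2) x) =ᵐ[volume] fun _ => 0 := by
      filter_upwards [Lp.coeFn_zero ℂ 2 (volume : Measure I)] with x hx
      rw [hx, Pi.zero_apply, smul_zero]
    rw [Prod.snd_zero, integral_congr_ae this]
    simp
  add_mem' := by
    rintro ⟨u, g⟩ ⟨v, h⟩ hu hv φ hφ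
    have e : (fun x : I => φ x • (g + h) x) =ᵐ[volume] fun x : I => φ x • g x + φ x • h x := by
      filter_upwards [Lp.coeFn_add g h] with x hx
      rw [hx, Pi.add_apply, smul_add]
    have h1 := hu φ hφ
    have h2 := hv φ hφ
    simp only [Prod.mk_add_mk, ContinuousMap.add_apply, smul_add] at h1 h2 ⊢
    rw [integral_congr_ae e, integral_add (integrable_smul_cont hφ.continuous_deriv u)
      (integrable_smul_cont hφ.continuous_deriv v),
      integral_add (integrable_smul_L2 hφ.continuous g) (integrable_smul_L2 hφ.continuous h),
      h1, h2, neg_add]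
  smul_mem' := by
    rintro c ⟨u, g⟩ hu φ hφ
    have e : (fun x : I => φ x • (c • g) x) =ᵐ[volume] fun x : I => c • (φ x • g x) := by
      filter_upwards [Lp.coeFn_smul c g] with x hx
      rw [hx, Pi.smul_apply, smul_comm]
    have h1 := hu φ hφ
    simp only [Prod.smul_mk, ContinuousMap.smul_apply] at h1 ⊢
    rw [integral_congr_ae e, integral_smul, ← smul_neg, ← h1, ← integral_smul]
    congr 1; ext x; exact smul_comm _ _ _

instance : AddCommGroup L2 := inferInstance

instance : Module ℂ L2 := inferInstance

instance : AddCommGroup H1 := H1.addCommGroup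

instance : Module ℂ H1 := H1.module

namespace H1

/-- The value at the point `x` of a function in `H¹(0,1)`. -/
def ev (x : I) : H1 →ₗ[ℂ] ℂ where
  toFun u := u.1.1 x
  map_add' _ _ := rfl
  map_smul' _ _ := rfl

/-- The class in `L²(0,1)` of a function in `H¹(0,1)`. -/
def fn : H1 →ₗ[ℂ] L2 := toL2.toLinearMap ∘ₗ LinearMap.fst ℂ C(I, ℂ) L2 ∘ₗ H1.subtype

/-- The weak derivative in `L²(0,1)` of a function in `H¹(0,1)`. -/
def dx : H1 →ₗ[ℂ] L2 := LinearMap.snd ℂ C(I, ℂ) L2 ∘ₗ H1.subtype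

end H1

/-- The space `H¹_L(0,1)` of the functions in `H¹(0,1)` that vanish at `0`. -/
def H1L : Submodule ℂ H1 := LinearMap.ker (H1.ev 0)

instance : AddCommGroup H1L := H1L.addCommGroup

instance : Module ℂ H1L := H1L.module

lemma integral_I (f : ℝ → ℂ) : ∫ x : I, f x = ∫ x in Set.Icc (0 : ℝ) 1, f x :=
  integral_subtype measurableSet_Icc f

/-- The fundamental lemma of the calculus of variations. -/
lemma ae_eq_zero_of_test {h : I → ℂ} (hi : Integrable h)
    (hh : ∀ φ : ℝ → ℝ, IsTest φ → ∫ x : I, φ x • h x = 0) : h =ᵐ[volume] 0 := by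
  set F : ℝ → ℂ := Set.IccExtend zero_le_one h with hF
  have hFv : ∀ x : I, F x = h x := fun x => Set.IccExtend_val zero_le_one h x
  have hemb : MeasurableEmbedding (Subtype.val : I → ℝ) :=
    MeasurableEmbedding.subtype_coe measurableSet_Icc
  have hmp : MeasurePreserving (Subtype.val : I → ℝ) volume (volume.restrict (Set.Icc (0 : ℝ) 1)) :=
    unitInterval.measurePreserving_coe
  have hint : IntegrableOn F (Set.Icc 0 1) := by
    rw [IntegrableOn, ← hmp.integrable_comp_emb hemb]
    exact hi.congr (ae_of_all _ fun x => (hFv x).symm)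
  have key : ∀ᵐ x : ℝ, x ∈ Set.Ioo (0 : ℝ) 1 → F x = 0 := by
    refine isOpen_Ioo.ae_eq_zero_of_integral_contDiff_smul_eq_zero
      ((hint.mono_set Set.Ioo_subset_Icc_self).locallyIntegrableOn) ?_
    intro φ hφ _ hs
    have h1 := hh φ ⟨hφ, hs⟩
    have h2 : ∫ x : I, φ x • h x = ∫ x : I, (fun t : ℝ => φ t • F t) x := by
      congr 1; ext x; exact congrArg (fun w => φ x • w) (hFv x).symm
    rw [h2, show (∫ x : I, (fun t : ℝ => φ t • F t) x) = _ from
      integral_I fun t : ℝ => φ t • F t] at h1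
    rw [← h1]
    symm
    refine setIntegral_eq_integral_of_forall_compl_eq_zero ?_
    intro x hx
    have : φ x = 0 := by
      by_contra hne
      exact hx (Set.Ioo_subset_Icc_self (hs (subset_tsupport φ hne)))
    rw [this, zero_smul]
  have key2 : ∀ᵐ x ∂(volume.restrict (Set.Icc (0 : ℝ) 1)), F x = 0 := by
    rw [← restrict_Ioo_eq_restrict_Icc]
    exact (ae_restrict_iff' measurableSet_Ioo).2 key
  filter_upwards [hmp.quasiMeasurePreserving.ae key2] with x hx
  rw [← hFv x, hx, Pi.zero_apply]

/-- A test function with vanishing mean has a primitive that is a test function. -/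
lemma exists_primitive {ψ : ℝ → ℝ} (hψ : IsTest ψ) (h0 : ∫ x in (0 : ℝ)..1, ψ x = 0) :
    ∃ Φ : ℝ → ℝ, IsTest Φ ∧ deriv Φ = ψ := by
  have hd : ∀ x, HasDerivAt (fun t => ∫ s in (0 : ℝ)..t, ψ s) (ψ x) x := fun x =>
    intervalIntegral.integral_hasDerivAt_right (hψ.continuous.intervalIntegrable _ _)
      hψ.continuous.aestronglyMeasurable.stronglyMeasurableAtFilter hψ.continuous.continuousAt
  have hde : deriv (fun t => ∫ s in (0 : ℝ)..t, ψ s) = ψ := funext fun x => (hd x).deriv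
  have hcomp : IsCompact (tsupport ψ) :=
    Metric.isCompact_of_isClosed_isBounded (isClosed_tsupport ψ)
      ((Metric.isBounded_Ioo 0 1).subset hψ.2)
  obtain ⟨a, b, ha, hb, hab⟩ : ∃ a b : ℝ, 0 < a ∧ b < 1 ∧ tsupport ψ ⊆ Set.Icc a b := by
    rcases (tsupport ψ).eq_empty_or_nonempty with he | hne
    · exact ⟨1, 0, one_pos, one_pos, by rw [he]; exact Set.empty_subset _⟩
    · obtain ⟨a, ha, ha'⟩ := hcomp.exists_isLeast hne
      obtain ⟨b, hb, hb'⟩ := hcomp.exists_isGreatest hne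
      exact ⟨a, b, (hψ.2 ha).1, (hψ.2 hb).2, fun x hx => ⟨ha' hx, hb' hx⟩⟩
  have hz : ∀ x, x ∉ Set.Icc a b → ψ x = 0 := fun x hx => by
    by_contra hne
    exact hx (hab (subset_tsupport ψ hne))
  refine ⟨fun t => ∫ s in (0 : ℝ)..t, ψ s, ⟨?_, ?_⟩, hde⟩
  · rw [contDiff_infty_iff_deriv, hde]
    exact ⟨fun x => (hd x).differentiableAt, hψ.1⟩
  · refine (closure_minimal ?_ isClosed_Icc).trans
      (fun x (hx : x ∈ Set.Icc a b) => ⟨ha.trans_le hx.1, hx.2.trans_lt hb⟩)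
    intro x hx
    by_contra hx'
    apply hx
    change ∫ s in (0 : ℝ)..x, ψ s = 0
    rcases lt_or_ge x a with h | h
    · refine intervalIntegral.integral_zero_ae (ae_of_all _ fun t ht => hz t fun ht' => ?_)
      have := ht.2
      rcases le_max_iff.1 this with h1 | h1 <;> linarith [ht'.1]
    · have hbx : b < x := by
        by_contra hbx
        exact hx' ⟨h, not_lt.1 hbx⟩
      have : ∫ s in x..(1 : ℝ), ψ s = 0 := by
        refine intervalIntegral.integral_zero_ae (ae_of_all _ fun t ht => hz t fun ht' => ?_)
        rcases min_lt_iff.1 ht.1 with h1 | h1 <;> linarith [ht'.2]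
      rw [← intervalIntegral.integral_add_adjacent_intervals
        (hψ.continuous.intervalIntegrable 0 x) (hψ.continuous.intervalIntegrable x 1), this,
        add_zero] at h0
      exact h0

lemma exists_test : ∃ φ : ℝ → ℝ, IsTest φ ∧ ∫ x in (0 : ℝ)..1, φ x = 1 := by
  let f : ContDiffBump (1 / 2 : ℝ) := ⟨1 / 8, 1 / 4, by norm_num, by norm_num⟩
  have hs : tsupport (f.normed volume) ⊆ Set.Ioo 0 1 := by
    rw [f.tsupport_normed_eq, Real.closedBall_eq_Icc]
    intro x hx
    change 1 / 2 - 1 / 4 ≤ x ∧ x ≤ 1 / 2 + 1 / 4 at hx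
    exact ⟨by linarith [hx.1], by linarith [hx.2]⟩
  refine ⟨f.normed volume, ⟨f.contDiff_normed, hs⟩, ?_⟩
  rw [intervalIntegral.integral_eq_integral_of_support_subset, f.integral_normed]
  exact (subset_tsupport _).trans (hs.trans Set.Ioo_subset_Ioc_self)

instance : (volume : Measure I).IsOpenPosMeasure where
  open_pos U hU hne := by
    obtain ⟨V, hV, rfl⟩ := isOpen_induced_iff.1 hU
    obtain ⟨x, hx⟩ := hne
    have hcl : (x : ℝ) ∈ closure (Set.Ioo (0 : ℝ) 1) := by
      rw [closure_Ioo zero_ne_one]; exact x.2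
    have hne' : (V ∩ Set.Ioo (0 : ℝ) 1).Nonempty := mem_closure_iff.1 hcl V hV hx
    have hpos := (hV.inter isOpen_Ioo).measure_pos volume hne'
    rw [unitInterval.volume_apply]
    refine (hpos.trans_le (measure_mono ?_)).ne'
    rintro y ⟨hy, hy'⟩
    exact ⟨⟨y, Set.Ioo_subset_Icc_self hy'⟩, hy, rfl⟩

lemma toL2_injective : Function.Injective toL2 :=
  ContinuousMap.toLp_injective (volume : Measure I)

lemma integral_smul_const_I {φ : ℝ → ℝ} (c : ℂ) :
    ∫ x : I, φ x • c = (∫ x in (0 : ℝ)..1, φ x) • c := by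
  rw [integral_smul_const, intervalIntegral.integral_of_le zero_le_one,
    ← integral_Icc_eq_integral_Ioc]
  congr 1
  exact integral_subtype measurableSet_Icc φ

lemma hasWeakDeriv_zero_unique {g : L2} (h : HasWeakDeriv 0 g) : g = 0 := by
  have hg : Integrable (fun x : I => g x) := (Lp.memLp g).integrable (by norm_num)
  have := ae_eq_zero_of_test hg fun φ hφ => by
    have := h φ hφ
    simpa using this
  exact Lp.ext (this.trans (Lp.coeFn_zero ℂ 2 (volume : Measure I)).symm)

/-- A continuous function on `[0,1]` whose weak derivative vanishes and which vanishes at `0` is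
zero. -/
lemma eq_zero_of_hasWeakDeriv_zero {u : C(I, ℂ)} (hu : HasWeakDeriv u 0) (h0 : u 0 = 0) :
    u = 0 := by
  have hu' : ∀ φ : ℝ → ℝ, IsTest φ → ∫ x : I, deriv φ x • u x = 0 := by
    intro φ hφ
    rw [hu φ hφ, neg_eq_zero]
    refine integral_eq_zero_of_ae ?_
    filter_upwards [Lp.coeFn_zero ℂ 2 (volume : Measure I)] with x hx
    rw [hx, Pi.zero_apply]
    exact smul_zero _
  obtain ⟨e, he, he1⟩ := exists_test
  set c : ℂ := ∫ x : I, e x • u x with hc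
  have hae : (fun x : I => u x - c) =ᵐ[volume] 0 := by
    refine ae_eq_zero_of_test ?_ ?_
    · exact Continuous.integrable_of_hasCompactSupport (by fun_prop)
        (HasCompactSupport.of_compactSpace _)
    intro φ hφ
    set m : ℝ := ∫ x in (0 : ℝ)..1, φ x with hm
    have hψ : IsTest (fun x => φ x - m * e x) := by
      refine ⟨hφ.1.sub (contDiff_const.mul he.1), ?_⟩
      refine (tsupport_sub φ (fun x => m * e x)).trans (Set.union_subset hφ.2 ?_)
      exact (tsupport_mul_subset_right (f := fun _ => m) (g := e)).trans he.2
    have hme : Continuous fun x => m * e x := continuous_const.mul he.continuous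
    obtain ⟨Φ, hΦ, hΦ'⟩ := exists_primitive hψ (by
      rw [intervalIntegral.integral_sub (hφ.continuous.intervalIntegrable _ _)
        (hme.intervalIntegrable _ _),
        intervalIntegral.integral_const_mul, he1, ← hm, mul_one, sub_self])
    have h1 := hu' Φ hΦ
    rw [hΦ'] at h1
    have h2 : ∫ x : I, (φ x - m * e x) • u x
        = (∫ x : I, φ x • u x) - m • ∫ x : I, e x • u x := by
      have i2 : Integrable (fun x : I => m • e x • u x) :=
        (integrable_smul_cont he.continuous u).smul m
      rw [← integral_smul, ← integral_sub (integrable_smul_cont hφ.continuous u) i2]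
      congr 1; ext x; rw [sub_smul, mul_smul]
    simp only [smul_sub]
    have i3 : Integrable (fun x : I => φ x • c) :=
      integrable_smul_cont hφ.continuous (ContinuousMap.const I c)
    rw [integral_sub (integrable_smul_cont hφ.continuous u) i3, integral_smul_const_I, ← hm]
    rw [h1, ← hc] at h2
    exact h2.symm
  have hcont : ∀ x : I, u x = c := by
    have := (Continuous.ae_eq_iff_eq (volume : Measure I) (f := fun x : I => u x - c)
      (g := fun _ => 0) (by fun_prop) continuous_const).1 hae
    intro x
    exact sub_eq_zero.1 (congrFun this x)
  ext x
  rw [hcont x, ← hcont 0, h0]; rfl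

lemma H1.eq_zero_of_fn {u : H1} (h : H1.fn u = 0) : u = 0 := by
  obtain ⟨⟨u, g⟩, hu⟩ := u
  change toL2 u = 0 at h
  have hu0 : u = 0 := toL2_injective (h.trans (map_zero toL2).symm)
  subst hu0
  have hg : g = 0 := hasWeakDeriv_zero_unique hu
  subst hg
  rfl

lemma H1L.eq_zero_of_dx {u : H1L} (h : H1.dx u.1 = 0) : u = 0 := by
  obtain ⟨⟨⟨u, g⟩, hu⟩, h0⟩ := u
  change g = 0 at h
  subst h
  have : u = 0 := eq_zero_of_hasWeakDeriv_zero hu h0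
  subst this
  rfl

/-! ### The energy space -/

/-- The positive constants `b`, `k₁`, `k₃` on which the energy depends. -/
structure Params where
  b : ℝ
  k₁ : ℝ
  k₃ : ℝ
  b_pos : 0 < b
  k₁_pos : 0 < k₁
  k₃_pos : 0 < k₃

/-- The energy space `H¹_L × L² × H¹_L × L² × ℂ × ℂ`, to be normed by the energy. -/
def Energy (_p : Params) : Type := H1L × L2 × H1L × L2 × ℂ × ℂ

namespace Energy

variable {p : Params}

instance : AddCommGroup (Energy p) := inferInstanceAs (AddCommGroup (H1L × L2 × H1L × L2 × ℂ × ℂ))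

instance : Module ℂ (Energy p) := inferInstanceAs (Module ℂ (H1L × L2 × H1L × L2 × ℂ × ℂ))

/-- The displacement. -/
def u (U : Energy p) : H1 := (U.1 : H1)

/-- The velocity. -/
def v (U : Energy p) : L2 := U.2.1

/-- The rotation angle. -/
def y (U : Energy p) : H1 := (U.2.2.1 : H1)

/-- The angular velocity. -/
def z (U : Energy p) : L2 := U.2.2.2.1

/-- The boundary velocity. -/
def η (U : Energy p) : ℂ := U.2.2.2.2.1

/-- The boundary angular velocity. -/
def γ (U : Energy p) : ℂ := U.2.2.2.2.2

/-- The energy inner product for the wave speed ratio `a = 1`, conjugate linear in the first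
argument. The weight `(b k₃)⁻¹` of the last term is the one for which the boundary terms of the
conservative system cancel:
`∫₀¹ (v̄ v₁ + b⁻¹ z̄ z₁ + b⁻¹ ȳₓ y₁ₓ + (ūₓ + ȳ) (u₁ₓ + y₁)) dx + k₁⁻¹ η̄ η₁ + (b k₃)⁻¹ γ̄ γ₁`. -/
def ip (U U₁ : Energy p) : ℂ :=
  inner ℂ U.v U₁.v + (p.b : ℂ)⁻¹ * inner ℂ U.z U₁.z + (p.b : ℂ)⁻¹ * inner ℂ (H1.dx U.y) (H1.dx U₁.y)
    + inner ℂ (H1.dx U.u + H1.fn U.y) (H1.dx U₁.u + H1.fn U₁.y)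
    + (p.k₁ : ℂ)⁻¹ * inner ℂ U.η U₁.η + ((p.b : ℂ) * (p.k₃ : ℂ))⁻¹ * inner ℂ U.γ U₁.γ

section
variable (U V : Energy p) (c : ℂ)

lemma u_add : (U + V).u = U.u + V.u := rfl
lemma y_add : (U + V).y = U.y + V.y := rfl
lemma u_smul : (c • U).u = c • U.u := rfl
lemma y_smul : (c • U).y = c • U.y := rfl
lemma zero_eq : (0 : Energy p).u = 0 ∧ (0 : Energy p).v = 0 ∧ (0 : Energy p).y = 0 ∧
    (0 : Energy p).z = 0 ∧ (0 : Energy p).η = 0 ∧ (0 : Energy p).γ = 0 :=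
  ⟨rfl, rfl, rfl, rfl, rfl, rfl⟩
lemma u_dx_add : H1.dx (U + V).u = H1.dx U.u + H1.dx V.u := rfl
lemma y_dx_add : H1.dx (U + V).y = H1.dx U.y + H1.dx V.y := rfl
lemma y_fn_add : H1.fn (U + V).y = H1.fn U.y + H1.fn V.y := map_add H1.fn U.y V.y
lemma v_add : (U + V).v = U.v + V.v := rfl
lemma z_add : (U + V).z = U.z + V.z := rfl
lemma η_add : (U + V).η = U.η + V.η := rfl
lemma γ_add : (U + V).γ = U.γ + V.γ := rfl
lemma u_dx_smul : H1.dx (c • U).u = c • H1.dx U.u := rfl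
lemma y_dx_smul : H1.dx (c • U).y = c • H1.dx U.y := rfl
lemma y_fn_smul : H1.fn (c • U).y = c • H1.fn U.y := map_smul H1.fn c U.y
lemma v_smul : (c • U).v = c • U.v := rfl
lemma z_smul : (c • U).z = c • U.z := rfl
lemma η_smul : (c • U).η = c • U.η := rfl
lemma γ_smul : (c • U).γ = c • U.γ := rfl

lemma ip_self : ip U U = ((‖U.v‖ ^ 2 + p.b⁻¹ * ‖U.z‖ ^ 2 + p.b⁻¹ * ‖H1.dx U.y‖ ^ 2
    + ‖H1.dx U.u + H1.fn U.y‖ ^ 2 + p.k₁⁻¹ * ‖U.η‖ ^ 2 + (p.b * p.k₃)⁻¹ * ‖U.γ‖ ^ 2 : ℝ) : ℂ) := by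
  simp only [ip, inner_self_eq_norm_sq_to_K]
  push_cast
  rfl

lemma ip_definite (h : ip U U = 0) : U = 0 := by
  rw [ip_self, Complex.ofReal_eq_zero] at h
  have hb := inv_pos.2 p.b_pos
  have hk := inv_pos.2 p.k₁_pos
  have hk3 := inv_pos.2 (mul_pos p.b_pos p.k₃_pos)
  have a1 := sq_nonneg ‖U.v‖
  have a2 := mul_nonneg hb.le (sq_nonneg ‖U.z‖)
  have a3 := mul_nonneg hb.le (sq_nonneg ‖H1.dx U.y‖)
  have a4 := sq_nonneg ‖H1.dx U.u + H1.fn U.y‖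
  have a5 := mul_nonneg hk.le (sq_nonneg ‖U.η‖)
  have a6 := mul_nonneg hk3.le (sq_nonneg ‖U.γ‖)
  have e1 : U.v = 0 := by
    rw [← norm_eq_zero, ← sq_eq_zero_iff]; linarith
  have e2 : U.z = 0 := by
    have : p.b⁻¹ * ‖U.z‖ ^ 2 = 0 := by linarith
    simpa [hb.ne', p.b_pos.ne'] using this
  have e3 : H1.dx U.y = 0 := by
    have : p.b⁻¹ * ‖H1.dx U.y‖ ^ 2 = 0 := by linarith
    simpa [hb.ne', p.b_pos.ne'] using this
  have e4 : H1.dx U.u + H1.fn U.y = 0 := by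
    rw [← norm_eq_zero, ← sq_eq_zero_iff]; linarith
  have e5 : U.η = 0 := by
    have : p.k₁⁻¹ * ‖U.η‖ ^ 2 = 0 := by linarith
    simpa [hk.ne', p.k₁_pos.ne'] using this
  have e6 : U.γ = 0 := by
    have : (p.b * p.k₃)⁻¹ * ‖U.γ‖ ^ 2 = 0 := by linarith
    simpa [p.b_pos.ne', p.k₃_pos.ne'] using this
  obtain ⟨u, v, y, z, η, γ⟩ := U
  change v = 0 at e1
  change z = 0 at e2
  change η = 0 at e5
  change γ = 0 at e6
  have hy : y = 0 := H1L.eq_zero_of_dx e3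
  subst hy
  have hu : u = 0 := by
    refine H1L.eq_zero_of_dx ?_
    change H1.dx u.1 + H1.fn 0 = 0 at e4
    simpa using e4
  subst hu e1 e2 e5 e6
  rfl

end

/-- The energy inner product space structure. -/
abbrev core : InnerProductSpace.Core ℂ (Energy p) where
  inner := ip
  conj_inner_symm U V := by
    simp only [ip, map_add, map_mul, map_inv₀, Complex.conj_ofReal, inner_conj_symm]
  re_inner_nonneg U := by
    change 0 ≤ Complex.re (ip U U)
    rw [ip_self, Complex.ofReal_re]
    have := p.b_pos
    have := p.k₁_pos
    have := p.k₃_pos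
    positivity
  add_left U V W := by
    simp only [ip, u_dx_add, y_dx_add, y_fn_add, v_add, z_add, η_add, γ_add, inner_add_left]
    ring
  smul_left U V c := by
    simp only [ip, u_dx_smul, y_dx_smul, y_fn_smul, v_smul, z_smul, η_smul, γ_smul,
      ← smul_add, inner_smul_left]
    ring
  definite U h := ip_definite U h

instance : NormedAddCommGroup (Energy p) :=
  @InnerProductSpace.Core.toNormedAddCommGroup ℂ (Energy p) _ _ _ core

instance : InnerProductSpace ℂ (Energy p) := InnerProductSpace.ofCore core.toCore

lemma inner_eq (U V : Energy p) : inner ℂ U V = ip U V := rfl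

end Energy

/-! ### The Timoshenko operator -/

/-- `(U, F)` belongs to the graph of the operator with damping constants `k₂`, `k₄`: there are
`uₓ, yₓ ∈ H¹` (so `u, y ∈ H²`) and `v, z ∈ H¹_L` with `η = v(1)`, `γ = z(1)`, and
`F = (v, (uₓ + y)ₓ, z, yₓₓ - b (uₓ + y), -k₁ (uₓ(1) + y(1)) - k₂ η, -k₃ yₓ(1) - k₄ γ)`. -/
def OpRel (p : Params) (k₂ k₄ : ℝ) (U F : Energy p) : Prop :=
  ∃ ux yx : H1, H1.fn ux = H1.dx U.u ∧ H1.fn yx = H1.dx U.y ∧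
    H1.fn F.u = U.v ∧ H1.fn F.y = U.z ∧ U.η = H1.ev 1 F.u ∧ U.γ = H1.ev 1 F.y ∧
    F.v = H1.dx (ux + U.y) ∧
    F.z = H1.dx yx - (p.b : ℂ) • H1.fn (ux + U.y) ∧
    F.η = -(p.k₁ : ℂ) * (H1.ev 1 ux + H1.ev 1 U.y) - (k₂ : ℂ) * U.η ∧
    F.γ = -(p.k₃ : ℂ) * H1.ev 1 yx - (k₄ : ℂ) * U.γ

/-- The graph of the operator, as a subspace. -/
def opGraph (p : Params) (k₂ k₄ : ℝ) : Submodule ℂ (Energy p × Energy p) where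
  carrier := {q | OpRel p k₂ k₄ q.1 q.2}
  zero_mem' := ⟨0, 0, by simp [Energy.zero_eq]⟩
  add_mem' := by
    rintro ⟨U, F⟩ ⟨U', F'⟩ ⟨ux, yx, h1, h2, h3, h4, h5, h6, h7, h8, h9, h10⟩
      ⟨ux', yx', h1', h2', h3', h4', h5', h6', h7', h8', h9', h10'⟩
    simp only at h1 h2 h3 h4 h5 h6 h7 h8 h9 h10 h1' h2' h3' h4' h5' h6' h7' h8' h9' h10'
    refine ⟨ux + ux', yx + yx', ?_, ?_, ?_, ?_, ?_, ?_, ?_, ?_, ?_, ?_⟩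
    all_goals simp only [Prod.mk_add_mk, Energy.u_add, Energy.y_add, Energy.v_add, Energy.z_add,
      Energy.η_add, Energy.γ_add, map_add, *]
    · abel
    · simp only [smul_add]; abel
    · ring
    · ring
  smul_mem' := by
    rintro c ⟨U, F⟩ ⟨ux, yx, h1, h2, h3, h4, h5, h6, h7, h8, h9, h10⟩
    simp only at h1 h2 h3 h4 h5 h6 h7 h8 h9 h10
    refine ⟨c • ux, c • yx, ?_, ?_, ?_, ?_, ?_, ?_, ?_, ?_, ?_, ?_⟩
    all_goals simp only [Prod.smul_mk, Energy.u_smul, Energy.y_smul, Energy.v_smul, Energy.z_smul,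
      Energy.η_smul, Energy.γ_smul, map_smul, map_add, smul_add, smul_sub, smul_eq_mul, *]
    · rw [smul_comm c, smul_comm c]
    · ring
    · ring

/-- The operator `𝒜` (for `a = 1`) with damping constants `k₂`, `k₄`; the conservative operator
`𝒜₀` is the one for `k₂ = k₄ = 0`. Its domain is the `U = (u,v,y,z,η,γ)` such
that `u, y ∈ H²`, `v, z ∈ H¹_L`, `η = v(1)`, `γ = z(1)`. -/
def op (p : Params) (k₂ k₄ : ℝ) : Energy p →ₗ.[ℂ] Energy p := (opGraph p k₂ k₄).toLinearPMap

lemma opRel_unique {p : Params} {k₂ k₄ : ℝ} {F : Energy p} (h : OpRel p k₂ k₄ 0 F) : F = 0 := by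
  obtain ⟨ux, yx, h1, h2, h3, h4, h5, h6, h7, h8, h9, h10⟩ := h
  obtain ⟨e1, e2, e3, e4, e5, e6⟩ := Energy.zero_eq (p := p)
  rw [e1, map_zero] at h1
  rw [e3, map_zero] at h2
  rw [e2] at h3
  rw [e4] at h4
  have hux := H1.eq_zero_of_fn h1
  have hyx := H1.eq_zero_of_fn h2
  have hu := H1.eq_zero_of_fn h3
  have hy := H1.eq_zero_of_fn h4
  subst hux hyx
  rw [e3] at h7 h8 h9
  rw [e5] at h9
  rw [e6] at h10
  simp only [add_zero, map_zero, smul_zero, sub_zero, mul_zero] at h7 h8 h9 h10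
  obtain ⟨u, v, y, z, η, γ⟩ := F
  have hu' : u = 0 := Subtype.ext hu
  have hy' : y = 0 := Subtype.ext hy
  change v = 0 at h7
  change z = 0 at h8
  change η = 0 at h9
  change γ = 0 at h10
  subst hu' hy' h7 h8 h9 h10
  rfl

/-- The relation `OpRel` is indeed the graph of the operator. -/
lemma mem_graph_op {p : Params} {k₂ k₄ : ℝ} {U F : Energy p} :
    (U, F) ∈ (op p k₂ k₄).graph ↔ OpRel p k₂ k₄ U F := by
  rw [op, Submodule.toLinearPMap_graph_eq]
  · rfl
  · rintro ⟨U, F⟩ h h0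
    change U = 0 at h0
    subst h0
    exact opRel_unique h

end Timoshenko

/-! ### Spectral notions for unbounded operators -/

namespace LinearPMap

variable {H : Type*} [NormedAddCommGroup H] [InnerProductSpace ℂ H]

/-- `c` is in the resolvent set: `c - T` maps the domain of `T` bijectively onto the whole space
and its inverse `R` is bounded. -/
def InResolventSet (T : H →ₗ.[ℂ] H) (c : ℂ) : Prop :=
  ∃ R : H →L[ℂ] H, (∀ f : H, ∃ h : R f ∈ T.domain, c • R f - T ⟨R f, h⟩ = f) ∧
    ∀ x : T.domain, R (c • (x : H) - T x) = x

/-- The spectrum of an unbounded operator. -/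
def unboundedSpectrum (T : H →ₗ.[ℂ] H) : Set ℂ := {c | ¬ T.InResolventSet c}

/-- The operator `T - c` on the domain of `T`. -/
def shift (T : H →ₗ.[ℂ] H) (c : ℂ) : T.domain →ₗ[ℂ] H := T.toFun - c • T.domain.subtype

/-- The kernel of `(T - c) ^ n`, the domain of the power being the natural one. -/
def kerPow (T : H →ₗ.[ℂ] H) (c : ℂ) : ℕ → Submodule ℂ H
  | 0 => ⊥
  | n + 1 => ((kerPow T c n).comap (T.shift c)).map T.domain.subtype

/-- The eigenspace `ker (T - c)`; its dimension is the geometric multiplicity of `c`. -/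
def eigenspace (T : H →ₗ.[ℂ] H) (c : ℂ) : Submodule ℂ H :=
  (LinearMap.ker (T.shift c)).map T.domain.subtype

/-- The space of generalized eigenvectors, the union of all `ker ((T - c) ^ n)`; its dimension is
the algebraic multiplicity of `c`. -/
def rootSpace (T : H →ₗ.[ℂ] H) (c : ℂ) : Submodule ℂ H := ⨆ n, T.kerPow c n

/-- `c` has finite algebraic multiplicity `m`. -/
def HasAlgMult (T : H →ₗ.[ℂ] H) (c : ℂ) (m : ℕ) : Prop :=
  Module.Finite ℂ (T.rootSpace c) ∧ Module.finrank ℂ (T.rootSpace c) = m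

/-- `c` has finite geometric multiplicity `n`. -/
def HasGeomMult (T : H →ₗ.[ℂ] H) (c : ℂ) (n : ℕ) : Prop :=
  Module.Finite ℂ (T.eigenspace c) ∧ Module.finrank ℂ (T.eigenspace c) = n

/-- `T* = -T`: the domain is dense, and `y` is in the domain of the adjoint with `T* y = w`
(that is, `⟪T x, y⟫ = ⟪x, w⟫` for all `x` in the domain) exactly when `y` is in the domain of `T`
and `-T y = w`. -/
def IsSkewAdjoint (T : H →ₗ.[ℂ] H) : Prop :=
  Dense (T.domain : Set H) ∧ ∀ y w : H,
    (∀ x : T.domain, inner ℂ (T x) y = inner ℂ (x : H) w) ↔ ∃ h : y ∈ T.domain, -T ⟨y, h⟩ = w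

/-- The vectors `ψ 1, …, ψ d` form a Jordan chain of length `d` for `T` at `c`:
`(T - c) ψ l = ψ (l - 1)` for `1 ≤ l ≤ d`, where `ψ 0 = 0`. -/
def IsJordanChain (T : H →ₗ.[ℂ] H) (c : ℂ) (d : ℕ) (ψ : ℕ → H) : Prop :=
  ψ 0 = 0 ∧ ∀ l < d, ∃ h : ψ (l + 1) ∈ T.domain, T ⟨ψ (l + 1), h⟩ - c • ψ (l + 1) = ψ l

/-- The spectrum of `T` splits into the finite set of the distinct points `κ i`, of finite algebraic
multiplicity `m i ≥ 1`, and two families of further points `μ j k`, `j = 0, 1`, `k ∈ ℤ`,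
`|k| ≥ k₀`, pairwise distinct and of algebraic multiplicity one, with `μ j k = i k π + o(1)` as
`|k| → ∞`. -/
structure SpectrumSplits (T : H →ₗ.[ℂ] H) (k₀ : ℕ) {N : ℕ} (κ : Fin N → ℂ) (m : Fin N → ℕ)
    (μ : Fin 2 → ℤ → ℂ) : Prop where
  spectrum_eq : T.unboundedSpectrum = Set.range κ ∪ {c | ∃ j k, (k₀ : ℤ) ≤ |k| ∧ c = μ j k}
  finite_injective : Function.Injective κ
  family_injective : ∀ j k j' k', (k₀ : ℤ) ≤ |k| → (k₀ : ℤ) ≤ |k'| → μ j k = μ j' k' →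
    j = j' ∧ k = k'
  disjoint : ∀ i j k, (k₀ : ℤ) ≤ |k| → κ i ≠ μ j k
  one_le_mult : ∀ i, 1 ≤ m i
  finite_mult : ∀ i, T.HasAlgMult (κ i) (m i)
  family_simple : ∀ j k, (k₀ : ℤ) ≤ |k| → T.HasAlgMult (μ j k) 1
  asymptotics : ∀ j, Tendsto (fun k : ℤ => μ j k - Complex.I * k * Real.pi) cofinite (𝓝 0)

end LinearPMap

end

noncomputable section

namespace Timoshenko

/-! ### Primitives of square integrable functions -/

/-! Both operators are treated at once as `op p k₂ k₄`. The equation `𝒜 U = F` is solved by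
integrating twice, so the operator has an everywhere defined inverse `opInv`, which is compact
because primitives of `L²` functions are (`isCompactOperator_prim`, `opRel_iff`). The Riesz theory
of `R = opInv` then gives a spectrum of eigenvalues only, finitely many in each ball, with
finite-dimensional root spaces. Jordan chains come from the structure theorem for modules over
`K[X]`. For `k₂ = k₄ = 0` integration by parts gives `R* = -R`; hence `iR` is compact and
self-adjoint, eigenvectors form an orthonormal basis, and there are no chains of length two.

It remains to locate the large eigenvalues. For an eigenvalue `c` the equation is a linear system
with exponents `±P ± Q`, where `c² = P² + Q²` and `4P²Q² = -bc²`. One exponent `P` is large, the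
other stays near `iβ` with `β = √b/2`. Both `c` and `Q` are holomorphic functions of `P`, with `c -
P → 0`. The two conditions at `1`, imposed on the two explicit solutions vanishing at `0`, give a
determinant which up to a nonvanishing factor is `A sinh² P + P⁻¹ B sinh P cosh P + P⁻² C cosh² P`,
with `A`, `B`, `C` holomorphic in `1/P` near `0` and `A(0) = 1` (`sinhQuad_factor`).

Near `ikπ` this form splits into two factors `sinh P - Tⱼ(P) cosh P` with `Tⱼ = O(1/k)`, provided
the discriminant `B² - 4AC` has a holomorphic square root there. Each factor has one zero, a fixed
point of `P = ikπ + artanh Tⱼ(P)`. The two zeros are distinct and simple because the discriminant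
does not vanish. Since it may vanish at `1/P = 0`, the identity theorem is used to show that it is
not identically zero (`disc_eventually_ne_zero`).

A simple zero of the determinant is an algebraically simple eigenvalue: Lagrange's identity shows
that an associated vector would force the eigenvector to have zero Cauchy data at `1`
(`boundary_pairing_eq_zero`, `algMult_of_simple_zero`). All eigenvalues outside the two families
form a finite set. -/

lemma integral_I_eq_intervalIntegral (f : ℝ → ℂ) : ∫ x : I, f x = ∫ x in (0 : ℝ)..1, f x := by
  rw [integral_I, intervalIntegral.integral_of_le zero_le_one, integral_Icc_eq_integral_Ioc]

lemma toL2_denseRange : DenseRange toL2 :=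
  ContinuousMap.toLp_denseRange ℂ (volume : Measure I) ℂ (by norm_num)

lemma coeFn_toL2 (f : C(I, ℂ)) : (toL2 f : I → ℂ) =ᵐ[volume] f :=
  ContinuousMap.coeFn_toLp (p := 2) (𝕜 := ℂ) volume f

/-- The indicator function of `[0,x]`. -/
def ind (x : I) : L2 := indicatorConstLp 2 measurableSet_Iic (measure_ne_top volume (Set.Iic x)) 1

lemma inner_ind_ind (x y : I) : inner ℂ (ind x) (ind y) = ((min x y : I) : ℂ) := by
  rw [ind, ind, L2.inner_indicatorConstLp_one_indicatorConstLp_one, Set.Iic_inter_Iic,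
    Measure.real, unitInterval.volume_Iic, ENNReal.toReal_ofReal (min x y).2.1]
  rfl

/-- The Gram matrix is `min x y`, and `x + y - 2 min x y = |x - y|`. This Hölder modulus of exponent
`1/2` is the source of both the continuity and the equicontinuity of primitives. -/
lemma norm_ind_sub_sq (x y : I) : ‖ind x - ind y‖ ^ 2 = |(x : ℝ) - y| := by
  have h : ((‖ind x - ind y‖ ^ 2 : ℝ) : ℂ) = ((|(x : ℝ) - y| : ℝ) : ℂ) := by
    have := inner_self_eq_norm_sq_to_K (𝕜 := ℂ) (ind x - ind y)
    push_cast
    refine this.symm.trans ?_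
    rw [inner_sub_left, inner_sub_right, inner_sub_right, inner_ind_ind, inner_ind_ind,
      inner_ind_ind, inner_ind_ind, min_self, min_self, min_comm y x]
    rcases le_total x y with h | h
    · rw [min_eq_left h, abs_of_nonpos (sub_nonpos.2 (Subtype.coe_le_coe.2 h))]; push_cast; ring
    · rw [min_eq_right h, abs_of_nonneg (sub_nonneg.2 (Subtype.coe_le_coe.2 h))]; push_cast; ring
  exact_mod_cast h

lemma norm_ind_sub (x y : I) : ‖ind x - ind y‖ = √(dist x y) := by
  rw [← Real.sqrt_sq (norm_nonneg (ind x - ind y)), norm_ind_sub_sq]; rfl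

lemma continuous_ind : Continuous ind := by
  rw [continuous_iff_continuousAt]
  intro y
  rw [ContinuousAt, tendsto_iff_norm_sub_tendsto_zero]
  simp only [norm_ind_sub]
  have : Tendsto (fun x => √(dist x y)) (𝓝 y) (𝓝 √(dist y y)) :=
    Continuous.tendsto (by fun_prop) y
  simpa using this

lemma norm_ind_le (x : I) : ‖ind x‖ ≤ 1 := by
  have h : ((‖ind x‖ ^ 2 : ℝ) : ℂ) = ((x : ℝ) : ℂ) := by
    have := inner_self_eq_norm_sq_to_K (𝕜 := ℂ) (ind x)
    rw [inner_ind_ind, min_self] at this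
    push_cast
    exact this.symm
  have h' : ‖ind x‖ ^ 2 = x := by exact_mod_cast h
  have := x.2.2
  nlinarith [norm_nonneg (ind x)]

/-- The primitive vanishing at `0` of a square integrable function. -/
def prim : L2 →L[ℂ] C(I, ℂ) :=
  LinearMap.mkContinuous
    -- Writing `∫₀ˣ g` as an inner product makes continuity in `x` a consequence of
    -- `continuous_ind`, and the bound a case of Cauchy-Schwarz.
    { toFun := fun g => ⟨fun x => inner ℂ (ind x) g, continuous_ind.inner continuous_const⟩
      map_add' := fun g h => by ext x; exact inner_add_right (𝕜 := ℂ) (ind x) g h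
      map_smul' := fun c g => by ext x; exact inner_smul_right (𝕜 := ℂ) (ind x) g c } 1 (by
    intro g
    rw [one_mul, ContinuousMap.norm_le _ (norm_nonneg g)]
    intro x
    exact (norm_inner_le_norm _ _).trans
      (mul_le_of_le_one_left (norm_nonneg _) (norm_ind_le x)))

lemma prim_apply (g : L2) (x : I) : prim g x = inner ℂ (ind x) g := rfl

lemma prim_zero (g : L2) : prim g 0 = 0 := by
  have : ind 0 = 0 := by
    have h := inner_ind_ind 0 0
    rw [min_self] at h
    exact inner_self_eq_zero.1 (h.trans (by simp))
  rw [prim_apply, this, inner_zero_left]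

lemma ind_one : ind 1 = toL2 (ContinuousMap.const I 1) := by
  refine Lp.ext ?_
  refine indicatorConstLp_coeFn.trans (EventuallyEq.trans ?_ (coeFn_toL2 _).symm)
  refine ae_of_all _ fun x => ?_
  exact Set.indicator_of_mem (Set.mem_Iic.2 le_one') _

lemma toL2_const (c : ℂ) : toL2 (ContinuousMap.const I c) = c • ind 1 := by
  rw [ind_one, ← map_smul]
  congr 1
  ext x
  simp

lemma prim_toL2 {F : ℝ → ℂ} (f : C(I, ℂ)) (hf : ∀ x : I, f x = F x) (x : I) :
    prim (toL2 f) x = ∫ t in (0 : ℝ)..x, F t := by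
  rw [prim_apply, ind, L2.inner_indicatorConstLp_one]
  have h1 : ∫ t in Set.Iic x, toL2 f t = ∫ t in Set.Iic x, f t :=
    integral_congr_ae (ae_restrict_of_ae (coeFn_toL2 f))
  rw [h1, ← integral_indicator measurableSet_Iic]
  have h2 : ∀ t : I, (Set.Iic x).indicator f t = (Set.Iic (x : ℝ)).indicator F t := by
    intro t
    by_cases ht : t ≤ x
    · rw [Set.indicator_of_mem (Set.mem_Iic.2 ht),
        Set.indicator_of_mem (Set.mem_Iic.2 (Subtype.coe_le_coe.2 ht)), hf]
    · rw [Set.indicator_of_notMem (by simpa using ht),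
        Set.indicator_of_notMem (by simpa using ht)]
  simp only [h2]
  rw [integral_I, setIntegral_indicator measurableSet_Iic,
    intervalIntegral.integral_of_le x.2.1, ← integral_Icc_eq_integral_Ioc]
  congr 2
  ext t
  simp only [Set.mem_inter_iff, Set.mem_Icc, Set.mem_Iic]
  exact ⟨fun h => ⟨h.1.1, h.2⟩, fun h => ⟨⟨h.1, h.2.trans x.2.2⟩, h.2⟩⟩

/-- A real continuous function as an element of `C([0,1])`. -/
def ofRealFun (φ : ℝ → ℝ) (hφ : Continuous φ) : C(I, ℂ) := ⟨fun x => (φ x : ℂ), by fun_prop⟩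

lemma integral_smul_eq_inner {φ : ℝ → ℝ} (hφ : Continuous φ) (g : L2) :
    ∫ x : I, φ x • g x = inner ℂ (toL2 (ofRealFun φ hφ)) g := by
  rw [L2.inner_def]
  refine integral_congr_ae ?_
  filter_upwards [coeFn_toL2 (ofRealFun φ hφ)] with x hx
  rw [hx]
  simp [ofRealFun, mul_comm]

lemma hasWeakDeriv_iff {u : C(I, ℂ)} {g : L2} : HasWeakDeriv u g ↔
    ∀ (φ : ℝ → ℝ) (h : IsTest φ), inner ℂ (toL2 (ofRealFun (deriv φ) h.continuous_deriv)) (toL2 u)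
      = - inner ℂ (toL2 (ofRealFun φ h.continuous)) g := by
  have : ∀ (φ : ℝ → ℝ) (h : IsTest φ), (∫ x : I, (deriv φ (x : ℝ) : ℝ) • u x)
      = inner ℂ (toL2 (ofRealFun (deriv φ) h.continuous_deriv)) (toL2 u) := by
    intro φ h
    rw [← integral_smul_eq_inner h.continuous_deriv]
    refine integral_congr_ae ?_
    filter_upwards [coeFn_toL2 u] with x hx
    rw [hx]
  refine forall_congr' fun φ => forall_congr' fun h => ?_
  rw [this φ h, integral_smul_eq_inner h.continuous]

lemma IsTest.eq_zero {φ : ℝ → ℝ} (h : IsTest φ) {x : ℝ} (hx : x ∉ Set.Ioo (0 : ℝ) 1) : φ x = 0 := by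
  by_contra hne
  exact hx (h.2 (subset_tsupport φ hne))

/-- A classical derivative is a weak derivative. -/
lemma hasWeakDeriv_of_hasDerivAt {U F : ℝ → ℂ} (hF : Continuous F)
    (hU : ∀ x, HasDerivAt U (F x) x) (u f : C(I, ℂ)) (hu : ∀ x : I, u x = U x)
    (hf : ∀ x : I, f x = F x) : HasWeakDeriv u (toL2 f) := by
  intro φ hφ
  have hUc : Continuous U := continuous_iff_continuousAt.2 fun x => (hU x).continuousAt
  have h2 : ∫ x : I, φ x • (toL2 f) x = ∫ x : I, (φ x : ℂ) * F x := by
    refine integral_congr_ae ?_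
    filter_upwards [coeFn_toL2 f] with x hx
    rw [hx, hf]
    simp
  have h1 : ∫ x : I, deriv φ x • u x = ∫ x : I, ((deriv φ x : ℝ) : ℂ) * U x := by
    congr 1; ext x; rw [hu]; simp
  have hd : ∀ x, HasDerivAt (fun t => (φ t : ℂ)) ((deriv φ x : ℝ) : ℂ) x := fun x =>
    ((hφ.1.differentiable (by simp)) x).hasDerivAt.ofReal_comp
  have e1 : ∫ x : I, ((deriv φ x : ℝ) : ℂ) * U x
      = ∫ x in (0 : ℝ)..1, ((deriv φ x : ℝ) : ℂ) * U x :=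
    integral_I_eq_intervalIntegral fun x => ((deriv φ x : ℝ) : ℂ) * U x
  have e2 : ∫ x : I, (φ x : ℂ) * F x = ∫ x in (0 : ℝ)..1, (φ x : ℂ) * F x :=
    integral_I_eq_intervalIntegral fun x => (φ x : ℂ) * F x
  rw [h1, h2, e1, e2, eq_neg_iff_add_eq_zero]
  have c1 : Continuous fun x => ((deriv φ x : ℝ) : ℂ) :=
    Complex.continuous_ofReal.comp hφ.continuous_deriv
  have c2 : Continuous fun x => ((φ x : ℝ) : ℂ) := Complex.continuous_ofReal.comp hφ.continuous
  have e := intervalIntegral.integral_add (μ := volume) ((c1.mul hUc).intervalIntegrable 0 1)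
    ((c2.mul hF).intervalIntegrable 0 1)
  simp only [Pi.mul_apply] at e
  rw [← e, intervalIntegral.integral_deriv_mul_eq_sub (fun x _ => hd x) (fun x _ => hU x)
      (c1.intervalIntegrable _ _) (hF.intervalIntegrable _ _), hφ.eq_zero (by simp),
      hφ.eq_zero (by simp)]
  simp

/-- The extension of a continuous function on `[0,1]` to `ℝ` by constants. -/
def extend (f : C(I, ℂ)) : ℝ → ℂ := Set.IccExtend zero_le_one f

lemma continuous_extend (f : C(I, ℂ)) : Continuous (extend f) := f.continuous.Icc_extend'

lemma extend_apply (f : C(I, ℂ)) (x : I) : extend f x = f x := Set.IccExtend_val zero_le_one f x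

lemma hasDerivAt_primitive {F : ℝ → ℂ} (hF : Continuous F) (x : ℝ) :
    HasDerivAt (fun t => ∫ s in (0 : ℝ)..t, F s) (F x) x :=
  intervalIntegral.integral_hasDerivAt_right (hF.intervalIntegrable _ _)
    hF.aestronglyMeasurable.stronglyMeasurableAtFilter hF.continuousAt

/-- For continuous `g` this is the fundamental theorem of calculus. Both sides of the weak identity
are continuous in `g`, and continuous functions are dense in `L²`. -/
lemma hasWeakDeriv_prim (g : L2) : HasWeakDeriv (prim g) g := by
  refine toL2_denseRange.induction_on g ?_ fun f => ?_
  · simp only [hasWeakDeriv_iff, Set.ofPred_forall]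
    exact isClosed_iInter fun φ => isClosed_iInter fun h =>
      isClosed_eq (by fun_prop) (by fun_prop)
  · exact hasWeakDeriv_of_hasDerivAt (continuous_extend f)
      (hasDerivAt_primitive (continuous_extend f)) _ f
      (fun x => prim_toL2 f (fun t => (extend_apply f t).symm) x) fun x => (extend_apply f x).symm

/-- The function in `H¹_L` with a given derivative. -/
def primL : L2 →ₗ[ℂ] H1L where
  toFun g := ⟨⟨(prim g, g), hasWeakDeriv_prim g⟩, prim_zero g⟩
  map_add' g h := by
    refine Subtype.ext (Subtype.ext (Prod.ext ?_ rfl)); exact map_add prim g h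
  map_smul' c g := by
    refine Subtype.ext (Subtype.ext (Prod.ext ?_ rfl)); exact map_smul prim c g

/-- A constant function. -/
def constH1 (c : ℂ) : H1 := ⟨(ContinuousMap.const I c, 0), by
  have h := hasWeakDeriv_of_hasDerivAt (U := fun _ => c) (F := fun _ => 0) continuous_const
    (fun x => hasDerivAt_const x c) (ContinuousMap.const I c) 0 (fun _ => rfl) (fun _ => rfl)
  rwa [map_zero] at h⟩

lemma dx_primL (g : L2) : H1.dx (primL g).1 = g := rfl
lemma fn_primL (g : L2) : H1.fn (primL g).1 = toL2 (prim g) := rfl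
lemma ev_primL (g : L2) (x : I) : H1.ev x (primL g).1 = prim g x := rfl
lemma dx_constH1 (c : ℂ) : H1.dx (constH1 c) = 0 := rfl
lemma fn_constH1 (c : ℂ) : H1.fn (constH1 c) = c • ind 1 := toL2_const c
lemma ev_constH1 (c : ℂ) (x : I) : H1.ev x (constH1 c) = c := rfl

lemma primL_dx (u : H1L) : primL (H1.dx u.1) = u := by
  rw [← sub_eq_zero]
  refine H1L.eq_zero_of_dx ?_
  change H1.dx ((primL (H1.dx u.1)).1 - u.1) = 0
  rw [map_sub, dx_primL, sub_self]

/-- After subtraction of its value at `0` the function lies in `H1L`, where the derivative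
determines it. Facts about `prim` thereby extend to all of `H1`. -/
lemma H1.eq_const_add_primL (u : H1) : u = constH1 (H1.ev 0 u) + (primL (H1.dx u)).1 := by
  have h : u - constH1 (H1.ev 0 u) ∈ H1L := by
    change H1.ev 0 (u - constH1 (H1.ev 0 u)) = 0
    rw [map_sub, ev_constH1, sub_self]
  have h2 := primL_dx ⟨_, h⟩
  have h3 : H1.dx (u - constH1 (H1.ev 0 u)) = H1.dx u := by rw [map_sub, dx_constH1, sub_zero]
  have h4 := congrArg Subtype.val h2
  simp only [h3] at h4
  rw [h4, add_sub_cancel]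

/-- Integration by parts for primitives. -/
lemma inner_prim_add (g h : L2) :
    inner ℂ g (toL2 (prim h)) + inner ℂ (toL2 (prim g)) h
      = starRingEnd ℂ (prim g 1) * prim h 1 := by
  -- Both sides are continuous in the pair, so density reduces the identity to classical integration
  -- by parts.
  refine toL2_denseRange.induction_on₂ (p := fun g h => inner ℂ g (toL2 (prim h)) +
    inner ℂ (toL2 (prim g)) h = starRingEnd ℂ (prim g 1) * prim h 1) ?_ ?_ g h
  · have e1 : Continuous fun f : C(I, ℂ) => f 1 := ContinuousEvalConst.continuous_eval_const 1
    refine isClosed_eq (by fun_prop) ?_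
    exact (Complex.continuous_conj.comp (e1.comp (prim.continuous.comp continuous_fst))).mul
      (e1.comp (prim.continuous.comp continuous_snd))
  · intro f h
    set F := fun t => ∫ s in (0 : ℝ)..t, extend f s with hF
    set H := fun t => ∫ s in (0 : ℝ)..t, extend h s with hH
    have hf := prim_toL2 f (fun t => (extend_apply f t).symm)
    have hh := prim_toL2 h (fun t => (extend_apply h t).symm)
    have dF := hasDerivAt_primitive (continuous_extend f)
    have dH := hasDerivAt_primitive (continuous_extend h)
    have cF : Continuous F := continuous_iff_continuousAt.2 fun x => (dF x).continuousAt
    have cH : Continuous H := continuous_iff_continuousAt.2 fun x => (dH x).continuousAt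
    have cf := continuous_extend f
    have ch := continuous_extend h
    have i1 : inner ℂ (toL2 f) (toL2 (prim (toL2 h)))
        = ∫ x in (0 : ℝ)..1, starRingEnd ℂ (extend f x) * H x := by
      rw [← integral_I_eq_intervalIntegral, toL2, ContinuousMap.inner_toLp]
      congr 1; ext x; rw [extend_apply, ← toL2, hh, mul_comm]
    have i2 : inner ℂ (toL2 (prim (toL2 f))) (toL2 h)
        = ∫ x in (0 : ℝ)..1, starRingEnd ℂ (F x) * extend h x := by
      rw [← integral_I_eq_intervalIntegral, toL2, ContinuousMap.inner_toLp]
      congr 1; ext x; rw [extend_apply, ← toL2, hf, mul_comm]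
    have c1 : Continuous fun x => starRingEnd ℂ (extend f x) := Complex.continuous_conj.comp cf
    have c2 : Continuous fun x => starRingEnd ℂ (F x) := Complex.continuous_conj.comp cF
    have dF' : ∀ x, HasDerivAt (fun x => starRingEnd ℂ (F x)) (starRingEnd ℂ (extend f x)) x := by
      intro x
      simpa using (dF x).star
    have e := intervalIntegral.integral_add (μ := volume) ((c1.mul cH).intervalIntegrable 0 1)
      ((c2.mul ch).intervalIntegrable 0 1)
    simp only [Pi.mul_apply] at e
    rw [i1, i2, ← e, intervalIntegral.integral_deriv_mul_eq_sub (fun x _ => dF' x) (fun x _ => dH x)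
      (c1.intervalIntegrable _ _) (ch.intervalIntegrable _ _), hf, hh]
    simp [F]

/-- Integration by parts in `H¹`. -/
lemma H1.inner_dx_fn (u w : H1) : inner ℂ (H1.dx u) (H1.fn w) + inner ℂ (H1.fn u) (H1.dx w)
    = starRingEnd ℂ (H1.ev 1 u) * H1.ev 1 w - starRingEnd ℂ (H1.ev 0 u) * H1.ev 0 w := by
  set a := H1.ev 0 u with ha
  set c := H1.ev 0 w with hc
  have hu := H1.eq_const_add_primL u
  have hw := H1.eq_const_add_primL w
  rw [← ha] at hu
  rw [← hc] at hw
  set g := H1.dx u with hg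
  set h := H1.dx w with hh
  rw [hu, hw]
  simp only [map_add, fn_constH1, fn_primL, ev_constH1, ev_primL]
  have e := inner_prim_add g h
  have e1 : inner ℂ g (ind 1) = starRingEnd ℂ (prim g 1) := (inner_conj_symm _ _).symm
  have e2 : inner ℂ (ind 1) h = prim h 1 := rfl
  rw [inner_add_right, inner_add_left, inner_smul_right, inner_smul_left, e1, e2]
  linear_combination e

/-! ### Compactness of the primitive -/

lemma norm_prim_sub_le (g : L2) (x y : I) : ‖prim g x - prim g y‖ ≤ √(dist x y) * ‖g‖ := by
  rw [prim_apply, prim_apply, ← inner_sub_left, ← norm_ind_sub]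
  exact norm_inner_le_norm _ _

lemma norm_prim_apply_le (g : L2) (x : I) : ‖prim g x‖ ≤ ‖g‖ :=
  (norm_inner_le_norm _ _).trans (mul_le_of_le_one_left (norm_nonneg _) (norm_ind_le x))

/-- Arzelà-Ascoli: primitives of the unit ball of `L²` are bounded by `1` and share the modulus of
continuity `√|x - y|`. -/
lemma isCompactOperator_prim : IsCompactOperator prim := by
  set S : Set C(I, ℂ) := {f | (∀ x, ‖f x‖ ≤ 1) ∧ ∀ x y, ‖f x - f y‖ ≤ √(dist x y)} with hS
  refine ⟨S, ?_, ?_⟩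
  · refine ArzelaAscoli.isCompact_of_equicontinuous S ?_ ?_
    -- Pointwise compactness: the modulus already forces continuity, so the image of `S` is a closed
    -- subset of a product of disks, and Tychonoff applies.
    · set S' : Set (I → ℂ) := {f | (∀ x, ‖f x‖ ≤ 1) ∧ ∀ x y, ‖f x - f y‖ ≤ √(dist x y)} with hS'
      have himg : ContinuousMap.toFun '' S = S' := by
        ext f
        constructor
        · rintro ⟨f, hf, rfl⟩
          exact hf
        · intro hf
          refine ⟨⟨f, ?_⟩, hf, rfl⟩
          rw [continuous_iff_continuousAt]
          intro y
          rw [ContinuousAt, tendsto_iff_norm_sub_tendsto_zero]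
          have : Tendsto (fun x => √(dist x y)) (𝓝 y) (𝓝 √(dist y y)) :=
            Continuous.tendsto (by fun_prop) y
          rw [dist_self, Real.sqrt_zero] at this
          exact squeeze_zero (fun x => norm_nonneg _) (fun x => hf.2 x y) this
      rw [himg]
      refine (isCompact_univ_pi fun _ : I => isCompact_closedBall (0 : ℂ) 1).of_isClosed_subset
        ?_ fun f hf x _ => by simpa using hf.1 x
      have : S' = (⋂ x, {f | ‖f x‖ ≤ 1}) ∩ ⋂ x, ⋂ y, {f | ‖f x - f y‖ ≤ √(dist x y)} := by
        ext f; simp only [hS', Set.mem_ofPred_eq, Set.mem_inter_iff, Set.mem_iInter]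
      rw [this]
      refine (isClosed_iInter fun x => isClosed_le (by fun_prop) continuous_const).inter
        (isClosed_iInter fun x => isClosed_iInter fun y =>
          isClosed_le (by fun_prop) continuous_const)
    · refine Metric.equicontinuous_of_continuity_modulus (fun r => √r) ?_ _ ?_
      · have : Tendsto (fun r : ℝ => √r) (𝓝 0) (𝓝 √0) := Real.continuous_sqrt.tendsto 0
        rwa [Real.sqrt_zero] at this
      · rintro x y ⟨f, hf⟩
        rw [dist_eq_norm]
        exact hf.2 x y
  · filter_upwards [Metric.closedBall_mem_nhds (0 : L2) one_pos] with g hg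
    have hg' : ‖g‖ ≤ 1 := by simpa using hg
    refine ⟨fun x => (norm_prim_apply_le g x).trans hg', fun x y => ?_⟩
    exact (norm_prim_sub_le g x y).trans
      (mul_le_of_le_one_right (Real.sqrt_nonneg _) hg')

end Timoshenko
end

noncomputable section

namespace Timoshenko

/-! ### Coordinates on the energy space -/

namespace Energy

variable {p : Params}

lemma norm_sq (U : Energy p) : ‖U‖ ^ 2 = ‖U.v‖ ^ 2 + p.b⁻¹ * ‖U.z‖ ^ 2
    + p.b⁻¹ * ‖H1.dx U.y‖ ^ 2 + ‖H1.dx U.u + H1.fn U.y‖ ^ 2 + p.k₁⁻¹ * ‖U.η‖ ^ 2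
    + (p.b * p.k₃)⁻¹ * ‖U.γ‖ ^ 2 := by
  have h := inner_self_eq_norm_sq_to_K (𝕜 := ℂ) U
  rw [inner_eq, ip_self, ← Complex.coe_algebraMap, ← map_pow] at h
  exact (Complex.ofReal_injective h).symm

/-- The Volterra operator on `L²(0,1)`. -/
def volterra : L2 →L[ℂ] L2 := toL2 ∘L prim

/-- An element of the energy space is determined by
`(uₓ + y, v, yₓ, z, η, γ) ∈ (L²)⁴ × ℂ²`, which is arbitrary. -/
def coordₗ (p : Params) : Energy p ≃ₗ[ℂ] L2 × L2 × L2 × L2 × ℂ × ℂ where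
  toFun U := (H1.dx U.u + H1.fn U.y, U.v, H1.dx U.y, U.z, U.η, U.γ)
  -- As an `L²` function `y` is `volterra yₓ`, so `uₓ` is the strain minus `volterra yₓ`.
  invFun c := (primL (c.1 - volterra c.2.2.1), c.2.1, primL c.2.2.1, c.2.2.2)
  map_add' U V := by
    simp only [u_dx_add, y_dx_add, y_fn_add, v_add, z_add, η_add, γ_add, Prod.mk_add_mk]
    rw [add_add_add_comm]
  map_smul' c U := by
    simp only [u_dx_smul, y_dx_smul, y_fn_smul, v_smul, z_smul, η_smul, γ_smul, Prod.smul_mk,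
      smul_add, RingHom.id_apply]
  left_inv U := by
    have hy : primL (H1.dx U.y) = U.2.2.1 := primL_dx _
    have hy' : volterra (H1.dx U.y) = H1.fn U.y := by
      change H1.fn (primL (H1.dx U.y)).1 = _
      rw [hy]; rfl
    refine Prod.ext ?_ (Prod.ext rfl (Prod.ext hy rfl))
    change primL (H1.dx U.u + H1.fn U.y - volterra (H1.dx U.y)) = U.1
    rw [hy', add_sub_cancel_right]
    exact primL_dx _
  right_inv c := by
    refine Prod.ext ?_ rfl
    change c.1 - volterra c.2.2.1 + volterra c.2.2.1 = c.1
    rw [sub_add_cancel]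

/-- The energy weights are `1`, `1`, `1/b`, `1/b`, `1/k₁`, `1/(b k₃)`. The constant under the root
dominates the inverse of every weight; in the reverse estimate it is the sum of the weights. -/
lemma norm_coordₗ_le (U : Energy p) :
    ‖coordₗ p U‖ ≤ √(1 + p.b + p.k₁ + p.b * p.k₃) * ‖U‖ := by
  have hb := p.b_pos
  have hk := p.k₁_pos
  have hk3 := p.k₃_pos
  have h := norm_sq U
  have hbk : 0 < p.b * p.k₃ := mul_pos hb hk3
  have a1 := sq_nonneg ‖U.v‖
  have a2 := mul_nonneg (inv_pos.2 hb).le (sq_nonneg ‖U.z‖)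
  have a3 := mul_nonneg (inv_pos.2 hb).le (sq_nonneg ‖H1.dx U.y‖)
  have a4 := sq_nonneg ‖H1.dx U.u + H1.fn U.y‖
  have a5 := mul_nonneg (inv_pos.2 hk).le (sq_nonneg ‖U.η‖)
  have a6 := mul_nonneg (inv_pos.2 hbk).le (sq_nonneg ‖U.γ‖)
  set N := ‖U‖ ^ 2 with hN
  have hN0 : 0 ≤ N := sq_nonneg _
  have key : ∀ {r w : ℝ}, 0 < w → w ≤ 1 + p.b + p.k₁ + p.b * p.k₃ → 0 ≤ r → w⁻¹ * r ^ 2 ≤ N →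
      r ≤ √(1 + p.b + p.k₁ + p.b * p.k₃) * ‖U‖ := by
    intro r w hw hw' hr h
    have h1 : r ^ 2 ≤ w * N := by
      have := mul_le_mul_of_nonneg_left h hw.le
      rwa [mul_inv_cancel_left₀ hw.ne'] at this
    have h2 : r ^ 2 ≤ (1 + p.b + p.k₁ + p.b * p.k₃) * N :=
      h1.trans (mul_le_mul_of_nonneg_right hw' hN0)
    rw [← Real.sqrt_sq hr, ← Real.sqrt_sq (norm_nonneg U), ← Real.sqrt_mul (by positivity)]
    exact Real.sqrt_le_sqrt h2
  change max _ (max _ (max _ (max _ (max _ _)))) ≤ _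
  refine max_le ?_ (max_le ?_ (max_le ?_ (max_le ?_ (max_le ?_ ?_))))
  · exact key (r := ‖H1.dx U.u + H1.fn U.y‖) (w := 1) one_pos (by linarith) (norm_nonneg _) (by rw [inv_one, one_mul]; linarith)
  · exact key (r := ‖U.v‖) (w := 1) one_pos (by linarith) (norm_nonneg _) (by rw [inv_one, one_mul]; linarith)
  · exact key (r := ‖H1.dx U.y‖) (w := p.b) hb (by linarith) (norm_nonneg _) (by linarith)
  · exact key (r := ‖U.z‖) (w := p.b) hb (by linarith) (norm_nonneg _) (by linarith)
  · exact key (r := ‖U.η‖) (w := p.k₁) hk (by linarith) (norm_nonneg _) (by linarith)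
  · exact key (r := ‖U.γ‖) (w := p.b * p.k₃) hbk (by linarith) (norm_nonneg _) (by linarith)

lemma norm_coordₗ_symm_le (c : L2 × L2 × L2 × L2 × ℂ × ℂ) :
    ‖(coordₗ p).symm c‖ ≤ √(1 + p.b⁻¹ + p.b⁻¹ + 1 + p.k₁⁻¹ + (p.b * p.k₃)⁻¹) * ‖c‖ := by
  have hb := inv_pos.2 p.b_pos
  have hk := inv_pos.2 p.k₁_pos
  have hk3 := inv_pos.2 (mul_pos p.b_pos p.k₃_pos)
  set U := (coordₗ p).symm c with hU
  have hc : c = coordₗ p U := ((coordₗ p).apply_symm_apply c).symm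
  have h := norm_sq U
  have b1 : ‖H1.dx U.u + H1.fn U.y‖ ≤ ‖c‖ := by rw [hc]; exact le_max_left _ _
  have b2 : ‖U.v‖ ≤ ‖c‖ := by rw [hc]; exact le_max_of_le_right (le_max_left _ _)
  have b3 : ‖H1.dx U.y‖ ≤ ‖c‖ := by
    rw [hc]; exact le_max_of_le_right (le_max_of_le_right (le_max_left _ _))
  have b4 : ‖U.z‖ ≤ ‖c‖ := by
    rw [hc]; exact le_max_of_le_right (le_max_of_le_right (le_max_of_le_right (le_max_left _ _)))
  have b5 : ‖U.η‖ ≤ ‖c‖ := by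
    rw [hc]
    exact le_max_of_le_right (le_max_of_le_right (le_max_of_le_right
      (le_max_of_le_right (le_max_left _ _))))
  have b6 : ‖U.γ‖ ≤ ‖c‖ := by
    rw [hc]
    exact le_max_of_le_right (le_max_of_le_right (le_max_of_le_right
      (le_max_of_le_right (le_max_right _ _))))
  have sq : ∀ {r : ℝ}, 0 ≤ r → r ≤ ‖c‖ → r ^ 2 ≤ ‖c‖ ^ 2 := fun h0 h => pow_le_pow_left₀ h0 h 2
  rw [← Real.sqrt_sq (norm_nonneg U), ← Real.sqrt_sq (norm_nonneg c),
    ← Real.sqrt_mul (by positivity)]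
  refine Real.sqrt_le_sqrt ?_
  rw [h]
  have c1 := sq (norm_nonneg _) b1
  have c2 := sq (norm_nonneg _) b2
  have c3 := mul_le_mul_of_nonneg_left (sq (norm_nonneg _) b3) hb.le
  have c4 := mul_le_mul_of_nonneg_left (sq (norm_nonneg _) b4) hb.le
  have c5 := mul_le_mul_of_nonneg_left (sq (norm_nonneg _) b5) hk.le
  have c6 := mul_le_mul_of_nonneg_left (sq (norm_nonneg _) b6) hk3.le
  linarith

/-- The coordinates, as an isomorphism of Banach spaces. -/
def coord (p : Params) : Energy p ≃L[ℂ] L2 × L2 × L2 × L2 × ℂ × ℂ :=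
  (coordₗ p).toContinuousLinearEquivOfBounds _ _ norm_coordₗ_le norm_coordₗ_symm_le

lemma coord_apply (U : Energy p) :
    coord p U = (H1.dx U.u + H1.fn U.y, U.v, H1.dx U.y, U.z, U.η, U.γ) := rfl

instance : CompleteSpace (Energy p) :=
  (completeSpace_congr (e := (coord p).toEquiv) (coord p).isUniformEmbedding).2 inferInstance

lemma ext_coord {U V : Energy p} (h1 : H1.dx U.u + H1.fn U.y = H1.dx V.u + H1.fn V.y)
    (h2 : U.v = V.v) (h3 : H1.dx U.y = H1.dx V.y) (h4 : U.z = V.z) (h5 : U.η = V.η)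
    (h6 : U.γ = V.γ) : U = V := by
  apply (coord p).injective
  rw [coord_apply, coord_apply, h1, h2, h3, h4, h5, h6]

end Energy

open Energy

/-! ### The inverse of the operator -/

lemma _root_.IsCompactOperator.prodMk {M₁ M₂ M₃ : Type*} [Zero M₁] [TopologicalSpace M₁]
    [TopologicalSpace M₂] [TopologicalSpace M₃] {f : M₁ → M₂} {g : M₁ → M₃}
    (hf : IsCompactOperator f) (hg : IsCompactOperator g) :
    IsCompactOperator fun x => (f x, g x) := by
  obtain ⟨K, hK, hfK⟩ := hf
  obtain ⟨L, hL, hgL⟩ := hg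
  exact ⟨K ×ˢ L, hK.prod hL, by filter_upwards [hfK, hgL] with x h1 h2 using ⟨h1, h2⟩⟩

/-- The value at `1` of the primitive. -/
def mean : L2 →L[ℂ] ℂ := innerSL ℂ (ind 1)

lemma mean_apply (g : L2) : mean g = prim g 1 := rfl

section
variable (p : Params) (k₂ k₄ : ℝ)

/-- The constant of integration in `invStrain`. -/
def strainConst : L2 × L2 × L2 × L2 × ℂ × ℂ →L[ℂ] ℂ where
  -- The boundary condition gives the strain at `1` as `-(F.η + k₂ F.u(1)) / k₁`; the integral of
  -- its derivative `F.v` is subtracted to reach the value at `0`.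
  toFun c := -(c.2.2.2.2.1 + k₂ * mean (c.1 - volterra c.2.2.1)) / p.k₁ - mean c.2.1
  map_add' c d := by
    simp only [Prod.fst_add, Prod.snd_add, map_add, add_sub_add_comm]
    ring
  map_smul' a c := by
    simp only [Prod.smul_fst, Prod.smul_snd, map_smul, ← smul_sub, RingHom.id_apply, smul_eq_mul]
    ring
  cont := by fun_prop

/-- The strain `uₓ + y` of the solution of `𝒜 U = F`, in terms of the coordinates of `F`. -/
def invStrain : L2 × L2 × L2 × L2 × ℂ × ℂ →L[ℂ] L2 where
  toFun c := volterra c.2.1 + strainConst p k₂ c • ind 1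
  map_add' c d := by
    simp only [Prod.fst_add, Prod.snd_add, map_add]
    module
  map_smul' a c := by
    simp only [Prod.smul_fst, Prod.smul_snd, map_smul, RingHom.id_apply, smul_eq_mul]
    module
  cont := by fun_prop

/-- The right-hand side of the equation for `yₓₓ`. -/
def rotLoad : L2 × L2 × L2 × L2 × ℂ × ℂ →L[ℂ] L2 where
  toFun c := c.2.2.2.1 + (p.b : ℂ) • invStrain p k₂ c
  map_add' c d := by
    simp only [Prod.fst_add, Prod.snd_add, map_add]
    module
  map_smul' a c := by
    simp only [Prod.smul_fst, Prod.smul_snd, map_smul, RingHom.id_apply]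
    module
  cont := by fun_prop

/-- The constant of integration in `invRot`. -/
def rotConst : L2 × L2 × L2 × L2 × ℂ × ℂ →L[ℂ] ℂ where
  -- Likewise `yₓ(1) = -(F.γ + k₄ F.y(1)) / k₃`, and `rotLoad` is the derivative of `yₓ`.
  toFun c := -(c.2.2.2.2.2 + k₄ * mean c.2.2.1) / p.k₃ - mean (rotLoad p k₂ c)
  map_add' c d := by
    simp only [Prod.fst_add, Prod.snd_add, map_add]
    ring
  map_smul' a c := by
    simp only [Prod.smul_fst, Prod.smul_snd, map_smul, RingHom.id_apply, smul_eq_mul]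
    ring
  cont := by fun_prop

/-- The derivative `yₓ` of the solution of `𝒜 U = F`, in terms of the coordinates of `F`. -/
def invRot : L2 × L2 × L2 × L2 × ℂ × ℂ →L[ℂ] L2 where
  toFun c := volterra (rotLoad p k₂ c) + rotConst p k₂ k₄ c • ind 1
  map_add' c d := by
    simp only [map_add]
    module
  map_smul' a c := by
    simp only [map_smul, RingHom.id_apply, smul_eq_mul]
    module
  cont := by fun_prop

/-- The inverse of the operator in coordinates. -/
def invCoord : L2 × L2 × L2 × L2 × ℂ × ℂ →L[ℂ] L2 × L2 × L2 × L2 × ℂ × ℂ where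
  -- The velocities of `U` are the displacements of `F`, recovered from `F.uₓ` and `F.yₓ`; the last
  -- two entries are their values at `1`.
  toFun c := (invStrain p k₂ c, volterra (c.1 - volterra c.2.2.1), invRot p k₂ k₄ c,
    volterra c.2.2.1, mean (c.1 - volterra c.2.2.1), mean c.2.2.1)
  map_add' c d := by
    simp only [Prod.fst_add, Prod.snd_add, map_add, add_sub_add_comm, Prod.mk_add_mk]
  map_smul' a c := by
    simp only [Prod.smul_fst, Prod.smul_snd, map_smul, ← smul_sub, RingHom.id_apply, Prod.smul_mk]
  cont := by fun_prop

/-- The inverse of the operator. -/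
def opInv : Energy p →L[ℂ] Energy p :=
  (coord p).symm.toContinuousLinearMap ∘L invCoord p k₂ k₄ ∘L (coord p).toContinuousLinearMap

end

lemma coord_opInv (p : Params) (k₂ k₄ : ℝ) (F : Energy p) :
    coord p (opInv p k₂ k₄ F) = invCoord p k₂ k₄ (coord p F) :=
  (coord p).apply_symm_apply _

lemma isCompactOperator_volterra : IsCompactOperator volterra := isCompactOperator_prim.clm_comp toL2

lemma isCompactOperator_smul_const {X Y : Type*} [NormedAddCommGroup X] [NormedSpace ℂ X]
    [NormedAddCommGroup Y] [NormedSpace ℂ Y] (φ : X →L[ℂ] ℂ) (y : Y) :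
    IsCompactOperator fun x => φ x • y :=
  (isCompactOperator_of_locallyCompactSpace_dom φ).clm_comp (ContinuousLinearMap.toSpanSingleton ℂ y)

/-- Each component is the Volterra operator after a bounded map, an operator of rank at most one, or
a sum of these. -/
lemma isCompactOperator_invCoord (p : Params) (k₂ k₄ : ℝ) :
    IsCompactOperator (invCoord p k₂ k₄) := by
  have h1 : IsCompactOperator (invStrain p k₂) :=
    (isCompactOperator_volterra.comp_clm (ContinuousLinearMap.fst ℂ L2 (L2 × L2 × ℂ × ℂ) ∘L
      ContinuousLinearMap.snd ℂ L2 _)).add (isCompactOperator_smul_const (strainConst p k₂) (ind 1))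
  have h3 : IsCompactOperator (invRot p k₂ k₄) :=
    (isCompactOperator_volterra.comp_clm (rotLoad p k₂)).add
      (isCompactOperator_smul_const (rotConst p k₂ k₄) (ind 1))
  let f3 : L2 × L2 × L2 × L2 × ℂ × ℂ →L[ℂ] L2 := ContinuousLinearMap.fst ℂ L2 (L2 × ℂ × ℂ) ∘L
    ContinuousLinearMap.snd ℂ L2 _ ∘L ContinuousLinearMap.snd ℂ L2 _
  let f1 : L2 × L2 × L2 × L2 × ℂ × ℂ →L[ℂ] L2 := ContinuousLinearMap.fst ℂ L2 _ - volterra ∘L f3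
  exact h1.prodMk <| (isCompactOperator_volterra.comp_clm f1).prodMk <| h3.prodMk <|
    (isCompactOperator_volterra.comp_clm f3).prodMk <|
    (isCompactOperator_of_locallyCompactSpace_dom (mean ∘L f1)).prodMk
    (isCompactOperator_of_locallyCompactSpace_dom (mean ∘L f3))

lemma isCompactOperator_opInv (p : Params) (k₂ k₄ : ℝ) : IsCompactOperator (opInv p k₂ k₄) :=
  ((isCompactOperator_invCoord p k₂ k₄).comp_clm (coord p).toContinuousLinearMap).clm_comp
    (coord p).symm.toContinuousLinearMap

lemma H1.fn_eq (w : H1) : H1.fn w = volterra (H1.dx w) + H1.ev 0 w • ind 1 := by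
  conv_lhs => rw [H1.eq_const_add_primL w, map_add, fn_constH1, add_comm]
  rfl

lemma H1.ev_one (w : H1) : H1.ev 1 w = mean (H1.dx w) + H1.ev 0 w := by
  conv_lhs => rw [H1.eq_const_add_primL w, map_add, ev_constH1, add_comm]
  rfl

lemma H1L.fn_eq (w : H1L) : H1.fn w.1 = volterra (H1.dx w.1) := by
  rw [H1.fn_eq, show H1.ev 0 w.1 = 0 from w.2, zero_smul, add_zero]

lemma H1L.ev_one (w : H1L) : H1.ev 1 w.1 = mean (H1.dx w.1) := by
  rw [H1.ev_one, show H1.ev 0 w.1 = 0 from w.2, add_zero]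

/-- The operator is the inverse of `opInv`. -/
lemma opRel_iff {p : Params} {k₂ k₄ : ℝ} {U F : Energy p} :
    OpRel p k₂ k₄ U F ↔ U = opInv p k₂ k₄ F := by
  have hk₁ : (p.k₁ : ℂ) ≠ 0 := by exact_mod_cast p.k₁_pos.ne'
  have hk₃ : (p.k₃ : ℂ) ≠ 0 := by exact_mod_cast p.k₃_pos.ne'
  have eFu : H1.fn F.u = volterra (H1.dx F.u + H1.fn F.y - volterra (H1.dx F.y)) := by
    rw [show H1.fn F.y = volterra (H1.dx F.y) from H1L.fn_eq F.2.2.1, add_sub_cancel_right]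
    exact H1L.fn_eq F.1
  have eFu1 : H1.ev 1 F.u = mean (H1.dx F.u + H1.fn F.y - volterra (H1.dx F.y)) := by
    rw [show H1.fn F.y = volterra (H1.dx F.y) from H1L.fn_eq F.2.2.1, add_sub_cancel_right]
    exact H1L.ev_one F.1
  have eFy : H1.fn F.y = volterra (H1.dx F.y) := H1L.fn_eq F.2.2.1
  have eFy1 : H1.ev 1 F.y = mean (H1.dx F.y) := H1L.ev_one F.2.2.1
  rw [← (coord p).injective.eq_iff, coord_opInv]
  set c := coord p F with hc
  have eU : coord p U = invCoord p k₂ k₄ c ↔ (H1.dx U.u + H1.fn U.y = invStrain p k₂ c ∧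
      U.v = H1.fn F.u ∧ H1.dx U.y = invRot p k₂ k₄ c ∧ U.z = H1.fn F.y ∧ U.η = H1.ev 1 F.u ∧
      U.γ = H1.ev 1 F.y) := by
    have i2 : (invCoord p k₂ k₄ c).2.1 = H1.fn F.u := eFu.symm
    have i4 : (invCoord p k₂ k₄ c).2.2.2.1 = H1.fn F.y := eFy.symm
    have i5 : (invCoord p k₂ k₄ c).2.2.2.2.1 = H1.ev 1 F.u := eFu1.symm
    have i6 : (invCoord p k₂ k₄ c).2.2.2.2.2 = H1.ev 1 F.y := eFy1.symm
    rw [← i2, ← i4, ← i5, ← i6]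
    simp only [coord_apply, Prod.ext_iff]
    rfl
  rw [eU]
  constructor
  · rintro ⟨ux, yx, h1, h2, h3, h4, h5, h6, h7, h8, h9, h10⟩
    -- The strain lies in `H¹` with derivative `F.v`, so it is `volterra F.v` plus its value at `0`,
    -- which the boundary condition at `1` determines.
    have es : H1.dx U.u + H1.fn U.y = invStrain p k₂ c := by
      rw [← h1, ← map_add, H1.fn_eq, ← h7]
      change _ = volterra F.v + (-(F.η + k₂ * mean (H1.dx F.u + H1.fn F.y - volterra (H1.dx F.y)))
        / p.k₁ - mean F.v) • ind 1
      rw [← eFu1, ← h5]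
      congr 2
      rw [← map_add, H1.ev_one, ← h7] at h9
      rw [h9]
      field_simp
      ring
    refine ⟨es, h3.symm, ?_, h4.symm, h5, h6⟩
    have ew : H1.dx yx = rotLoad p k₂ c := by
      change _ = F.z + (p.b : ℂ) • invStrain p k₂ c
      rw [← es, h8, map_add, h1, sub_add_cancel]
    rw [← h2, H1.fn_eq, ew]
    change _ = volterra (rotLoad p k₂ c) + (-(F.γ + k₄ * mean (H1.dx F.y)) / p.k₃ -
      mean (rotLoad p k₂ c)) • ind 1
    rw [← eFy1, ← h6]
    congr 2
    rw [H1.ev_one, ew] at h10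
    rw [h10]
    field_simp
    ring
  · rintro ⟨h1, h2, h3, h4, h5, h6⟩
    -- Strain and `yₓ` are rebuilt as elements of `H¹`; `s - y` then witnesses `u ∈ H²`.
    set s : H1 := constH1 (strainConst p k₂ c) + (primL F.v).1 with hs
    set yx : H1 := constH1 (rotConst p k₂ k₄ c) + (primL (rotLoad p k₂ c)).1 with hyx
    have fs : H1.fn s = H1.dx U.u + H1.fn U.y := by
      rw [h1, hs, map_add, fn_constH1, fn_primL, add_comm]; rfl
    have fy : H1.fn yx = H1.dx U.y := by
      rw [h3, hyx, map_add, fn_constH1, fn_primL, add_comm]; rfl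
    refine ⟨s - U.y, yx, ?_, fy, h2.symm, h4.symm, h5, h6, ?_, ?_, ?_, ?_⟩
    · rw [map_sub, fs, add_sub_cancel_right]
    · rw [sub_add_cancel, hs, map_add, dx_constH1, zero_add, dx_primL]
    · rw [sub_add_cancel, fs, h1, hyx, map_add, dx_constH1, zero_add, dx_primL]
      exact (add_sub_cancel_right F.z _).symm
    · rw [map_sub, sub_add_cancel, h5, eFu1, hs, map_add, ev_constH1, ev_primL, ← mean_apply]
      change F.η = -(p.k₁ : ℂ) * (-(F.η + k₂ * mean (H1.dx F.u + H1.fn F.y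
        - volterra (H1.dx F.y))) / p.k₁ - mean F.v + mean F.v) - _
      field_simp
      ring
    · rw [h6, eFy1, hyx, map_add, ev_constH1, ev_primL, ← mean_apply]
      change F.γ = -(p.k₃ : ℂ) * (-(F.γ + k₄ * mean (H1.dx F.y)) / p.k₃ -
        mean (rotLoad p k₂ c) + mean (rotLoad p k₂ c)) - _
      field_simp
      ring

lemma mem_domain_op_iff {p : Params} {k₂ k₄ : ℝ} {U : Energy p} :
    U ∈ (op p k₂ k₄).domain ↔ ∃ F, U = opInv p k₂ k₄ F := by
  simp only [LinearPMap.mem_domain_iff, mem_graph_op, opRel_iff]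

lemma op_apply_eq_iff {p : Params} {k₂ k₄ : ℝ} (U : (op p k₂ k₄).domain) (F : Energy p) :
    op p k₂ k₄ U = F ↔ (U : Energy p) = opInv p k₂ k₄ F := by
  rw [← opRel_iff, ← mem_graph_op, LinearPMap.mem_graph_iff]
  constructor
  · rintro h
    exact ⟨U, rfl, h⟩
  · rintro ⟨y, h1, h2⟩
    have : y = U := Subtype.ext h1
    rwa [this] at h2

/-! ### Skew-adjointness of the conservative operator -/

/-- Four integrations by parts. The terms at `0` vanish since the displacements of `F` and `G` do;
those at `1` cancel against the `η` and `γ` terms thanks to the weights `1/k₁` and `1/(b k₃)`. The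
term `-b (uₓ + y)` cancels the part of the strain energy that comes from `y`. -/
lemma opRel_skew {p : Params} {U F V G : Energy p} (h : OpRel p 0 0 U F) (h' : OpRel p 0 0 V G) :
    inner ℂ F V + inner ℂ U G = 0 := by
  obtain ⟨ux, yx, h1, h2, h3, h4, h5, h6, h7, h8, h9, h10⟩ := h
  obtain ⟨ux', yx', h1', h2', h3', h4', h5', h6', h7', h8', h9', h10'⟩ := h'
  have hb : (p.b : ℂ) ≠ 0 := by exact_mod_cast p.b_pos.ne'
  have hk₁ : (p.k₁ : ℂ) ≠ 0 := by exact_mod_cast p.k₁_pos.ne'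
  have hk₃ : (p.k₃ : ℂ) ≠ 0 := by exact_mod_cast p.k₃_pos.ne'
  set s := ux + U.y with hs
  set s' := ux' + V.y with hs'
  have e1 := H1.inner_dx_fn s G.u
  have e2 := H1.inner_dx_fn yx G.y
  have e3 := H1.inner_dx_fn F.u s'
  have e4 := H1.inner_dx_fn F.y yx'
  have z1 : H1.ev 0 G.u = 0 := G.1.2
  have z2 : H1.ev 0 G.y = 0 := G.2.2.1.2
  have z3 : H1.ev 0 F.u = 0 := F.1.2
  have z4 : H1.ev 0 F.y = 0 := F.2.2.1.2
  have fs : H1.fn s = H1.dx U.u + H1.fn U.y := by rw [hs, map_add, h1]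
  have fs' : H1.fn s' = H1.dx V.u + H1.fn V.y := by rw [hs', map_add, h1']
  rw [inner_eq, inner_eq, ip, ip, ← fs, ← fs', h7, h8, h9, h10, h7', h8', h9', h10', ← h3, ← h4,
    ← h3', ← h4', h5, h6, h5', h6', ← map_add, ← map_add, ← hs, ← hs', ← h2, ← h2']
  simp only [z1, z2, z3, z4, map_zero, mul_zero, zero_mul, sub_zero] at e1 e2 e3 e4
  simp only [Complex.ofReal_zero, zero_mul, sub_zero, inner_sub_left, inner_sub_right,
    inner_add_left, inner_add_right, inner_smul_left, inner_smul_right, Complex.conj_ofReal,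
    RCLike.inner_apply, map_neg, map_mul]
  field_simp
  linear_combination (p.b : ℂ) * e1 + e2 + (p.b : ℂ) * e3 + e4

end Timoshenko
end

noncomputable section

namespace InverseOperator

variable {H : Type*} [NormedAddCommGroup H] [InnerProductSpace ℂ H]

/-! ### Operators with compact inverse -/

/-- `R` is a bounded inverse of `T`, defined on the whole space. -/
structure HasBoundedInverse (T : H →ₗ.[ℂ] H) (R : H →L[ℂ] H) : Prop where
  mem_domain_iff : ∀ x, x ∈ T.domain ↔ ∃ f, x = R f
  apply_eq_iff : ∀ (x : T.domain) (f : H), T x = f ↔ (x : H) = R f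

/-- The operator `1 - c R`, which has the same kernel as `R⁻¹ - c`. -/
def oneSub (R : H →L[ℂ] H) (c : ℂ) : H →L[ℂ] H := 1 - c • R

lemma oneSub_apply (R : H →L[ℂ] H) (c : ℂ) (x : H) : oneSub R c x = x - c • R x := rfl

lemma oneSub_comm (R : H →L[ℂ] H) (c : ℂ) : Commute (oneSub R c) R := by
  ext x
  simp [oneSub_apply]

lemma oneSub_pow_comm (R : H →L[ℂ] H) (c : ℂ) (n : ℕ) (x : H) :
    (oneSub R c ^ n) (R x) = R ((oneSub R c ^ n) x) :=
  congrArg (fun A : H →L[ℂ] H => A x) ((oneSub_comm R c).pow_left n).eq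

lemma mem_kerPow_succ {T : H →ₗ.[ℂ] H} {c : ℂ} {n : ℕ} {x : H} :
    x ∈ T.kerPow c (n + 1) ↔ ∃ h : x ∈ T.domain, T ⟨x, h⟩ - c • x ∈ T.kerPow c n := by
  constructor
  · rintro ⟨y, hy, rfl⟩
    exact ⟨y.2, hy⟩
  · rintro ⟨h, hx⟩
    exact ⟨⟨x, h⟩, hx, rfl⟩

lemma mem_eigenspace_iff' {T : H →ₗ.[ℂ] H} {c : ℂ} {x : H} :
    x ∈ T.eigenspace c ↔ ∃ h : x ∈ T.domain, T ⟨x, h⟩ = c • x := by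
  constructor
  · rintro ⟨y, hy, rfl⟩
    exact ⟨y.2, sub_eq_zero.1 hy⟩
  · rintro ⟨h, hx⟩
    exact ⟨⟨x, h⟩, sub_eq_zero.2 hx, rfl⟩

lemma kerPow_one {T : H →ₗ.[ℂ] H} {c : ℂ} : T.kerPow c 1 = T.eigenspace c := rfl

namespace HasBoundedInverse

variable {T : H →ₗ.[ℂ] H} {R : H →L[ℂ] H}

lemma injective (h : HasBoundedInverse T R) : Function.Injective R := by
  intro f g hfg
  have hd : R f ∈ T.domain := (h.mem_domain_iff _).2 ⟨f, rfl⟩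
  rw [← (h.apply_eq_iff ⟨R f, hd⟩ f).2 rfl, (h.apply_eq_iff ⟨R f, hd⟩ g).2 hfg]

/-- Since `x = (1 - cR) x + R (c x)`, induction applied to `(1 - cR) x` puts `x` in the range of
`R`, which is the domain of the inverse. -/
lemma mem_range_of_oneSub_pow (c : ℂ) (n : ℕ) {x : H}
    (hx : (oneSub R c ^ n) x = 0) : ∃ f, x = R f := by
  induction n generalizing x with
  | zero => exact ⟨0, by simpa using hx⟩
  | succ n ih =>
    rw [pow_succ] at hx
    obtain ⟨f, hf⟩ := ih hx
    replace hf : oneSub R c x = R f := hf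
    refine ⟨f + c • x, ?_⟩
    rw [map_add, map_smul, ← hf, oneSub_apply, sub_add_cancel]

/-- On the domain `R (T - c) = 1 - cR`, and `R` is injective and commutes with `1 - cR`. All
questions about root spaces thus pass to the bounded operator `R`. -/
lemma mem_kerPow_iff (h : HasBoundedInverse T R) {c : ℂ} {n : ℕ} {x : H} :
    x ∈ T.kerPow c n ↔ (oneSub R c ^ n) x = 0 := by
  induction n generalizing x with
  | zero => rw [pow_zero]; exact Submodule.mem_bot ℂ
  | succ n ih =>
    rw [mem_kerPow_succ]
    constructor
    · rintro ⟨hd, hx⟩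
      rw [ih] at hx
      have h1 := (h.apply_eq_iff ⟨x, hd⟩ _).1 rfl
      have h2 : oneSub R c x = R (T ⟨x, hd⟩ - c • x) := by
        rw [oneSub_apply, map_sub, map_smul, ← h1]
      rw [pow_succ, mul_apply_eq_comp, h2, oneSub_pow_comm, hx, map_zero]
    · intro hx
      obtain ⟨f, rfl⟩ := mem_range_of_oneSub_pow c _ hx
      have hd : R f ∈ T.domain := (h.mem_domain_iff _).2 ⟨f, rfl⟩
      refine ⟨hd, ?_⟩
      rw [ih, (h.apply_eq_iff ⟨R f, hd⟩ f).2 rfl]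
      rw [oneSub_pow_comm] at hx
      have h3 := h.injective (hx.trans (map_zero R).symm)
      rwa [pow_succ] at h3

lemma mem_eigenspace_iff (h : HasBoundedInverse T R) {c : ℂ} {x : H} :
    x ∈ T.eigenspace c ↔ x = c • R x := by
  rw [← kerPow_one, h.mem_kerPow_iff, pow_one, oneSub_apply, sub_eq_zero]

lemma kerPow_eq (h : HasBoundedInverse T R) (c : ℂ) (n : ℕ) :
    T.kerPow c n = LinearMap.ker (oneSub R c ^ n).toLinearMap := by
  ext x
  exact h.mem_kerPow_iff

lemma kerPow_mono (h : HasBoundedInverse T R) (c : ℂ) : Monotone (T.kerPow c) := by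
  refine monotone_nat_of_le_succ fun n x hx => ?_
  rw [h.mem_kerPow_iff] at hx ⊢
  rw [pow_succ', mul_apply_eq_comp, hx, map_zero]

lemma isClosed_kerPow (h : HasBoundedInverse T R) (c : ℂ) (n : ℕ) :
    IsClosed (T.kerPow c n : Set H) := by
  rw [h.kerPow_eq]
  exact (oneSub R c ^ n).isClosed_ker

end HasBoundedInverse

/-- The argument of F. Riesz: there is no strictly increasing sequence of closed subspaces
on which the compact operator `R` acts in a triangular way with diagonal entries that stay away
from zero. -/
lemma false_of_strictMono {R : H →L[ℂ] H} (hR : IsCompactOperator R) {F : ℕ → Submodule ℂ H}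
    (hF : StrictMono F) (hcl : ∀ n, IsClosed (F n : Set H)) (hinv : ∀ n, ∀ x ∈ F n, R x ∈ F n)
    (c : ℕ → ℂ) {r : ℝ} (hc : ∀ n, ‖c n‖ ≤ r) (hS : ∀ n, ∀ x ∈ F (n + 1), oneSub R (c n) x ∈ F n) :
    False := by
  -- Riesz's lemma inside `F (n + 1)`; any bound above `2` would do in place of `3`.
  have hx : ∀ n, ∃ x ∈ F (n + 1), ‖x‖ ≤ 3 ∧ ∀ y ∈ F n, 1 ≤ ‖x - y‖ := by
    intro n
    obtain ⟨z, hz, hz'⟩ := SetLike.exists_of_lt (hF (Nat.lt_succ_self n))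
    have hcl' : IsClosed (((F n).comap (F (n + 1)).subtype : Submodule ℂ (F (n + 1))) :
        Set (F (n + 1))) := (hcl n).preimage continuous_subtype_val
    obtain ⟨x, hx, hx'⟩ := riesz_lemma_of_norm_lt (c := (2 : ℂ)) (R := 3) (by norm_num)
      (by norm_num) hcl' ⟨⟨z, hz⟩, hz'⟩
    exact ⟨x, x.2, hx, fun y hy => hx' ⟨y, hF.monotone (Nat.le_succ n) hy⟩ hy⟩
  choose x hxF hx3 hx1 using hx
  obtain ⟨K, hK, hKs⟩ := hR.image_closedBall_subset_compact (r * 3)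
  have hmem : ∀ n, R (c n • x n) ∈ K := fun n => hKs ⟨_, by
    rw [mem_closedBall_zero_iff, norm_smul]
    exact mul_le_mul (hc n) (hx3 n) (norm_nonneg _) ((norm_nonneg _).trans (hc n)), rfl⟩
  obtain ⟨a, -, φ, hφ, hlim⟩ := hK.tendsto_subseq hmem
  have hcauchy := hlim.cauchySeq
  rw [Metric.cauchySeq_iff] at hcauchy
  obtain ⟨N, hN⟩ := hcauchy 1 one_pos
  have h1 := hN (N + 1) (Nat.le_succ N) N le_rfl
  have hlt : φ N < φ (N + 1) := hφ (Nat.lt_succ_self N)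
  set m := φ N
  set n := φ (N + 1)
  -- For `m < n` the vector `R (c n x n)` differs from `x n` by an element of `F n`, and `R (c m x
  -- m)` lies in `F n`. The images thus stay at distance at least `1`, so no subsequence converges.
  have h2 := hx1 n (oneSub R (c n) (x n) + R (c m • x m)) (by
    refine add_mem (hS n _ (hxF n)) ?_
    refine hF.monotone (Nat.succ_le_of_lt hlt) (hinv _ _ ((F (m + 1)).smul_mem _ (hxF m))))
  have h3 : x n - (oneSub R (c n) (x n) + R (c m • x m)) = R (c n • x n) - R (c m • x m) := by
    rw [oneSub_apply, map_smul R (c n)]; abel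
  rw [h3, ← dist_eq_norm] at h2
  exact absurd h1 (not_lt.2 h2)

/-! ### Riesz theory: root spaces and spectrum -/

namespace HasBoundedInverse

variable {T : H →ₗ.[ℂ] H} {R : H →L[ℂ] H}

lemma map_kerPow (h : HasBoundedInverse T R) {c : ℂ} {n : ℕ} {x : H} (hx : x ∈ T.kerPow c n) :
    R x ∈ T.kerPow c n := by
  rw [h.mem_kerPow_iff] at hx ⊢
  rw [oneSub_pow_comm, hx, map_zero]

/-- Otherwise the kernels would form a chain excluded by `false_of_strictMono`, with constant
diagonal entry `c`. -/
lemma exists_kerPow_eq (h : HasBoundedInverse T R) (hR : IsCompactOperator R) (c : ℂ) :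
    ∃ n, T.kerPow c (n + 1) = T.kerPow c n := by
  by_contra! hne
  refine false_of_strictMono hR (strictMono_nat_of_lt_succ fun n =>
    lt_of_le_of_ne (h.kerPow_mono c (Nat.le_succ n)) (hne n).symm)
    (h.isClosed_kerPow c) (fun n x hx => h.map_kerPow hx) (fun _ => c) (fun _ => le_rfl) ?_
  intro n x hx
  rw [h.mem_kerPow_iff] at hx ⊢
  rwa [pow_succ] at hx

lemma rootSpace_eq_of_kerPow_eq (h : HasBoundedInverse T R) {c : ℂ} {n : ℕ}
    (hn : T.kerPow c (n + 1) = T.kerPow c n) : T.rootSpace c = T.kerPow c n := by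
  have key : ∀ m, T.kerPow c (n + m) = T.kerPow c n := by
    intro m
    induction m with
    | zero => rfl
    | succ m ih =>
      ext x
      rw [← add_assoc, mem_kerPow_succ, ih, ← mem_kerPow_succ, hn]
  refine le_antisymm (iSup_le fun m => ?_) (le_iSup _ n)
  rw [← key m]
  exact h.kerPow_mono c (Nat.le_add_left m n)

/-- The power `(1 - cR)ⁿ` is `1 - K` with `K` compact, so its kernel is the eigenspace of `K` at
`1`. -/
lemma finite_kerPow [CompleteSpace H] (h : HasBoundedInverse T R) (hR : IsCompactOperator R) (c : ℂ) (n : ℕ) :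
    Module.Finite ℂ (T.kerPow c n) := by
  have hK : IsCompactOperator (1 - oneSub R c ^ n : H →L[ℂ] H) := by
    induction n with
    | zero =>
      rw [pow_zero, sub_self]
      exact isCompactOperator_zero
    | succ n ih =>
      have e : (1 - oneSub R c ^ (n + 1) : H →L[ℂ] H)
          = (1 - oneSub R c ^ n) + oneSub R c ^ n * (c • R) := by
        rw [pow_succ, oneSub, mul_sub, mul_one]; abel
      rw [e]
      exact ih.add ((hR.smul c).clm_comp (oneSub R c ^ n))
  have hf := ContinuousLinearMap.finite_dimensional_eigenspace hK 1 one_ne_zero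
  have e : T.kerPow c n
      = Module.End.eigenspace (1 - oneSub R c ^ n : H →L[ℂ] H).toLinearMap 1 := by
    ext x
    rw [h.mem_kerPow_iff, Module.End.mem_eigenspace_iff, one_smul]
    change _ ↔ x - (oneSub R c ^ n) x = x
    rw [sub_eq_self]
  rw [e]
  exact hf

lemma finite_rootSpace [CompleteSpace H] (h : HasBoundedInverse T R) (hR : IsCompactOperator R) (c : ℂ) :
    Module.Finite ℂ (T.rootSpace c) := by
  obtain ⟨n, hn⟩ := h.exists_kerPow_eq hR c
  rw [h.rootSpace_eq_of_kerPow_eq hn]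
  exact h.finite_kerPow hR c n

lemma finite_eigenspace [CompleteSpace H] (h : HasBoundedInverse T R) (hR : IsCompactOperator R) (c : ℂ) :
    Module.Finite ℂ (T.eigenspace c) := h.finite_kerPow hR c 1

lemma eigenspace_le_rootSpace (c : ℂ) : T.eigenspace c ≤ T.rootSpace c :=
  kerPow_one (T := T) (c := c) ▸ le_iSup (T.kerPow c) 1

/-- The spectrum consists of eigenvalues. -/
lemma mem_spectrum_iff [CompleteSpace H] (h : HasBoundedInverse T R) (hR : IsCompactOperator R)
    {c : ℂ} : c ∈ T.unboundedSpectrum ↔ T.eigenspace c ≠ ⊥ := by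
  rw [← not_iff_not, not_not]
  change ¬ ¬ T.InResolventSet c ↔ _
  rw [not_not]
  constructor
  · rintro ⟨B, -, hB⟩
    rw [eq_bot_iff]
    intro x hx
    rw [mem_eigenspace_iff'] at hx
    obtain ⟨hd, hx⟩ := hx
    have := hB ⟨x, hd⟩
    rw [hx, sub_self, map_zero] at this
    exact this.symm
  · intro hbot
    -- Fredholm alternative: `1 - cR = c (c⁻¹ - R)` is invertible unless `c⁻¹` is an eigenvalue of
    -- `R`.
    have hu : IsUnit (oneSub R c) := by
      rcases eq_or_ne c 0 with rfl | hc
      · rw [oneSub, zero_smul, sub_zero]; exact isUnit_one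
      · have hne : ¬ Module.End.HasEigenvalue (R : Module.End ℂ H) c⁻¹ := by
          intro he
          obtain ⟨x, hx⟩ := he.exists_hasEigenvector
          have hx1 : R x = c⁻¹ • x := Module.End.mem_eigenspace_iff.1 hx.1
          have hx2 : x ∈ T.eigenspace c := by
            rw [h.mem_eigenspace_iff, hx1, smul_inv_smul₀ hc]
          rw [hbot] at hx2
          exact hx.2 ((Submodule.mem_bot ℂ).1 hx2)
        have hr := (hR.hasEigenvalue_or_mem_resolventSet (inv_ne_zero hc)).resolve_left hne
        rw [spectrum.mem_resolventSet_iff] at hr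
        have e : oneSub R c = (Units.mk0 c hc) • (algebraMap ℂ (H →L[ℂ] H) c⁻¹ - R) := by
          rw [Units.smul_mk0, smul_sub, Algebra.algebraMap_eq_smul_one, smul_inv_smul₀ hc, oneSub]
        rw [e]
        exact hr.smul _
    obtain ⟨S, hS⟩ := hu
    set B : H →L[ℂ] H := ↑S⁻¹ with hB
    have h1 : ∀ x, oneSub R c (B x) = x := fun x => by
      rw [← hS]; exact congrArg (fun A : H →L[ℂ] H => A x) S.mul_inv
    have h2 : ∀ x, B (oneSub R c x) = x := fun x => by
      rw [← hS]; exact congrArg (fun A : H →L[ℂ] H => A x) S.inv_mul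
    -- From `R (T - c) = 1 - cR` the resolvent `(c - T)⁻¹` must be `-(1 - cR)⁻¹ R`.
    refine ⟨-(B * R), fun f => ?_, fun x => ?_⟩
    · have e : (-(B * R)) f = R (c • (-(B * R)) f - f) := by
        have := h1 (R f)
        rw [oneSub_apply] at this
        change -(B (R f)) = R (c • -(B (R f)) - f)
        rw [map_sub, map_smul, map_neg, smul_neg]
        nth_rewrite 3 [← this]
        abel
      have hd : (-(B * R)) f ∈ T.domain := (h.mem_domain_iff _).2 ⟨_, e⟩
      refine ⟨hd, ?_⟩
      rw [(h.apply_eq_iff ⟨_, hd⟩ _).2 e, sub_sub_cancel]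
    · have e := (h.apply_eq_iff x _).1 rfl
      change -(B (R (c • (x : H) - T x))) = x
      rw [map_sub, map_smul, ← e, ← map_neg, neg_sub, ← oneSub_apply, h2]

/-- There are finitely many eigenvalues in a ball. -/
lemma finite_eigenvalues (h : HasBoundedInverse T R) (hR : IsCompactOperator R) (r : ℝ) :
    {c : ℂ | T.eigenspace c ≠ ⊥ ∧ ‖c‖ ≤ r}.Finite := by
  by_contra hinf
  have := (Set.not_finite.1 hinf).natEmbedding
  set e := (Set.not_finite.1 hinf).natEmbedding with he
  have hx : ∀ n, ∃ x ∈ T.eigenspace (e n), x ≠ 0 := fun n =>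
    Submodule.exists_mem_ne_zero_of_ne_bot (e n).2.1
  choose x hxe hx0 using hx
  have hxR : ∀ n, x n = (e n : ℂ) • R (x n) := fun n => h.mem_eigenspace_iff.1 (hxe n)
  have he0 : ∀ n, (e n : ℂ) ≠ 0 := by
    intro n h0
    apply hx0 n
    rw [hxR n, h0, zero_smul]
  have hRx : ∀ n, R (x n) = (e n : ℂ)⁻¹ • x n := by
    intro n
    conv_rhs => rw [hxR n]
    rw [inv_smul_smul₀ (he0 n)]
  have hli : LinearIndependent ℂ x := by
    refine Module.End.eigenvectors_linearIndependent' (R : Module.End ℂ H)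
      (fun n => (e n : ℂ)⁻¹) (fun m n hmn => ?_) x (fun n => ⟨?_, hx0 n⟩)
    · exact e.injective (Subtype.ext (inv_injective hmn))
    · exact Module.End.mem_eigenspace_iff.2 (hRx n)
  -- On these spans `R` is diagonal with entries `1 / e i`, so `1 - e n R` kills `x n` and maps `F
  -- (n + 1)` into `F n`.
  set F : ℕ → Submodule ℂ H := fun n => Submodule.span ℂ (x '' Set.Iio n) with hF
  have hmono : Monotone F := fun m n hmn =>
    Submodule.span_mono (Set.image_mono (Set.Iio_subset_Iio hmn))
  have hstrict : StrictMono F := by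
    refine strictMono_nat_of_lt_succ fun n => lt_of_le_of_ne (hmono (Nat.le_succ n)) fun heq => ?_
    have h1 : x n ∈ F (n + 1) := Submodule.subset_span ⟨n, Nat.lt_succ_self n, rfl⟩
    rw [← heq] at h1
    exact (hli.notMem_span_image (s := Set.Iio n) (x := n) (lt_irrefl n)) h1
  refine false_of_strictMono hR hstrict (fun n => ?_) (fun n y hy => ?_) (fun n => (e n : ℂ))
    (fun n => (e n).2.2) (fun n y hy => ?_)
  · have : FiniteDimensional ℂ (F n) :=
      FiniteDimensional.span_of_finite ℂ ((Set.finite_Iio n).image x)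
    exact (F n).closed_of_finiteDimensional
  · refine Submodule.span_induction (p := fun y _ => R y ∈ F n) ?_ ?_ ?_ ?_ hy
    · rintro _ ⟨i, hi, rfl⟩
      rw [hRx]
      exact (F n).smul_mem _ (Submodule.subset_span ⟨i, hi, rfl⟩)
    · rw [map_zero]; exact zero_mem _
    · intro y z _ _ h1 h2
      rw [map_add]; exact add_mem h1 h2
    · intro a y _ h1
      rw [map_smul]; exact (F n).smul_mem _ h1
  · refine Submodule.span_induction (p := fun y _ => oneSub R (e n) y ∈ F n) ?_ ?_ ?_ ?_ hy
    · rintro _ ⟨i, hi, rfl⟩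
      rw [oneSub_apply]
      rcases (Nat.lt_succ_iff.1 hi).lt_or_eq with hlt | rfl
      · rw [hRx]
        have := Submodule.subset_span (R := ℂ) (s := x '' Set.Iio n) ⟨i, hlt, rfl⟩
        exact sub_mem this ((F n).smul_mem _ ((F n).smul_mem _ this))
      · rw [← hxR, sub_self]; exact zero_mem _
    · rw [map_zero]; exact zero_mem _
    · intro y z _ _ h1 h2
      rw [map_add]; exact add_mem h1 h2
    · intro a y _ h1
      rw [map_smul]; exact (F n).smul_mem _ h1

/-! ### Skew-adjoint operators -/

/-- All is read off from `R* = -R`. A vector orthogonal to the range of `R` lies in `ker R = 0`. If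
`⟪T x, y⟫ = ⟪x, w⟫` for all `x = R f`, then `⟪f, y⟫ = ⟪R f, w⟫ = ⟪f, R (-w)⟫`, so `y = R (-w)`. -/
lemma isSkewAdjoint [CompleteSpace H] (h : HasBoundedInverse T R)
    (hs : ∀ f g, inner ℂ f (R g) + inner ℂ (R f) g = 0) : T.IsSkewAdjoint := by
  have hd : ∀ f, R f ∈ T.domain := fun f => (h.mem_domain_iff _).2 ⟨f, rfl⟩
  have hT : ∀ f, T ⟨R f, hd f⟩ = f := fun f => (h.apply_eq_iff _ _).2 rfl
  constructor
  · rw [Submodule.dense_iff_topologicalClosure_eq_top,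
      Submodule.topologicalClosure_eq_top_iff, eq_bot_iff]
    intro y hy
    have h1 : R y = 0 := by
      rw [← inner_self_eq_zero (𝕜 := ℂ)]
      have h2 := hs (R y) y
      have h3 := (Submodule.mem_orthogonal _ _).1 hy _ (hd (R y))
      rwa [h3, add_zero] at h2
    exact h.injective (h1.trans (map_zero R).symm)
  · intro y w
    constructor
    · intro hyw
      have key : y = R (-w) := by
        rw [← sub_eq_zero, ← inner_self_eq_zero (𝕜 := ℂ)]
        set f := y - R (-w) with hf
        have h1 := hyw ⟨R f, hd f⟩
        rw [hT] at h1
        have h2 := hs f (-w)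
        rw [inner_neg_right] at h2
        rw [hf, inner_sub_right, ← hf, h1]
        simp only at h2 ⊢
        linear_combination -h2
      refine ⟨key ▸ hd _, ?_⟩
      rw [(h.apply_eq_iff ⟨y, key ▸ hd _⟩ (-w)).2 key, neg_neg]
    · rintro ⟨hy, rfl⟩ x
      have h1 := (h.apply_eq_iff ⟨y, hy⟩ _).1 rfl
      have h2 := (h.apply_eq_iff x _).1 rfl
      have h3 := hs (T x) (T ⟨y, hy⟩)
      rw [← h1, ← h2] at h3
      rw [inner_neg_right]
      linear_combination h3

/-- An eigenvector `y = (1 - cR) x` forces `c` to be imaginary, and then `1 - cR` is symmetric. Its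
kernel is orthogonal to its range, and `y` lies in both. -/
lemma kerPow_two_of_skew (h : HasBoundedInverse T R)
    (hs : ∀ f g, inner ℂ f (R g) + inner ℂ (R f) g = 0) (c : ℂ) :
    T.kerPow c 2 = T.kerPow c 1 := by
  refine le_antisymm (fun x hx => ?_) (h.kerPow_mono c one_le_two)
  rw [h.mem_kerPow_iff, pow_two, mul_apply_eq_comp] at hx
  rw [h.mem_kerPow_iff, pow_one]
  set y := oneSub R c x with hy
  have hy' : y = c • R y := by rwa [oneSub_apply, sub_eq_zero] at hx
  rcases eq_or_ne c 0 with rfl | hc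
  · rw [hy', zero_smul]
  by_contra hne
  have hyy : inner ℂ y y ≠ (0 : ℂ) := inner_self_ne_zero.2 hne
  have e1 := hs y y
  have hRy : R y = c⁻¹ • y := by
    conv_rhs => rw [hy']
    rw [inv_smul_smul₀ hc]
  rw [hRy, inner_smul_right, inner_smul_left, ← add_mul, mul_eq_zero] at e1
  have e2 := e1.resolve_right hyy
  have hconj : starRingEnd ℂ c = -c := by
    rw [map_inv₀] at e2
    have hc' : starRingEnd ℂ c ≠ 0 := (map_ne_zero _).2 hc
    field_simp at e2
    linear_combination e2
  apply hyy
  have e3 : inner ℂ y y = inner ℂ y x - c * inner ℂ y (R x) := by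
    rw [show inner ℂ y y = inner ℂ y (x - c • R x) from rfl, inner_sub_right, inner_smul_right]
  have e4 := hs y x
  rw [hRy, inner_smul_left, map_inv₀, hconj] at e4
  rw [e3]
  field_simp at e4
  linear_combination -e4

end HasBoundedInverse

end InverseOperator
end

noncomputable section

namespace InverseOperator

/-! ### Jordan chains of nilpotent endomorphisms -/

open Polynomial in
lemma exists_basis_quotient_X_pow {K : Type*} [Field K] (n : ℕ) :
    ∃ b : Module.Basis (Fin n) K (K[X] ⧸ Submodule.span K[X] {(X : K[X]) ^ n}),
      ∀ j, b j = Submodule.Quotient.mk ((X : K[X]) ^ (j : ℕ)) := by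
  set e := finCongr (show (AdjoinRoot.powerBasis' (monic_X_pow (R := K) n)).dim = n by
    rw [AdjoinRoot.powerBasis'_dim, natDegree_X_pow])
  refine ⟨(AdjoinRoot.powerBasis' (monic_X_pow (R := K) n)).basis.reindex e, fun j => ?_⟩
  have h : (AdjoinRoot.powerBasis' (monic_X_pow (R := K) n)).basis.reindex e j
      = AdjoinRoot.mk _ (X ^ (j : ℕ)) := by
    rw [Module.Basis.reindex_apply, PowerBasis.basis_eq_pow, AdjoinRoot.powerBasis'_gen, map_pow,
      AdjoinRoot.mk_X]
    rfl
  exact h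

lemma basis_apply_eq_single {ι K : Type*} [DecidableEq ι] [Semiring K] {M η : ι → Type*}
    [∀ i, AddCommMonoid (M i)] [∀ i, Module K (M i)] (b : ∀ i, Module.Basis (η i) K (M i)) (i : ι)
    (j : η i) : DFinsupp.basis b ⟨i, j⟩ = DFinsupp.single i (b i j) := by
  classical
  rw [Module.Basis.apply_eq_iff]
  change sigmaFinsuppEquivDFinsupp.symm (DFinsupp.mapRange (fun i x => (b i).repr x) (fun _ => map_zero _)
    (DFinsupp.single i (b i j))) = _
  rw [DFinsupp.mapRange_single, Module.Basis.repr_self, Equiv.symm_apply_eq,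
    sigmaFinsuppEquivDFinsupp_single]

open Polynomial in
-- With `X` acting as `N`, the space `V` is a finitely generated module in which powers of `X`
-- annihilate every element, hence a direct sum of modules `K[X] / (X ^ k i)`. The powers of `X`
-- times a generator form one chain.
lemma exists_jordan_basis {K V : Type*} [Field K] [AddCommGroup V] [Module K V]
    [FiniteDimensional K V] (N : V →ₗ[K] V) (hN : IsNilpotent N) :
    ∃ (d : ℕ) (k : Fin d → ℕ) (v : Fin d → V) (B : Module.Basis (Σ i, Fin (k i)) K V),
      (∀ i, (N ^ k i) (v i) = 0) ∧ ∀ i (j : Fin (k i)), B ⟨i, j⟩ = (N ^ (j : ℕ)) (v i) := by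
  have htors : Module.IsTorsion' (Module.AEval' N) (Submonoid.powers (X : K[X])) := by
    obtain ⟨n, hn⟩ := hN
    intro x
    refine ⟨⟨X ^ n, n, rfl⟩, ?_⟩
    change (X ^ n : K[X]) • x = 0
    obtain ⟨m, rfl⟩ := (Module.AEval'.of N).surjective x
    rw [Module.AEval'.X_pow_smul_of, hn]
    simp
  classical
  obtain ⟨d, k, ⟨f⟩⟩ := Module.torsion_by_prime_power_decomposition (irreducible_X (R := K)) htors
  choose b hb using fun i => exists_basis_quotient_X_pow (K := K) (k i)
  let g : V ≃ₗ[K] DirectSum (Fin d) fun i => K[X] ⧸ Submodule.span K[X] {(X : K[X]) ^ k i} :=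
    (Module.AEval'.of N).trans (f.restrictScalars K)
  have hg : ∀ n x, g.symm ((X ^ n : K[X]) • x) = (N ^ n) (g.symm x) := by
    intro n x
    apply g.injective
    rw [g.apply_symm_apply]
    change _ = f (Module.AEval'.of N ((N ^ n) (g.symm x)))
    have h1 := Module.AEval'.X_pow_smul_of N (g.symm x) n
    change _ = Module.AEval'.of N ((N ^ n) (g.symm x)) at h1
    rw [← h1, map_smul]
    congr 1
    exact (g.apply_symm_apply x).symm
  let w : ∀ i : Fin d, DirectSum (Fin d) fun i => K[X] ⧸ Submodule.span K[X] {(X : K[X]) ^ k i} :=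
    fun i => DirectSum.lof K[X] (Fin d) _ i (Submodule.Quotient.mk 1)
  have hw : ∀ i n, (X ^ n : K[X]) • w i
      = DirectSum.lof K[X] (Fin d) _ i (Submodule.Quotient.mk (X ^ n)) := by
    intro i n
    rw [← map_smul, ← Submodule.Quotient.mk_smul, smul_eq_mul, mul_one]
  refine ⟨d, k, fun i => g.symm (w i), (DFinsupp.basis b).map g.symm, fun i => ?_, fun i j => ?_⟩
  · rw [← hg, hw, (Submodule.Quotient.mk_eq_zero _).2 (Submodule.mem_span_singleton_self _),
      map_zero, map_zero]
  · rw [← hg, hw, Module.Basis.map_apply, ← hb]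
    congr 1
    exact basis_apply_eq_single b i j

/-- Every nilpotent endomorphism of a finite-dimensional space has a basis of Jordan chains. -/
lemma exists_jordan_chains {K V : Type*} [Field K] [AddCommGroup V] [Module K V]
    [FiniteDimensional K V] (N : V →ₗ[K] V) (hN : IsNilpotent N) :
    ∃ (δ : Fin (Module.finrank K (LinearMap.ker N)) → ℕ)
      (ψ : Fin (Module.finrank K (LinearMap.ker N)) → ℕ → V),
      (∀ r, 1 ≤ δ r) ∧ ∑ r, δ r = Module.finrank K V ∧ (∀ r, ψ r 0 = 0) ∧
      (∀ r, ∀ l < δ r, N (ψ r (l + 1)) = ψ r l) ∧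
      LinearIndependent K fun q : (Σ r, Fin (δ r)) => ψ q.1 (q.2 + 1) := by
  obtain ⟨d, k, v, B, hv, hB⟩ := exists_jordan_basis N hN
  have hV : Module.finrank K V = ∑ i, k i := by
    rw [Module.finrank_eq_card_basis B]; simp
  have hsucc : ∀ n x, N ((N ^ n) x) = (N ^ (n + 1)) x := fun n x => by rw [pow_succ']; rfl
  -- Blocks of size `0` may occur and are discarded. The last vectors of the other chains are
  -- independent in the kernel, the non-initial vectors are independent in the range, and
  -- rank-nullity turns both inequalities into equalities. So the nonempty chains are counted by
  -- `dim ker N`.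
  have hker : Fintype.card {i // k i ≠ 0} ≤ Module.finrank K (LinearMap.ker N) := by
    have h1 : LinearIndependent K (fun i : {i // k i ≠ 0} =>
        B ⟨i, ⟨k i - 1, Nat.sub_lt (Nat.pos_of_ne_zero i.2) one_pos⟩⟩) :=
      B.linearIndependent.comp _ fun i j hij => Subtype.ext (congrArg Sigma.fst hij)
    have h2 : ∀ i : {i // k i ≠ 0},
        B ⟨i, ⟨k i - 1, Nat.sub_lt (Nat.pos_of_ne_zero i.2) one_pos⟩⟩ ∈ LinearMap.ker N := by
      intro i
      have : k i - 1 + 1 = k i := Nat.sub_add_cancel (Nat.pos_of_ne_zero i.2)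
      rw [LinearMap.mem_ker, hB, hsucc]
      exact this.symm ▸ hv i
    have h3 : LinearIndependent K (fun i => (⟨_, h2 i⟩ : LinearMap.ker N)) :=
      LinearIndependent.of_comp (LinearMap.ker N).subtype h1
    exact h3.fintype_card_le_finrank
  have hrange : ∑ i, (k i - 1) ≤ Module.finrank K (LinearMap.range N) := by
    let s : (Σ i, Fin (k i - 1)) → Σ i, Fin (k i) := fun q => ⟨q.1, ⟨q.2 + 1, by omega⟩⟩
    have hs : Function.Injective s := by
      rintro ⟨i, a⟩ ⟨j, c⟩ h
      simp only [s, Sigma.mk.injEq] at h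
      obtain ⟨rfl, h⟩ := h
      simp only [heq_eq_eq, Fin.mk.injEq, Nat.add_right_cancel_iff] at h
      rw [Fin.ext h]
    have h1 : LinearIndependent K (fun q => B (s q)) := B.linearIndependent.comp s hs
    have h2 : ∀ q, B (s q) ∈ LinearMap.range N := by
      intro q
      rw [hB]
      exact ⟨_, hsucc _ _⟩
    have h3 : LinearIndependent K (fun q => (⟨_, h2 q⟩ : LinearMap.range N)) :=
      LinearIndependent.of_comp (LinearMap.range N).subtype h1
    have := h3.fintype_card_le_finrank
    simpa using this
  have hsum : ∑ i, k i = ∑ i, (k i - 1) + Fintype.card {i // k i ≠ 0} := by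
    rw [Fintype.card_subtype, Finset.card_filter, ← Finset.sum_add_distrib]
    refine Finset.sum_congr rfl fun i _ => ?_
    split_ifs <;> omega
  have hrn := LinearMap.finrank_range_add_finrank_ker N
  have hcard : Fintype.card {i // k i ≠ 0}
      = Fintype.card (Fin (Module.finrank K (LinearMap.ker N))) := by
    rw [Fintype.card_fin]; omega
  let e := (Fintype.equivOfCardEq hcard).symm
  -- The chain is read backwards: `l = 0` gives `N ^ k v = 0` and `l = k` gives the generator.
  refine ⟨fun r => k (e r), fun r l => (N ^ (k (e r) - l)) (v (e r)),
    fun r => Nat.one_le_iff_ne_zero.2 (e r).2, ?_, fun r => hv _, fun r l hl => ?_, ?_⟩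
  · rw [hV, e.sum_comp fun i => k i]
    have := Fintype.sum_subtype_add_sum_subtype (fun i => k i ≠ 0) k
    rw [← this, left_eq_add]
    exact Finset.sum_eq_zero fun i _ => not_not.1 i.2
  · rw [hsucc]
    have hl' : l < k (e r) := hl
    congr 2
    omega
  · let s : (Σ r, Fin (k (e r))) → Σ i, Fin (k i) := fun q => ⟨e q.1, Fin.rev q.2⟩
    have hs : Function.Injective s := by
      rintro ⟨i, a⟩ ⟨j, c⟩ h
      have h1 : i = j := e.injective (Subtype.ext (congrArg Sigma.fst h))
      subst h1
      simp only [s, Sigma.mk.injEq, heq_eq_eq, true_and] at h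
      rw [Fin.rev_injective h]
    convert B.linearIndependent.comp s hs using 1
    ext q
    simp only [Function.comp_apply, s, hB, Fin.val_rev]

variable {H : Type*} [NormedAddCommGroup H] [InnerProductSpace ℂ H]

/-! ### Jordan chains in root spaces and orthonormal bases of eigenvectors -/

namespace HasBoundedInverse

variable {T : H →ₗ.[ℂ] H} {R : H →L[ℂ] H}

/-- The root space at `c` has a basis of Jordan chains. -/
lemma exists_isJordanChain [CompleteSpace H] (h : HasBoundedInverse T R)
    (hR : IsCompactOperator R) (c : ℂ) {n : ℕ} (hn : Module.finrank ℂ (T.eigenspace c) = n) :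
    ∃ (δ : Fin n → ℕ) (ψ : Fin n → ℕ → H),
      (∀ r, 1 ≤ δ r) ∧ ∑ r, δ r = Module.finrank ℂ (T.rootSpace c) ∧
      (∀ r, T.IsJordanChain c (δ r) (ψ r)) ∧
      LinearIndependent ℂ fun q : (Σ r, Fin (δ r)) => ψ q.1 (q.2 + 1) := by
  obtain ⟨k, hk⟩ := h.exists_kerPow_eq hR c
  have hroot := h.rootSpace_eq_of_kerPow_eq hk
  have hfin := h.finite_rootSpace hR c
  -- The root space equals both `kerPow c (k + 1)` and `kerPow c k`, so it lies in the domain and `T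
  -- - c` maps it to itself.
  have hmem : ∀ x : T.rootSpace c, ∃ hd : (x : H) ∈ T.domain,
      T ⟨x, hd⟩ - c • (x : H) ∈ T.rootSpace c := by
    rintro ⟨x, hx⟩
    rw [hroot, ← hk, mem_kerPow_succ, ← hroot] at hx
    exact hx
  let N : T.rootSpace c →ₗ[ℂ] T.rootSpace c :=
    { toFun := fun x => ⟨_, (hmem x).2⟩
      map_add' := fun x y => by
        refine Subtype.ext ?_
        have := T.map_add ⟨x, (hmem x).1⟩ ⟨y, (hmem y).1⟩
        change T (⟨x, (hmem x).1⟩ + ⟨y, (hmem y).1⟩) - c • ((x : H) + y)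
          = (T ⟨x, _⟩ - c • (x : H)) + (T ⟨y, _⟩ - c • (y : H))
        rw [this]
        module
      map_smul' := fun a x => by
        refine Subtype.ext ?_
        have := T.map_smul a ⟨x, (hmem x).1⟩
        change T ⟨a • (x : H), _⟩ - c • (a • (x : H)) = a • (T ⟨x, _⟩ - c • (x : H))
        rw [smul_sub, ← this, smul_comm a c]
        rfl }
  have hN : ∀ x, ((N x : T.rootSpace c) : H) = T ⟨x, (hmem x).1⟩ - c • (x : H) := fun x => rfl
  have hpow : ∀ j, ∀ x : T.rootSpace c, (x : H) ∈ T.kerPow c j → (N ^ j) x = 0 := by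
    intro j
    induction j with
    | zero =>
      intro x hx
      exact Subtype.ext ((Submodule.mem_bot ℂ).1 hx)
    | succ j ih =>
      intro x hx
      rw [pow_succ]
      refine ih (N x) ?_
      rw [hN]
      exact (mem_kerPow_succ.1 hx).2
  have hnil : IsNilpotent N := by
    refine ⟨k, LinearMap.ext fun x => hpow k x ?_⟩
    rw [← hroot]
    exact x.2
  have hker : (LinearMap.ker N).map (T.rootSpace c).subtype = T.eigenspace c := by
    ext x
    rw [mem_eigenspace_iff']
    constructor
    · rintro ⟨y, hy, rfl⟩
      refine ⟨(hmem y).1, sub_eq_zero.1 ?_⟩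
      rw [SetLike.mem_coe, LinearMap.mem_ker] at hy
      exact (hN y).symm.trans (congrArg Subtype.val hy)
    · rintro ⟨hd, hx⟩
      have hx' : x ∈ T.rootSpace c := eigenspace_le_rootSpace c (mem_eigenspace_iff'.2 ⟨hd, hx⟩)
      exact ⟨⟨x, hx'⟩, Subtype.ext (sub_eq_zero.2 hx), rfl⟩
  have hkn : Module.finrank ℂ (LinearMap.ker N) = n := by
    rw [← hn, ← hker]
    exact (Submodule.finrank_map_subtype_eq _ _).symm
  subst hkn
  obtain ⟨δ, ψ, h1, h2, h3, h4, h5⟩ := exists_jordan_chains N hnil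
  refine ⟨δ, fun r l => ψ r l, h1, h2, fun r => ⟨by simp [h3], fun l hl => ?_⟩, ?_⟩
  · refine ⟨(hmem _).1, ?_⟩
    exact (hN _).symm.trans (congrArg Subtype.val (h4 r l hl))
  · exact h5.map' (T.rootSpace c).subtype (Submodule.ker_subtype _)

/-- This links `T` to the symmetric operator `iR`. With `0⁻¹ = 0` it also holds at `c = 0`, where
both sides vanish because `R` is injective. -/
lemma eigenspace_eq (h : HasBoundedInverse T R) (c : ℂ) :
    T.eigenspace c = Module.End.eigenspace (Complex.I • R : H →L[ℂ] H).toLinearMap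
      (Complex.I * c⁻¹) := by
  ext x
  rw [h.mem_eigenspace_iff, Module.End.mem_eigenspace_iff]
  change _ ↔ Complex.I • R x = _
  rw [mul_smul, (smul_right_injective H Complex.I_ne_zero).eq_iff]
  rcases eq_or_ne c 0 with rfl | hc
  · rw [zero_smul, inv_zero, zero_smul, ← map_zero R, h.injective.eq_iff, map_zero]
  · rw [eq_comm, eq_inv_smul_iff₀ hc]

/-- A skew-adjoint operator with compact inverse has an orthonormal basis of eigenvectors. -/
lemma exists_hilbertBasis [CompleteSpace H] (h : HasBoundedInverse T R)
    (hR : IsCompactOperator R) (hs : ∀ f g, inner ℂ f (R g) + inner ℂ (R f) g = 0)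
    {ι α : Type*} (e : ι → ℂ) (he : Function.Injective e)
    (hsurj : ∀ c, T.eigenspace c ≠ ⊥ → ∃ i, e i = c) (d : ι → ℕ)
    (hd : ∀ i, Module.finrank ℂ (T.eigenspace (e i)) = d i) (τ : α ≃ Σ i, Fin (d i)) :
    ∃ φ : HilbertBasis α ℂ H, ∀ a, φ a ∈ T.eigenspace (e (τ a).1) := by
  set K : H →L[ℂ] H := Complex.I • R with hK
  have hKc : IsCompactOperator K := hR.smul Complex.I
  have hKs : K.IsSymmetric := by
    intro f g
    change inner ℂ (Complex.I • R f) g = inner ℂ f (Complex.I • R g)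
    rw [inner_smul_left, inner_smul_right, Complex.conj_I]
    linear_combination -Complex.I * hs f g
  have hfam : OrthogonalFamily ℂ (fun i => T.eigenspace (e i))
      fun i => (T.eigenspace (e i)).subtypeₗᵢ := by
    have := hKs.orthogonalFamily_eigenspaces.comp (γ := ι) (f := fun i => Complex.I * (e i)⁻¹)
      (fun i j hij => he (inv_injective (mul_left_cancel₀ Complex.I_ne_zero hij)))
    intro i j hij x y
    exact this hij ⟨x, h.eigenspace_eq (e i) ▸ x.2⟩ ⟨y, h.eigenspace_eq (e j) ▸ y.2⟩
  have hfin : ∀ i, Module.Finite ℂ (T.eigenspace (e i)) := fun i => h.finite_eigenspace hR _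
  let b : ∀ i, OrthonormalBasis (Fin (d i)) ℂ (T.eigenspace (e i)) := fun i =>
    (stdOrthonormalBasis ℂ (T.eigenspace (e i))).reindex (finCongr (hd i))
  let v : (Σ i, Fin (d i)) → H := fun q => (b q.1 q.2 : H)
  have hv : Orthonormal ℂ v :=
    hfam.orthonormal_sigma_orthonormal (v_family := fun i => b i) fun i => (b i).orthonormal
  have hle : ∀ c, T.eigenspace c ≤ Submodule.span ℂ (Set.range v) := by
    intro c
    by_cases hc : T.eigenspace c = ⊥
    · rw [hc]; exact bot_le
    obtain ⟨i, rfl⟩ := hsurj c hc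
    have h1 : Submodule.map (T.eigenspace (e i)).subtype (Submodule.span ℂ (Set.range (b i)))
        = T.eigenspace (e i) := by
      rw [← OrthonormalBasis.coe_toBasis, (b i).toBasis.span_eq, Submodule.map_subtype_top]
    rw [← h1, Submodule.map_span]
    refine Submodule.span_mono ?_
    rintro _ ⟨_, ⟨j, rfl⟩, rfl⟩
    exact ⟨⟨i, j⟩, rfl⟩
  have hbot : (Submodule.span ℂ (Set.range (v ∘ τ)))ᗮ = ⊥ := by
    rw [τ.surjective.range_comp, eq_bot_iff,
      ← ContinuousLinearMap.orthogonalComplement_iSup_eigenspaces_eq_bot hKc hKs]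
    -- Every eigenspace of `iR`, at any `μ`, is the eigenspace of `T` at `i μ⁻¹`, so the spectral
    -- theorem for `iR` gives completeness.
    refine Submodule.orthogonal_le (iSup_le fun μ => ?_)
    refine le_trans (le_of_eq ?_) (hle (Complex.I * μ⁻¹))
    rw [h.eigenspace_eq, mul_inv, inv_inv, ← mul_assoc, Complex.inv_I, mul_neg, Complex.I_mul_I,
      neg_neg, one_mul]
  refine ⟨HilbertBasis.mkOfOrthogonalEqBot (hv.comp τ τ.injective) hbot, fun a => ?_⟩
  rw [HilbertBasis.coe_mkOfOrthogonalEqBot]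
  exact (b (τ a).1 (τ a).2).2

end HasBoundedInverse

end InverseOperator

namespace Timoshenko

open InverseOperator

/-! ### The Timoshenko operators as instances of the abstract theory -/

lemma hasBoundedInverse_op (p : Params) (k₂ k₄ : ℝ) :
    HasBoundedInverse (op p k₂ k₄) (opInv p k₂ k₄) :=
  ⟨fun _ => mem_domain_op_iff, fun U F => op_apply_eq_iff U F⟩

lemma inner_opInv_add (p : Params) (F G : Energy p) :
    inner ℂ F (opInv p 0 0 G) + inner ℂ (opInv p 0 0 F) G = 0 :=
  opRel_skew (opRel_iff.2 rfl) (opRel_iff.2 rfl)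

end Timoshenko
end

noncomputable section

namespace Timoshenko

open InverseOperator

/-! ### The eigenvalue equation as a quadratic pencil -/

/-- The strain `s = uₓ + y` and the derivative `q = yₓ` of a solution of the resolvent equation
with right-hand side built from `f` and `g`. -/
structure PencilSol (b c : ℂ) (f g u y s q : H1) : Prop where
  dx_u : H1.dx u = H1.fn (s - y)
  dx_y : H1.dx y = H1.fn q
  dx_s : H1.dx s = H1.fn (c ^ 2 • u + (2 * c) • f)
  dx_q : H1.dx q = H1.fn (c ^ 2 • y + b • s + (2 * c) • g)

/-- The vector of the energy space with the displacements `u`, `y` and the velocities `c u + f`,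
`c y + g`. -/
structure IsLift {p : Params} (c : ℂ) (f g : H1) (W : Energy p) : Prop where
  v_eq : W.v = H1.fn (c • W.u + f)
  z_eq : W.z = H1.fn (c • W.y + g)
  η_eq : W.η = H1.ev 1 (c • W.u + f)
  γ_eq : W.γ = H1.ev 1 (c • W.y + g)

/-- Eliminating the velocities turns `(𝒜 - c) W = Ψ` into a second order problem. As `Ψ` has
velocity `c f`, the load is `c (c u + f) + c f = c² u + 2c f`. The case `Ψ = 0` describes
eigenvectors, an eigenvector `Ψ` describes chains of length two. -/
lemma opRel_iff_pencil {p : Params} {k₂ k₄ : ℝ} {c : ℂ} {W Ψ : Energy p} (hΨ : IsLift c 0 0 Ψ) :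
    OpRel p k₂ k₄ W (c • W + Ψ) ↔ IsLift c Ψ.u Ψ.y W ∧
      ∃ s q : H1, PencilSol p.b c Ψ.u Ψ.y W.u W.y s q ∧
        (p.k₁ : ℂ) * H1.ev 1 s + c * (c + k₂) * H1.ev 1 W.u + (2 * c + k₂) * H1.ev 1 Ψ.u = 0 ∧
        (p.k₃ : ℂ) * H1.ev 1 q + c * (c + k₄) * H1.ev 1 W.y + (2 * c + k₄) * H1.ev 1 Ψ.y = 0 := by
  obtain ⟨e1, e2, e3, e4⟩ := hΨ
  simp only [add_zero] at e1 e2 e3 e4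
  have eu : (c • W + Ψ).u = c • W.u + Ψ.u := rfl
  have ey : (c • W + Ψ).y = c • W.y + Ψ.y := rfl
  have ev : (c • W + Ψ).v = c • W.v + Ψ.v := rfl
  have ez : (c • W + Ψ).z = c • W.z + Ψ.z := rfl
  have eη : (c • W + Ψ).η = c • W.η + Ψ.η := rfl
  have eγ : (c • W + Ψ).γ = c • W.γ + Ψ.γ := rfl
  constructor
  · rintro ⟨ux, yx, h1, h2, h3, h4, h5, h6, h7, h8, h9, h10⟩
    rw [eu] at h3 h5
    rw [ey] at h4 h6
    rw [ev, ← h3, e1] at h7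
    rw [ez, ← h4, e2] at h8
    rw [eη, e3, h5] at h9
    rw [eγ, e4, h6] at h10
    refine ⟨⟨h3.symm, h4.symm, h5, h6⟩, ux + W.y, yx, ⟨?_, h2.symm, ?_, ?_⟩, ?_, ?_⟩
    · rw [add_sub_cancel_right, h1]
    · rw [← h7]
      simp only [map_add, map_smul]
      module
    · have : H1.dx yx = (c • H1.fn (c • W.y + Ψ.y) + H1.fn (c • Ψ.y))
        + (p.b : ℂ) • H1.fn (ux + W.y) := by rw [h8, sub_add_cancel]
      rw [this]
      simp only [map_add, map_smul]
      module
    · simp only [map_add, map_smul, smul_eq_mul] at h9 ⊢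
      linear_combination h9
    · simp only [map_add, map_smul, smul_eq_mul] at h10 ⊢
      linear_combination h10
  · rintro ⟨⟨h3, h4, h5, h6⟩, s, q, ⟨d1, d2, d3, d4⟩, b1, b2⟩
    refine ⟨s - W.y, q, d1.symm, d2.symm, h3.symm, h4.symm, h5, h6, ?_, ?_, ?_, ?_⟩
    · rw [ev, e1, h3, sub_add_cancel, d3]
      simp only [map_add, map_smul]
      module
    · rw [ez, e2, h4, sub_add_cancel, d4]
      simp only [map_add, map_smul]
      module
    · rw [eη, e3, h5]
      simp only [map_add, map_sub, map_smul, smul_eq_mul] at b1 ⊢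
      linear_combination b1
    · rw [eγ, e4, h6]
      simp only [map_add, map_smul, smul_eq_mul] at b2 ⊢
      linear_combination b2

lemma isLift_zero {p : Params} (c : ℂ) : IsLift c 0 0 (0 : Energy p) := by
  obtain ⟨a1, a2, a3, a4, a5, a6⟩ := Energy.zero_eq (p := p)
  constructor <;> simp [*]

lemma mem_eigenspace_op_iff {p : Params} {k₂ k₄ : ℝ} {c : ℂ} {W : Energy p} :
    W ∈ (op p k₂ k₄).eigenspace c ↔ IsLift c 0 0 W ∧
      ∃ s q : H1, PencilSol p.b c 0 0 W.u W.y s q ∧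
        (p.k₁ : ℂ) * H1.ev 1 s + c * (c + k₂) * H1.ev 1 W.u = 0 ∧
        (p.k₃ : ℂ) * H1.ev 1 q + c * (c + k₄) * H1.ev 1 W.y = 0 := by
  have h := opRel_iff_pencil (k₂ := k₂) (k₄ := k₄) (W := W) (isLift_zero (p := p) c)
  obtain ⟨a1, a2, a3, a4, a5, a6⟩ := Energy.zero_eq (p := p)
  rw [add_zero, a1, a3] at h
  simp only [map_zero, mul_zero, add_zero] at h
  rw [← h, (hasBoundedInverse_op p k₂ k₄).mem_eigenspace_iff, opRel_iff, map_smul]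

/-! ### Classical solutions -/

/-- A function in `H¹` whose derivative is continuous is continuously differentiable. -/
lemma H1.exists_fun (w d : H1) (h : H1.dx w = H1.fn d) :
    ∃ f : ℝ → ℂ, Continuous f ∧ (∀ x : I, f x = H1.ev x w) ∧
      ∀ x : I, HasDerivAt f (H1.ev x d) x := by
  have hd : ∀ x, HasDerivAt (fun t => H1.ev 0 w + ∫ s in (0 : ℝ)..t, extend d.1.1 s)
      (extend d.1.1 x) x := fun x =>
    (hasDerivAt_primitive (continuous_extend d.1.1) x).const_add _
  refine ⟨fun t => H1.ev 0 w + ∫ s in (0 : ℝ)..t, extend d.1.1 s,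
    continuous_iff_continuousAt.2 fun x => (hd x).continuousAt, fun x => ?_, fun x => ?_⟩
  · conv_rhs => rw [H1.eq_const_add_primL w, map_add, ev_constH1, ev_primL, h]
    change _ = H1.ev 0 w + prim (toL2 d.1.1) x
    rw [prim_toL2 d.1.1 (fun t => (extend_apply d.1.1 t).symm) x]
  · have := hd x
    rwa [extend_apply] at this

/-- A continuously differentiable function as an element of `H¹`. -/
def mkH1 (f f' : ℝ → ℂ) (hf : ∀ x, HasDerivAt f (f' x) x) (hf' : Continuous f') : H1 :=
  ⟨(⟨fun x : I => f x, (continuous_iff_continuousAt.2 fun x => (hf x).continuousAt).comp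
    continuous_subtype_val⟩, toL2 ⟨fun x : I => f' x, hf'.comp continuous_subtype_val⟩),
    hasWeakDeriv_of_hasDerivAt hf' hf _ _ (fun _ => rfl) fun _ => rfl⟩

lemma H1.fn_eq_of_ev {v w : H1} (h : ∀ x, H1.ev x v = H1.ev x w) : H1.fn v = H1.fn w :=
  congrArg toL2 (ContinuousMap.ext h)

lemma H1.ext_ev {v w : H1} (h : ∀ x, H1.ev x v = H1.ev x w) : v = w := by
  rw [← sub_eq_zero]
  refine H1.eq_zero_of_fn ?_
  rw [map_sub, H1.fn_eq_of_ev h, sub_self]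

/-- The coefficient of the first order system. -/
def systemMap (b c : ℂ) : ℂ × ℂ × ℂ × ℂ →L[ℂ] ℂ × ℂ × ℂ × ℂ where
  toFun X := (X.2.2.1 - X.2.1, X.2.2.2, c ^ 2 * X.1, c ^ 2 * X.2.1 + b * X.2.2.1)
  map_add' X Y := by
    simp only [Prod.fst_add, Prod.snd_add, Prod.mk_add_mk, Prod.mk.injEq]
    refine ⟨?_, trivial, ?_, ?_⟩ <;> ring
  map_smul' a X := by
    simp only [Prod.smul_fst, Prod.smul_snd, Prod.smul_mk, RingHom.id_apply, smul_eq_mul,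
      Prod.mk.injEq]
    refine ⟨?_, trivial, ?_, ?_⟩ <;> ring
  cont := by fun_prop

lemma PencilSol.exists_fun {b c : ℂ} {u y s q : H1} (h : PencilSol b c 0 0 u y s q) :
    ∃ X : ℝ → ℂ × ℂ × ℂ × ℂ, Continuous X ∧
      (∀ x : I, X x = (H1.ev x u, H1.ev x y, H1.ev x s, H1.ev x q)) ∧
      ∀ x : I, HasDerivAt X (systemMap b c (X x)) x := by
  obtain ⟨u', cu, eu, du⟩ := H1.exists_fun u _ h.dx_u
  obtain ⟨y', cy, ey, dy⟩ := H1.exists_fun y _ h.dx_y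
  obtain ⟨s', cs, es, ds⟩ := H1.exists_fun s _ h.dx_s
  obtain ⟨q', cq, eq, dq⟩ := H1.exists_fun q _ h.dx_q
  refine ⟨fun x => (u' x, y' x, s' x, q' x), by fun_prop, fun x => ?_, fun x => ?_⟩
  · change (u' x, y' x, s' x, q' x) = _
    rw [eu, ey, es, eq]
  have := (du x).prodMk ((dy x).prodMk ((ds x).prodMk (dq x)))
  convert this using 1
  simp only [eu, ey, es, eq, map_sub, map_add, map_smul, map_zero, smul_eq_mul, mul_zero, add_zero]
  rfl

/-- Uniqueness in the linear Cauchy problem; it identifies every solution vanishing at `0` with an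
explicit one. -/
lemma PencilSol.eq_zero_of_left {b c : ℂ} {u y s q : H1} (h : PencilSol b c 0 0 u y s q)
    (hu : H1.ev 0 u = 0) (hy : H1.ev 0 y = 0) (hs : H1.ev 0 s = 0) (hq : H1.ev 0 q = 0) :
    u = 0 ∧ y = 0 := by
  obtain ⟨X, hX, heq, hd⟩ := h.exists_fun
  have h0 : X 0 = 0 := by
    have := heq 0
    rw [hu, hy, hs, hq] at this
    exact this
  have key : Set.EqOn X (fun _ => 0) (Set.Icc 0 1) := by
    refine ODE_solution_unique_of_mem_Icc_right (v := fun _ => systemMap b c)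
      (s := fun _ => Set.univ) (K := ‖systemMap b c‖₊)
      (fun t _ => (systemMap b c).lipschitz.lipschitzOnWith) hX.continuousOn
      (fun t ht => (hd ⟨t, ht.1, ht.2.le⟩).hasDerivWithinAt) (fun _ _ => trivial)
      continuousOn_const (fun t _ => ?_) (fun _ _ => trivial) h0
    rw [map_zero]
    exact hasDerivWithinAt_const _ _ _
  have h1 : ∀ x : I, (H1.ev x u, H1.ev x y, H1.ev x s, H1.ev x q) = (0 : ℂ × ℂ × ℂ × ℂ) :=
    fun x => (heq x).symm.trans (key x.2)
  constructor <;> refine H1.ext_ev fun x => ?_ <;> rw [map_zero]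
  · exact congrArg Prod.fst (h1 x)
  · exact congrArg (fun X : ℂ × ℂ × ℂ × ℂ => X.2.1) (h1 x)

/-- Needed at the free end: there the boundary conditions make `s` and `q` vanish as soon as `u` and
`y` do. -/
lemma PencilSol.eq_zero_of_right {b c : ℂ} {u y s q : H1} (h : PencilSol b c 0 0 u y s q)
    (hu : H1.ev 1 u = 0) (hy : H1.ev 1 y = 0) (hs : H1.ev 1 s = 0) (hq : H1.ev 1 q = 0) :
    u = 0 ∧ y = 0 := by
  obtain ⟨X, hX, heq, hd⟩ := h.exists_fun
  have h0 : X 1 = 0 := by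
    have := heq 1
    rw [hu, hy, hs, hq] at this
    exact this
  have key : Set.EqOn X (fun _ => 0) (Set.Icc 0 1) := by
    refine ODE_solution_unique_of_mem_Icc_left (v := fun _ => systemMap b c)
      (s := fun _ => Set.univ) (K := ‖systemMap b c‖₊)
      (fun t _ => (systemMap b c).lipschitz.lipschitzOnWith) hX.continuousOn
      (fun t ht => (hd ⟨t, ht.1.le, ht.2⟩).hasDerivWithinAt) (fun _ _ => trivial)
      continuousOn_const (fun t _ => ?_) (fun _ _ => trivial) h0
    rw [map_zero]
    exact hasDerivWithinAt_const _ _ _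
  have h1 : ∀ x : I, (H1.ev x u, H1.ev x y, H1.ev x s, H1.ev x q) = (0 : ℂ × ℂ × ℂ × ℂ) :=
    fun x => (heq x).symm.trans (key x.2)
  constructor <;> refine H1.ext_ev fun x => ?_ <;> rw [map_zero]
  · exact congrArg Prod.fst (h1 x)
  · exact congrArg (fun X : ℂ × ℂ × ℂ × ℂ => X.2.1) (h1 x)

/-! ### The explicit solutions -/

section Explicit

variable (P Q c₁ c₂ : ℂ)

/-- The displacement of the solutions that vanish at `0`. -/
def solU (x : ℝ) : ℂ :=
  -- The exponents `m` of the system satisfy `(m² - c²)² = -b c²`. Written as `±P ± Q` they amount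
  -- to `c² = P² + Q²` and `4 P² Q² = -b c²`, so products of hyperbolic functions of `P x` and `Q x`
  -- span the solutions.
  c₁ * (P * (Complex.sinh (P * x) * Complex.cosh (Q * x))
    + Q * (Complex.cosh (P * x) * Complex.sinh (Q * x)))
  + c₂ * ((P ^ 2 - Q ^ 2) * (Complex.sinh (P * x) * Complex.sinh (Q * x)))

/-- The rotation angle of the solutions that vanish at `0`. -/
def solY (x : ℝ) : ℂ :=
  -2 * P * Q * (c₁ * (Complex.sinh (P * x) * Complex.sinh (Q * x))
    + c₂ * (P * (Complex.sinh (P * x) * Complex.cosh (Q * x))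
      - Q * (Complex.cosh (P * x) * Complex.sinh (Q * x))))

/-- The strain of the solutions that vanish at `0`. -/
def solS (x : ℝ) : ℂ :=
  (P ^ 2 + Q ^ 2) * (c₁ * (Complex.cosh (P * x) * Complex.cosh (Q * x))
    + c₂ * (P * (Complex.cosh (P * x) * Complex.sinh (Q * x))
      - Q * (Complex.sinh (P * x) * Complex.cosh (Q * x))))

/-- The derivative of the rotation angle of the solutions that vanish at `0`. -/
def solQ (x : ℝ) : ℂ :=
  -2 * P * Q * (c₁ * (P * (Complex.cosh (P * x) * Complex.sinh (Q * x))
      + Q * (Complex.sinh (P * x) * Complex.cosh (Q * x)))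
    + c₂ * ((P ^ 2 - Q ^ 2) * (Complex.cosh (P * x) * Complex.cosh (Q * x))))

lemma hasDerivAt_sinh_mul (x : ℝ) :
    HasDerivAt (fun x : ℝ => Complex.sinh (P * x)) (P * Complex.cosh (P * x)) x := by
  have h := ((hasDerivAt_id (x : ℂ)).const_mul P).csinh.comp_ofReal
  simpa [mul_comm] using h

lemma hasDerivAt_cosh_mul (x : ℝ) :
    HasDerivAt (fun x : ℝ => Complex.cosh (P * x)) (P * Complex.sinh (P * x)) x := by
  have h := ((hasDerivAt_id (x : ℂ)).const_mul P).ccosh.comp_ofReal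
  simpa [mul_comm] using h

variable (x : ℝ)

lemma hasDerivAt_solU : HasDerivAt (solU P Q c₁ c₂) (solS P Q c₁ c₂ x - solY P Q c₁ c₂ x) x := by
  have sP := hasDerivAt_sinh_mul P x
  have cP := hasDerivAt_cosh_mul P x
  have sQ := hasDerivAt_sinh_mul Q x
  have cQ := hasDerivAt_cosh_mul Q x
  have := ((((sP.mul cQ).const_mul P).add ((cP.mul sQ).const_mul Q)).const_mul c₁).add
    (((sP.mul sQ).const_mul (P ^ 2 - Q ^ 2)).const_mul c₂)
  refine this.congr_deriv ?_
  simp only [solS, solY]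
  ring

lemma hasDerivAt_solY : HasDerivAt (solY P Q c₁ c₂) (solQ P Q c₁ c₂ x) x := by
  have sP := hasDerivAt_sinh_mul P x
  have cP := hasDerivAt_cosh_mul P x
  have sQ := hasDerivAt_sinh_mul Q x
  have cQ := hasDerivAt_cosh_mul Q x
  have := (((sP.mul sQ).const_mul c₁).add
    ((((sP.mul cQ).const_mul P).sub ((cP.mul sQ).const_mul Q)).const_mul c₂)).const_mul
      (-2 * P * Q)
  refine this.congr_deriv ?_
  simp only [solQ]
  ring

lemma hasDerivAt_solS : HasDerivAt (solS P Q c₁ c₂) ((P ^ 2 + Q ^ 2) * solU P Q c₁ c₂ x) x := by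
  have sP := hasDerivAt_sinh_mul P x
  have cP := hasDerivAt_cosh_mul P x
  have sQ := hasDerivAt_sinh_mul Q x
  have cQ := hasDerivAt_cosh_mul Q x
  have := (((cP.mul cQ).const_mul c₁).add
    ((((cP.mul sQ).const_mul P).sub ((sP.mul cQ).const_mul Q)).const_mul c₂)).const_mul
      (P ^ 2 + Q ^ 2)
  refine this.congr_deriv ?_
  simp only [solU]
  ring

lemma hasDerivAt_solQ {b : ℂ} (hb : b * (P ^ 2 + Q ^ 2) = -4 * P ^ 2 * Q ^ 2) :
    HasDerivAt (solQ P Q c₁ c₂)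
      ((P ^ 2 + Q ^ 2) * solY P Q c₁ c₂ x + b * solS P Q c₁ c₂ x) x := by
  have sP := hasDerivAt_sinh_mul P x
  have cP := hasDerivAt_cosh_mul P x
  have sQ := hasDerivAt_sinh_mul Q x
  have cQ := hasDerivAt_cosh_mul Q x
  have := (((((cP.mul sQ).const_mul P).add ((sP.mul cQ).const_mul Q)).const_mul c₁).add
    (((cP.mul cQ).const_mul (P ^ 2 - Q ^ 2)).const_mul c₂)).const_mul (-2 * P * Q)
  refine this.congr_deriv ?_
  simp only [solS, solY]
  rw [← mul_assoc b, hb]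
  ring

lemma continuous_solU : Continuous (solU P Q c₁ c₂) :=
  continuous_iff_continuousAt.2 fun x => (hasDerivAt_solU P Q c₁ c₂ x).continuousAt
lemma continuous_solY : Continuous (solY P Q c₁ c₂) :=
  continuous_iff_continuousAt.2 fun x => (hasDerivAt_solY P Q c₁ c₂ x).continuousAt
lemma continuous_solS : Continuous (solS P Q c₁ c₂) :=
  continuous_iff_continuousAt.2 fun x => (hasDerivAt_solS P Q c₁ c₂ x).continuousAt
lemma continuous_solQ : Continuous (solQ P Q c₁ c₂) := by unfold solQ; fun_prop

/-- `solU` as an element of `H¹`. -/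
def solUH : H1 := mkH1 (solU P Q c₁ c₂) _ (hasDerivAt_solU P Q c₁ c₂)
  ((continuous_solS P Q c₁ c₂).sub (continuous_solY P Q c₁ c₂))

/-- `solY` as an element of `H¹`. -/
def solYH : H1 := mkH1 (solY P Q c₁ c₂) _ (hasDerivAt_solY P Q c₁ c₂) (continuous_solQ P Q c₁ c₂)

/-- `solS` as an element of `H¹`. -/
def solSH : H1 := mkH1 (solS P Q c₁ c₂) _ (hasDerivAt_solS P Q c₁ c₂)
  (continuous_const.mul (continuous_solU P Q c₁ c₂))

/-- `solQ` as an element of `H¹`. -/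
def solQH {b : ℂ} (hb : b * (P ^ 2 + Q ^ 2) = -4 * P ^ 2 * Q ^ 2) : H1 :=
  mkH1 (solQ P Q c₁ c₂) _ (fun x => hasDerivAt_solQ P Q c₁ c₂ x hb)
  ((continuous_const.mul (continuous_solY P Q c₁ c₂)).add
    (continuous_const.mul (continuous_solS P Q c₁ c₂)))

lemma solU_zero : solU P Q c₁ c₂ 0 = 0 := by simp [solU]
lemma solY_zero : solY P Q c₁ c₂ 0 = 0 := by simp [solY]
lemma solS_zero : solS P Q c₁ c₂ 0 = (P ^ 2 + Q ^ 2) * c₁ := by simp [solS]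
lemma solQ_zero : solQ P Q c₁ c₂ 0 = -2 * P * Q * (P ^ 2 - Q ^ 2) * c₂ := by simp [solQ]; ring

lemma pencilSol_sol {b c : ℂ} (hc : c ^ 2 = P ^ 2 + Q ^ 2)
    (hb : b * (P ^ 2 + Q ^ 2) = -4 * P ^ 2 * Q ^ 2) :
    PencilSol b c 0 0 (solUH P Q c₁ c₂) (solYH P Q c₁ c₂) (solSH P Q c₁ c₂)
      (solQH P Q c₁ c₂ hb) := by
  refine ⟨congrArg toL2 (ContinuousMap.ext fun x => rfl), congrArg toL2 (ContinuousMap.ext fun x =>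
    rfl), congrArg toL2 (ContinuousMap.ext fun x => ?_), congrArg toL2 (ContinuousMap.ext fun x =>
    ?_)⟩
  · rw [smul_zero, add_zero, hc]; rfl
  · rw [smul_zero, add_zero, hc]; rfl

end Explicit

end Timoshenko
end

noncomputable section

namespace Timoshenko

open InverseOperator

/-! ### The characteristic determinant -/

/-- `P` and `Q` are such that `P + Q`, `P - Q` and their opposites are the four distinct
characteristic exponents of the pencil at `c`. -/
structure IsExponent (b c P Q : ℂ) : Prop where
  ne_zero : c ≠ 0
  sq_eq : c ^ 2 = P ^ 2 + Q ^ 2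
  b_mul : b * (P ^ 2 + Q ^ 2) = -4 * P ^ 2 * Q ^ 2
  mul_ne : -2 * P * Q * (P ^ 2 - Q ^ 2) ≠ 0

lemma PencilSol.sub {b c : ℂ} {u y s q u' y' s' q' : H1} (h : PencilSol b c 0 0 u y s q)
    (h' : PencilSol b c 0 0 u' y' s' q') :
    PencilSol b c 0 0 (u - u') (y - y') (s - s') (q - q') := by
  obtain ⟨a1, a2, a3, a4⟩ := h
  obtain ⟨b1, b2, b3, b4⟩ := h'
  constructor
  · rw [map_sub, a1, b1, ← map_sub]; congr 1; abel
  · rw [map_sub, a2, b2, ← map_sub]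
  · rw [map_sub, a3, b3, ← map_sub]; congr 1; module
  · rw [map_sub, a4, b4, ← map_sub]; congr 1; module

lemma PencilSol.strain_eq_zero {b c : ℂ} {s q : H1} (h : PencilSol b c 0 0 0 0 s q) :
    s = 0 ∧ q = 0 := by
  constructor
  · have := h.dx_u
    rw [map_zero, sub_zero] at this
    exact H1.eq_zero_of_fn this.symm
  · have := h.dx_y
    rw [map_zero] at this
    exact H1.eq_zero_of_fn this.symm

/-- The solutions that vanish at `0` are the explicit ones. -/
lemma PencilSol.exists_eq_sol {b c P Q : ℂ} (hPQ : IsExponent b c P Q) {u y s q : H1}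
    (h : PencilSol b c 0 0 u y s q) (hu : H1.ev 0 u = 0) (hy : H1.ev 0 y = 0) :
    ∃ c₁ c₂, u = solUH P Q c₁ c₂ ∧ y = solYH P Q c₁ c₂ ∧ s = solSH P Q c₁ c₂ ∧
      q = solQH P Q c₁ c₂ hPQ.b_mul := by
  have hc : P ^ 2 + Q ^ 2 ≠ 0 := by
    rw [← hPQ.sq_eq]; exact pow_ne_zero 2 hPQ.ne_zero
  -- The constants match `s(0)` and `q(0)`; the difference then has zero Cauchy data at `0`.
  refine ⟨H1.ev 0 s / (P ^ 2 + Q ^ 2), H1.ev 0 q / (-2 * P * Q * (P ^ 2 - Q ^ 2)), ?_⟩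
  set c₁ := H1.ev 0 s / (P ^ 2 + Q ^ 2)
  set c₂ := H1.ev 0 q / (-2 * P * Q * (P ^ 2 - Q ^ 2))
  have hd := h.sub (pencilSol_sol P Q c₁ c₂ hPQ.sq_eq hPQ.b_mul)
  have e1 : H1.ev 0 (solUH P Q c₁ c₂) = 0 := solU_zero P Q c₁ c₂
  have e2 : H1.ev 0 (solYH P Q c₁ c₂) = 0 := solY_zero P Q c₁ c₂
  have e3 : H1.ev 0 (solSH P Q c₁ c₂) = H1.ev 0 s :=
    (solS_zero P Q c₁ c₂).trans (mul_div_cancel₀ _ hc)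
  have e4 : H1.ev 0 (solQH P Q c₁ c₂ hPQ.b_mul) = H1.ev 0 q :=
    (solQ_zero P Q c₁ c₂).trans (mul_div_cancel₀ _ hPQ.mul_ne)
  obtain ⟨h1, h2⟩ := hd.eq_zero_of_left (by rw [map_sub, hu, e1, sub_zero])
    (by rw [map_sub, hy, e2, sub_zero]) (by rw [map_sub, e3, sub_self])
    (by rw [map_sub, e4, sub_self])
  rw [h1, h2] at hd
  obtain ⟨h3, h4⟩ := hd.strain_eq_zero
  exact ⟨sub_eq_zero.1 h1, sub_eq_zero.1 h2, sub_eq_zero.1 h3, sub_eq_zero.1 h4⟩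

lemma sol_coeff_eq_zero {b c P Q : ℂ} (hPQ : IsExponent b c P Q) {c₁ c₂ : ℂ}
    (hu : solUH P Q c₁ c₂ = 0) (hy : solYH P Q c₁ c₂ = 0) : c₁ = 0 ∧ c₂ = 0 := by
  have h := pencilSol_sol P Q c₁ c₂ hPQ.sq_eq hPQ.b_mul
  rw [hu, hy] at h
  obtain ⟨h3, h4⟩ := h.strain_eq_zero
  have e3 : (P ^ 2 + Q ^ 2) * c₁ = 0 := by
    rw [← solS_zero P Q c₁ c₂]
    change H1.ev 0 (solSH P Q c₁ c₂) = 0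
    rw [h3, map_zero]
  have e4 : -2 * P * Q * (P ^ 2 - Q ^ 2) * c₂ = 0 := by
    rw [← solQ_zero P Q c₁ c₂]
    change H1.ev 0 (solQH P Q c₁ c₂ hPQ.b_mul) = 0
    rw [h4, map_zero]
  refine ⟨(mul_eq_zero.1 e3).resolve_left ?_, (mul_eq_zero.1 e4).resolve_left hPQ.mul_ne⟩
  rw [← hPQ.sq_eq]; exact pow_ne_zero 2 hPQ.ne_zero

/-! ### From displacements to eigenvectors in the energy space -/

section Lift

variable {p : Params} {c : ℂ}

/-- The lift of a pair of displacements that vanish at `0`. -/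
def liftEnergy (p : Params) (c : ℂ) (u y : H1L) : Energy p :=
  (u, H1.fn (c • u.1), y, H1.fn (c • y.1), H1.ev 1 (c • u.1), H1.ev 1 (c • y.1))

lemma isLift_liftEnergy (u y : H1L) : IsLift c 0 0 (liftEnergy p c u y) := by
  constructor <;> rw [add_zero] <;> rfl

lemma IsLift.ext {W W' : Energy p} (h : IsLift c 0 0 W) (h' : IsLift c 0 0 W') (hu : W.u = W'.u)
    (hy : W.y = W'.y) : W = W' := by
  refine Energy.ext_coord ?_ ?_ ?_ ?_ ?_ ?_
  · rw [hu, hy]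
  · rw [h.v_eq, h'.v_eq, hu]
  · rw [hy]
  · rw [h.z_eq, h'.z_eq, hy]
  · rw [h.η_eq, h'.η_eq, hu]
  · rw [h.γ_eq, h'.γ_eq, hy]

lemma IsLift.smul {W : Energy p} (h : IsLift c 0 0 W) (a : ℂ) : IsLift c 0 0 (a • W) := by
  obtain ⟨h1, h2, h3, h4⟩ := h
  constructor
  · rw [Energy.v_smul, h1, Energy.u_smul, ← map_smul]; congr 1; module
  · rw [Energy.z_smul, h2, Energy.y_smul, ← map_smul]; congr 1; module
  · rw [Energy.η_smul, h3, Energy.u_smul, ← map_smul]; congr 1; module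
  · rw [Energy.γ_smul, h4, Energy.y_smul, ← map_smul]; congr 1; module

lemma Energy.ev_zero_u (W : Energy p) : H1.ev 0 W.u = 0 := W.1.2
lemma Energy.ev_zero_y (W : Energy p) : H1.ev 0 W.y = 0 := W.2.2.1.2

/-- The element of the energy space built from an explicit solution. -/
def solEnergy (p : Params) (c P Q c₁ c₂ : ℂ) : Energy p :=
  liftEnergy p c ⟨solUH P Q c₁ c₂, solU_zero P Q c₁ c₂⟩ ⟨solYH P Q c₁ c₂, solY_zero P Q c₁ c₂⟩

end Lift

/-- The residual of the first boundary condition. -/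
def bdU (p : Params) (k₂ : ℝ) (c P Q c₁ c₂ : ℂ) : ℂ :=
  p.k₁ * solS P Q c₁ c₂ 1 + c * (c + k₂) * solU P Q c₁ c₂ 1

/-- The residual of the second boundary condition. -/
def bdY (p : Params) (k₄ : ℝ) (c P Q c₁ c₂ : ℂ) : ℂ :=
  p.k₃ * solQ P Q c₁ c₂ 1 + c * (c + k₄) * solY P Q c₁ c₂ 1

lemma bdU_eq (p : Params) (k₂ : ℝ) (c P Q c₁ c₂ : ℂ) :
    bdU p k₂ c P Q c₁ c₂ = c₁ * bdU p k₂ c P Q 1 0 + c₂ * bdU p k₂ c P Q 0 1 := by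
  simp only [bdU, solS, solU]; ring

lemma bdY_eq (p : Params) (k₄ : ℝ) (c P Q c₁ c₂ : ℂ) :
    bdY p k₄ c P Q c₁ c₂ = c₁ * bdY p k₄ c P Q 1 0 + c₂ * bdY p k₄ c P Q 0 1 := by
  simp only [bdY, solQ, solY]; ring

/-- The determinant of the boundary conditions on the solutions that vanish at `0`. -/
def charDet (p : Params) (k₂ k₄ : ℝ) (c P Q : ℂ) : ℂ :=
  bdU p k₂ c P Q 1 0 * bdY p k₄ c P Q 0 1 - bdU p k₂ c P Q 0 1 * bdY p k₄ c P Q 1 0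

section Eigen

variable {p : Params} {k₂ k₄ : ℝ} {c P Q : ℂ}

lemma solEnergy_mem_eigenspace (hPQ : IsExponent p.b c P Q) {c₁ c₂ : ℂ}
    (h1 : bdU p k₂ c P Q c₁ c₂ = 0) (h2 : bdY p k₄ c P Q c₁ c₂ = 0) :
    solEnergy p c P Q c₁ c₂ ∈ (op p k₂ k₄).eigenspace c :=
  mem_eigenspace_op_iff.2 ⟨isLift_liftEnergy _ _, solSH P Q c₁ c₂, solQH P Q c₁ c₂ hPQ.b_mul,
    pencilSol_sol P Q c₁ c₂ hPQ.sq_eq hPQ.b_mul, h1, h2⟩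

lemma exists_of_mem_eigenspace (hPQ : IsExponent p.b c P Q) {W : Energy p}
    (hW : W ∈ (op p k₂ k₄).eigenspace c) :
    ∃ c₁ c₂, W = solEnergy p c P Q c₁ c₂ ∧ bdU p k₂ c P Q c₁ c₂ = 0 ∧
      bdY p k₄ c P Q c₁ c₂ = 0 := by
  obtain ⟨hl, s, q, hs, b1, b2⟩ := mem_eigenspace_op_iff.1 hW
  obtain ⟨c₁, c₂, hu, hy, rfl, rfl⟩ := hs.exists_eq_sol hPQ W.ev_zero_u W.ev_zero_y
  refine ⟨c₁, c₂, hl.ext (isLift_liftEnergy _ _) hu hy, ?_, ?_⟩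
  · rw [hu] at b1
    exact b1
  · rw [hy] at b2
    exact b2

lemma solEnergy_eq_zero_iff (hPQ : IsExponent p.b c P Q) {c₁ c₂ : ℂ} :
    solEnergy p c P Q c₁ c₂ = 0 ↔ c₁ = 0 ∧ c₂ = 0 := by
  constructor
  · intro h
    exact sol_coeff_eq_zero hPQ (congrArg Energy.u h) (congrArg Energy.y h)
  · rintro ⟨rfl, rfl⟩
    refine (isLift_liftEnergy _ _).ext (isLift_zero c) ?_ ?_
    · refine H1.ext_ev fun x => ?_
      change solU P Q 0 0 x = 0
      simp [solU]
    · refine H1.ext_ev fun x => ?_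
      change solY P Q 0 0 x = 0
      simp [solY]

lemma smul_solEnergy (a c₁ c₂ : ℂ) :
    a • solEnergy p c P Q c₁ c₂ = solEnergy p c P Q (a * c₁) (a * c₂) := by
  refine ((isLift_liftEnergy _ _).smul a).ext (isLift_liftEnergy _ _) ?_ ?_
  · refine H1.ext_ev fun x => ?_
    change a * solU P Q c₁ c₂ x = solU P Q (a * c₁) (a * c₂) x
    simp only [solU]; ring
  · refine H1.ext_ev fun x => ?_
    change a * solY P Q c₁ c₂ x = solY P Q (a * c₁) (a * c₂) x
    simp only [solY]; ring

/-- `c` is an eigenvalue if and only if the characteristic determinant vanishes. -/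
theorem eigenspace_ne_bot_iff (hPQ : IsExponent p.b c P Q) :
    (op p k₂ k₄).eigenspace c ≠ ⊥ ↔ charDet p k₂ k₄ c P Q = 0 := by
  rw [Submodule.ne_bot_iff]
  constructor
  · rintro ⟨W, hW, hW0⟩
    obtain ⟨c₁, c₂, rfl, b1, b2⟩ := exists_of_mem_eigenspace hPQ hW
    rw [Ne, solEnergy_eq_zero_iff hPQ] at hW0
    rw [bdU_eq] at b1
    rw [bdY_eq] at b2
    by_contra hne
    refine hW0 ⟨?_, ?_⟩
    · refine (mul_eq_zero.1 (?_ : charDet p k₂ k₄ c P Q * c₁ = 0)).resolve_left hne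
      unfold charDet
      linear_combination bdY p k₄ c P Q 0 1 * b1 - bdU p k₂ c P Q 0 1 * b2
    · refine (mul_eq_zero.1 (?_ : charDet p k₂ k₄ c P Q * c₂ = 0)).resolve_left hne
      unfold charDet
      linear_combination bdU p k₂ c P Q 1 0 * b2 - bdY p k₄ c P Q 1 0 * b1
  · intro h
    obtain ⟨c₁, c₂, hne, b1, b2⟩ : ∃ c₁ c₂, ¬ (c₁ = 0 ∧ c₂ = 0) ∧ bdU p k₂ c P Q c₁ c₂ = 0 ∧
        bdY p k₄ c P Q c₁ c₂ = 0 := by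
      unfold charDet at h
      by_cases h1 : bdU p k₂ c P Q 1 0 = 0 ∧ bdU p k₂ c P Q 0 1 = 0
      · by_cases h2 : bdY p k₄ c P Q 1 0 = 0 ∧ bdY p k₄ c P Q 0 1 = 0
        · exact ⟨1, 0, by simp, h1.1, h2.1⟩
        -- A nonzero row `(a, b)` of a singular matrix provides the kernel vector `(-b, a)`.
        · refine ⟨-bdY p k₄ c P Q 0 1, bdY p k₄ c P Q 1 0, by rwa [neg_eq_zero, and_comm], ?_, ?_⟩
          · rw [bdU_eq, h1.1, h1.2]; ring
          · rw [bdY_eq]; ring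
      · refine ⟨-bdU p k₂ c P Q 0 1, bdU p k₂ c P Q 1 0, by rwa [neg_eq_zero, and_comm], ?_, ?_⟩
        · rw [bdU_eq]; ring
        · rw [bdY_eq]; linear_combination h
    exact ⟨_, solEnergy_mem_eigenspace hPQ b1 b2, (solEnergy_eq_zero_iff hPQ).not.2 hne⟩

/-- The eigenspace is at most one-dimensional if the boundary conditions do not degenerate. -/
lemma finrank_eigenspace_eq_one (hPQ : IsExponent p.b c P Q) (h0 : charDet p k₂ k₄ c P Q = 0)
    (hM : ¬ (bdU p k₂ c P Q 1 0 = 0 ∧ bdU p k₂ c P Q 0 1 = 0 ∧ bdY p k₄ c P Q 1 0 = 0 ∧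
      bdY p k₄ c P Q 0 1 = 0)) : Module.finrank ℂ ((op p k₂ k₄).eigenspace c) = 1 := by
  obtain ⟨a, b, hab, hker⟩ : ∃ a b : ℂ, ¬ (a = 0 ∧ b = 0) ∧ ∀ c₁ c₂, bdU p k₂ c P Q c₁ c₂ = 0 →
      bdY p k₄ c P Q c₁ c₂ = 0 → c₁ * a + c₂ * b = 0 := by
    by_cases h1 : bdU p k₂ c P Q 1 0 = 0 ∧ bdU p k₂ c P Q 0 1 = 0
    · exact ⟨bdY p k₄ c P Q 1 0, bdY p k₄ c P Q 0 1, fun h2 => hM ⟨h1.1, h1.2, h2⟩,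
        fun c₁ c₂ _ h => by rwa [bdY_eq] at h⟩
    · exact ⟨bdU p k₂ c P Q 1 0, bdU p k₂ c P Q 0 1, h1, fun c₁ c₂ h _ => by rwa [bdU_eq] at h⟩
  have hdir : ∀ c₁ c₂ : ℂ, c₁ * a + c₂ * b = 0 → ∃ t, c₁ = t * -b ∧ c₂ = t * a := by
    intro c₁ c₂ h
    by_cases ha : a = 0
    · have hb : b ≠ 0 := fun hb => hab ⟨ha, hb⟩
      have h2 : c₂ = 0 := by
        rw [ha, mul_zero, zero_add] at h
        exact (mul_eq_zero.1 h).resolve_right hb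
      exact ⟨-c₁ / b, by field_simp, by rw [h2, ha, mul_zero]⟩
    · refine ⟨c₂ / a, ?_, by field_simp⟩
      field_simp
      linear_combination h
  have hbot := (eigenspace_ne_bot_iff (k₂ := k₂) (k₄ := k₄) hPQ).2 h0
  obtain ⟨W, hW, hW0⟩ := (Submodule.ne_bot_iff _).1 hbot
  refine finrank_eq_one (⟨W, hW⟩ : (op p k₂ k₄).eigenspace c) (fun h => hW0 (congrArg Subtype.val h)) ?_
  rintro ⟨V, hV⟩
  obtain ⟨c₁, c₂, rfl, b1, b2⟩ := exists_of_mem_eigenspace hPQ hW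
  obtain ⟨d₁, d₂, rfl, b3, b4⟩ := exists_of_mem_eigenspace hPQ hV
  obtain ⟨t, rfl, rfl⟩ := hdir _ _ (hker _ _ b1 b2)
  obtain ⟨t', rfl, rfl⟩ := hdir _ _ (hker _ _ b3 b4)
  rw [Ne, solEnergy_eq_zero_iff hPQ] at hW0
  have ht : t ≠ 0 := by
    rintro rfl
    exact hW0 ⟨zero_mul _, zero_mul _⟩
  refine ⟨t' / t, Subtype.ext ?_⟩
  change (t' / t) • solEnergy p c P Q (t * -b) (t * a) = _
  rw [smul_solEnergy]
  congr 1 <;> field_simp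

end Eigen

/-! ### Lagrange's identity -/

/-- The bilinear pairing of an explicit solution with a pair of functions in `H¹`. -/
def pairing (b P Q c₁ c₂ : ℂ) (f g : H1) : ℂ :=
  ∫ x in (0 : ℝ)..1, (b * (solU P Q c₁ c₂ x * extend f.1.1 x) + solY P Q c₁ c₂ x * extend g.1.1 x)

lemma pairing_zero (b P Q c₁ c₂ : ℂ) : pairing b P Q c₁ c₂ 0 0 = 0 := by
  have : ∀ x, extend 0 x = 0 := fun x => rfl
  simp [pairing, this]

lemma continuous_pairing (b : ℂ) (f g : H1) :
    Continuous fun X : ℂ × ℂ × ℂ × ℂ => pairing b X.1 X.2.1 X.2.2.1 X.2.2.2 f g := by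
  have hf := continuous_extend f.1.1
  have hg := continuous_extend g.1.1
  unfold pairing
  refine intervalIntegral.continuous_parametric_intervalIntegral_of_continuous' ?_ 0 1
  unfold solU solY Function.uncurry
  fun_prop

/-- The left side is a Wronskian at `1`, which vanishes at `0`. The weight `b` on the displacement
part makes the coupling terms cancel in its derivative. The pairing has no conjugation, which keeps
the dependence on `P` and `Q` holomorphic. -/
lemma lagrange_identity {b c c₀ P Q : ℂ} (hc : c ^ 2 = P ^ 2 + Q ^ 2)
    (hb : b * (P ^ 2 + Q ^ 2) = -4 * P ^ 2 * Q ^ 2) (c₁ c₂ : ℂ) {f g u y s q : H1}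
    (h : PencilSol b c₀ f g u y s q) (hu : H1.ev 0 u = 0) (hy : H1.ev 0 y = 0) :
    b * (solS P Q c₁ c₂ 1 * H1.ev 1 u - solU P Q c₁ c₂ 1 * H1.ev 1 s)
      + (solQ P Q c₁ c₂ 1 * H1.ev 1 y - solY P Q c₁ c₂ 1 * H1.ev 1 q)
      = (c ^ 2 - c₀ ^ 2) * pairing b P Q c₁ c₂ u y - 2 * c₀ * pairing b P Q c₁ c₂ f g := by
  obtain ⟨u', cu, eu, du⟩ := H1.exists_fun u _ h.dx_u
  obtain ⟨y', cy, ey, dy⟩ := H1.exists_fun y _ h.dx_y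
  obtain ⟨s', cs, es, ds⟩ := H1.exists_fun s _ h.dx_s
  obtain ⟨q', cq, eq, dq⟩ := H1.exists_fun q _ h.dx_q
  set G : ℝ → ℂ := fun x => b * (solS P Q c₁ c₂ x * u' x - solU P Q c₁ c₂ x * s' x)
    + (solQ P Q c₁ c₂ x * y' x - solY P Q c₁ c₂ x * q' x) with hG
  set K : ℝ → ℂ := fun x => (c ^ 2 - c₀ ^ 2) *
      (b * (solU P Q c₁ c₂ x * extend u.1.1 x) + solY P Q c₁ c₂ x * extend y.1.1 x)
    - 2 * c₀ * (b * (solU P Q c₁ c₂ x * extend f.1.1 x) + solY P Q c₁ c₂ x * extend g.1.1 x)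
    with hK
  have hU := continuous_solU P Q c₁ c₂
  have hY := continuous_solY P Q c₁ c₂
  have e1 := continuous_extend u.1.1
  have e2 := continuous_extend y.1.1
  have e3 := continuous_extend f.1.1
  have e4 := continuous_extend g.1.1
  have hd : ∀ x ∈ Set.uIcc (0 : ℝ) 1, HasDerivAt G (K x) x := by
    intro x hx
    rw [Set.uIcc_of_le zero_le_one] at hx
    have a1 := (((hasDerivAt_solS P Q c₁ c₂ x).mul (du ⟨x, hx⟩)).sub
      ((hasDerivAt_solU P Q c₁ c₂ x).mul (ds ⟨x, hx⟩))).const_mul b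
    have a2 := ((hasDerivAt_solQ P Q c₁ c₂ x hb).mul (dy ⟨x, hx⟩)).sub
      ((hasDerivAt_solY P Q c₁ c₂ x).mul (dq ⟨x, hx⟩))
    refine (a1.add a2).congr_deriv ?_
    have v1 : u' x = H1.ev ⟨x, hx⟩ u := eu ⟨x, hx⟩
    have v2 : y' x = H1.ev ⟨x, hx⟩ y := ey ⟨x, hx⟩
    have v3 : s' x = H1.ev ⟨x, hx⟩ s := es ⟨x, hx⟩
    have v4 : q' x = H1.ev ⟨x, hx⟩ q := eq ⟨x, hx⟩
    have w1 : extend u.1.1 x = H1.ev ⟨x, hx⟩ u := extend_apply u.1.1 ⟨x, hx⟩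
    have w2 : extend y.1.1 x = H1.ev ⟨x, hx⟩ y := extend_apply y.1.1 ⟨x, hx⟩
    have w3 : extend f.1.1 x = H1.ev ⟨x, hx⟩ f := extend_apply f.1.1 ⟨x, hx⟩
    have w4 : extend g.1.1 x = H1.ev ⟨x, hx⟩ g := extend_apply g.1.1 ⟨x, hx⟩
    simp only [hK, v1, v2, v3, v4, w1, w2, w3, w4, map_sub, map_add, map_smul, smul_eq_mul, hc]
    ring
  have hI := intervalIntegral.integral_eq_sub_of_hasDerivAt hd
    (Continuous.intervalIntegrable (by fun_prop) _ _)
  have i1 : IntervalIntegrable (fun x : ℝ => (c ^ 2 - c₀ ^ 2) *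
      (b * (solU P Q c₁ c₂ x * extend u.1.1 x) + solY P Q c₁ c₂ x * extend y.1.1 x)) volume 0 1 :=
    Continuous.intervalIntegrable (by fun_prop) _ _
  have i2 : IntervalIntegrable (fun x : ℝ => 2 * c₀ *
      (b * (solU P Q c₁ c₂ x * extend f.1.1 x) + solY P Q c₁ c₂ x * extend g.1.1 x)) volume 0 1 :=
    Continuous.intervalIntegrable (by fun_prop) _ _
  rw [hK, intervalIntegral.integral_sub i1 i2, intervalIntegral.integral_const_mul,
    intervalIntegral.integral_const_mul] at hI
  change (c ^ 2 - c₀ ^ 2) * pairing b P Q c₁ c₂ u y - 2 * c₀ * pairing b P Q c₁ c₂ f g = _ at hI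
  rw [hI]
  have u0 : u' 0 = 0 := (eu 0).trans hu
  have y0 : y' 0 = 0 := (ey 0).trans hy
  have u1 : u' 1 = H1.ev 1 u := eu 1
  have y1 : y' 1 = H1.ev 1 y := ey 1
  have s1 : s' 1 = H1.ev 1 s := es 1
  have q1 : q' 1 = H1.ev 1 q := eq 1
  simp only [hG, u0, y0, u1, y1, s1, q1, solU_zero, solY_zero]
  ring

/-! ### Simple zeros of the characteristic determinant -/

section Simple

variable {p : Params} {k₂ k₄ : ℝ} {P Q l : ℂ → ℂ} {w₀ c₀ D' : ℂ}

lemma continuous_solU_coeff :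
    Continuous fun X : ℂ × ℂ × ℂ × ℂ => solU X.1 X.2.1 X.2.2.1 X.2.2.2 1 := by
  unfold solU; fun_prop

lemma continuous_solY_coeff :
    Continuous fun X : ℂ × ℂ × ℂ × ℂ => solY X.1 X.2.1 X.2.2.1 X.2.2.2 1 := by
  unfold solY; fun_prop

lemma continuousAt_comp_coeff {G : ℂ × ℂ × ℂ × ℂ → ℂ} (hG : Continuous G) {c₁ c₂ : ℂ → ℂ}
    (hP : ContinuousAt P w₀) (hQ : ContinuousAt Q w₀) (h₁ : ContinuousAt c₁ w₀)
    (h₂ : ContinuousAt c₂ w₀) : ContinuousAt (fun w => G (P w, Q w, c₁ w, c₂ w)) w₀ :=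
  hG.continuousAt.comp (hP.prodMk (hQ.prodMk (h₁.prodMk h₂)))

/-- An eigenvector `(u, y)` at `c₀` is tested against explicit solutions at `l w` with boundary
residuals `D w * e₁` and `D w * e₂`. Lagrange's identity gives `D w * Z = (l w - c₀) * R w`, where
`Z` is the expression to be shown zero. The associated vector `(u', y')`, tested at `w₀`, gives `R
w₀ = 0`. Division by `w - w₀` in the limit yields `D' * Z = 0`. -/
lemma boundary_pairing_eq_zero (hPQ : ∀ᶠ w in 𝓝 w₀, IsExponent p.b (l w) (P w) (Q w))
    (hl : DifferentiableAt ℂ l w₀) (hl₀ : l w₀ = c₀)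
    (hP : ContinuousAt P w₀) (hQ : ContinuousAt Q w₀) {D : ℂ → ℂ} (h0 : D w₀ = 0)
    (hD : HasDerivAt D D' w₀) (hD' : D' ≠ 0) {c₁ c₂ : ℂ → ℂ} (h₁ : ContinuousAt c₁ w₀)
    (h₂ : ContinuousAt c₂ w₀) {e₁ e₂ : ℂ}
    (hb1 : ∀ w, bdU p k₂ (l w) (P w) (Q w) (c₁ w) (c₂ w) = D w * e₁)
    (hb2 : ∀ w, bdY p k₄ (l w) (P w) (Q w) (c₁ w) (c₂ w) = D w * e₂)
    {u y s q u' y' s' q' : H1} (h : PencilSol p.b c₀ 0 0 u y s q)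
    (h' : PencilSol p.b c₀ u y u' y' s' q') (hu : H1.ev 0 u = 0) (hy : H1.ev 0 y = 0)
    (hu' : H1.ev 0 u' = 0) (hy' : H1.ev 0 y' = 0)
    (b1 : (p.k₁ : ℂ) * H1.ev 1 s + c₀ * (c₀ + k₂) * H1.ev 1 u = 0)
    (b2 : (p.k₃ : ℂ) * H1.ev 1 q + c₀ * (c₀ + k₄) * H1.ev 1 y = 0)
    (b3 : (p.k₁ : ℂ) * H1.ev 1 s' + c₀ * (c₀ + k₂) * H1.ev 1 u' + (2 * c₀ + k₂) * H1.ev 1 u = 0)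
    (b4 : (p.k₃ : ℂ) * H1.ev 1 q' + c₀ * (c₀ + k₄) * H1.ev 1 y' + (2 * c₀ + k₄) * H1.ev 1 y = 0) :
    p.k₃ * p.b * (e₁ * H1.ev 1 u) + p.k₁ * (e₂ * H1.ev 1 y) = 0 := by
  set R : ℂ → ℂ := fun w =>
    p.k₁ * p.k₃ * ((l w + c₀) * pairing p.b (P w) (Q w) (c₁ w) (c₂ w) u y)
    + p.k₃ * (p.b * ((l w + c₀ + k₂) * (solU (P w) (Q w) (c₁ w) (c₂ w) 1 * H1.ev 1 u)))
    + p.k₁ * ((l w + c₀ + k₄) * (solY (P w) (Q w) (c₁ w) (c₂ w) 1 * H1.ev 1 y)) with hR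
  set Z : ℂ := p.k₃ * p.b * (e₁ * H1.ev 1 u) + p.k₁ * (e₂ * H1.ev 1 y) with hZ
  have key : ∀ᶠ w in 𝓝 w₀, D w * Z = (l w - c₀) * R w := by
    filter_upwards [hPQ] with w hc
    have L := lagrange_identity hc.sq_eq hc.b_mul (c₁ w) (c₂ w) h hu hy
    rw [pairing_zero] at L
    have B1 := hb1 w
    have B2 := hb2 w
    simp only [bdU, bdY] at B1 B2
    simp only [hZ, hR]
    linear_combination (p.k₁ * p.k₃ : ℂ) * L - (p.k₃ * p.b * H1.ev 1 u) * B1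
      - (p.k₁ * H1.ev 1 y) * B2
      + (p.k₃ * p.b * solU (P w) (Q w) (c₁ w) (c₂ w) 1) * b1
      + (p.k₁ * solY (P w) (Q w) (c₁ w) (c₂ w) 1) * b2
  have hR0 : R w₀ = 0 := by
    have hc := hPQ.self_of_nhds
    have L := lagrange_identity hc.sq_eq hc.b_mul (c₁ w₀) (c₂ w₀) h' hu' hy'
    have B1 := hb1 w₀
    have B2 := hb2 w₀
    rw [h0, zero_mul] at B1 B2
    simp only [bdU, bdY] at B1 B2
    rw [hl₀] at L B1 B2
    simp only [hR, hl₀]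
    linear_combination (p.k₁ * p.k₃ : ℂ) * L - (p.k₃ * p.b * H1.ev 1 u') * B1
      - (p.k₁ * H1.ev 1 y') * B2
      + (p.k₃ * p.b * solU (P w₀) (Q w₀) (c₁ w₀) (c₂ w₀) 1) * b3
      + (p.k₁ * solY (P w₀) (Q w₀) (c₁ w₀) (c₂ w₀) 1) * b4
  have hRc : ContinuousAt R w₀ := by
    have f1 := continuousAt_comp_coeff (continuous_pairing (p.b : ℂ) u y) hP hQ h₁ h₂
    have f2 := continuousAt_comp_coeff continuous_solU_coeff hP hQ h₁ h₂
    have f3 := continuousAt_comp_coeff continuous_solY_coeff hP hQ h₁ h₂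
    have i0 : ContinuousAt (fun w : ℂ => l w + c₀) w₀ := hl.continuousAt.add continuousAt_const
    exact ((continuousAt_const.mul (i0.mul f1)).add (continuousAt_const.mul
      (continuousAt_const.mul ((i0.add continuousAt_const).mul (f2.mul continuousAt_const))))).add
      (continuousAt_const.mul ((i0.add continuousAt_const).mul (f3.mul continuousAt_const)))
  have t1 : Tendsto (fun w => (w - w₀)⁻¹ * (D w * Z)) (𝓝[≠] w₀) (𝓝 (D' * Z)) := by
    have := (hasDerivAt_iff_tendsto_slope.1 hD).mul_const Z
    refine this.congr fun w => ?_
    rw [slope_def_field, h0]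
    ring
  have t2 : Tendsto (fun w => (w - w₀)⁻¹ * (D w * Z)) (𝓝[≠] w₀) (𝓝 (deriv l w₀ * R w₀)) := by
    refine ((hasDerivAt_iff_tendsto_slope.1 hl.hasDerivAt).mul
      (hRc.mono_left nhdsWithin_le_nhds)).congr' ?_
    filter_upwards [nhdsWithin_le_nhds key] with w hk
    rw [hk, slope_def_field, hl₀]
    ring
  rw [hR0, mul_zero] at t2
  exact (mul_eq_zero.1 (tendsto_nhds_unique t1 t2)).resolve_left hD'

/-- A simple zero of the characteristic determinant, along a holomorphic parametrization of the
exponents, is an algebraically simple eigenvalue. -/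
theorem algMult_of_simple_zero
    (hPQ : ∀ᶠ w in 𝓝 w₀, IsExponent p.b (l w) (P w) (Q w))
    (hl : DifferentiableAt ℂ l w₀) (hP : DifferentiableAt ℂ P w₀) (hQ : DifferentiableAt ℂ Q w₀)
    (h0 : charDet p k₂ k₄ (l w₀) (P w₀) (Q w₀) = 0)
    (hD : HasDerivAt (fun w => charDet p k₂ k₄ (l w) (P w) (Q w)) D' w₀) (hD' : D' ≠ 0) :
    (op p k₂ k₄).HasAlgMult (l w₀) 1 := by
  have hc₀ := hPQ.self_of_nhds
  have d11 : DifferentiableAt ℂ (fun w => bdU p k₂ (l w) (P w) (Q w) 1 0) w₀ := by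
    unfold bdU solS solU; fun_prop
  have d12 : DifferentiableAt ℂ (fun w => bdU p k₂ (l w) (P w) (Q w) 0 1) w₀ := by
    unfold bdU solS solU; fun_prop
  have d21 : DifferentiableAt ℂ (fun w => bdY p k₄ (l w) (P w) (Q w) 1 0) w₀ := by
    unfold bdY solQ solY; fun_prop
  have d22 : DifferentiableAt ℂ (fun w => bdY p k₄ (l w) (P w) (Q w) 0 1) w₀ := by
    unfold bdY solQ solY; fun_prop
  -- If all four entries vanished at `w₀`, the determinant would have a double zero there.
  have hfin : Module.finrank ℂ ((op p k₂ k₄).eigenspace (l w₀)) = 1 := by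
    refine finrank_eigenspace_eq_one hc₀ h0 ?_
    rintro ⟨z1, z2, z3, z4⟩
    refine hD' (hD.unique ?_)
    refine ((d11.hasDerivAt.mul d22.hasDerivAt).sub
      (d12.hasDerivAt.mul d21.hasDerivAt)).congr_deriv ?_
    rw [z1, z2, z3, z4]
    ring
  have hinv := hasBoundedInverse_op p k₂ k₄
  have hker : (op p k₂ k₄).kerPow (l w₀) (1 + 1) = (op p k₂ k₄).kerPow (l w₀) 1 := by
    refine le_antisymm (fun W hW => ?_) (hinv.kerPow_mono (l w₀) one_le_two)
    obtain ⟨hdom, hΨ⟩ := mem_kerPow_succ.1 hW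
    rw [kerPow_one] at hΨ ⊢
    set Ψ := op p k₂ k₄ ⟨W, hdom⟩ - l w₀ • W with hΨdef
    have hrel : OpRel p k₂ k₄ W (l w₀ • W + Ψ) := by
      rw [← mem_graph_op, LinearPMap.mem_graph_iff]
      exact ⟨⟨W, hdom⟩, rfl, (add_sub_cancel _ _).symm⟩
    obtain ⟨hlift, s, q, hs, b1, b2⟩ := mem_eigenspace_op_iff.1 hΨ
    obtain ⟨_, s', q', hs', b3, b4⟩ := (opRel_iff_pencil hlift).1 hrel
    have key := fun (c₁ c₂ : ℂ → ℂ) (h₁ : ContinuousAt c₁ w₀) (h₂ : ContinuousAt c₂ w₀) (e₁ e₂ : ℂ)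
      hb1 hb2 => boundary_pairing_eq_zero (k₂ := k₂) (k₄ := k₄) hPQ hl rfl hP.continuousAt
        hQ.continuousAt h0 hD hD' h₁ h₂ (e₁ := e₁) (e₂ := e₂) hb1 hb2 hs hs' Ψ.ev_zero_u
        Ψ.ev_zero_y W.ev_zero_u W.ev_zero_y b1 b2 b3 b4
    -- The coefficients are the columns of the adjugate of the boundary matrix, so the residuals are
    -- the determinant times the unit vectors. The two choices isolate `u(1)` and `y(1)`.
    have k1 := key _ _ d22.continuousAt d21.neg.continuousAt 1 0
      (fun w => by rw [bdU_eq]; simp only [charDet, Pi.neg_apply]; ring)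
      (fun w => by rw [bdY_eq]; simp only [Pi.neg_apply]; ring)
    have k2 := key _ _ d12.neg.continuousAt d11.continuousAt 0 1
      (fun w => by rw [bdU_eq]; simp only [Pi.neg_apply]; ring)
      (fun w => by rw [bdY_eq]; simp only [charDet, Pi.neg_apply]; ring)
    have pb : (p.b : ℂ) ≠ 0 := Complex.ofReal_ne_zero.2 p.b_pos.ne'
    have pk1 : (p.k₁ : ℂ) ≠ 0 := Complex.ofReal_ne_zero.2 p.k₁_pos.ne'
    have pk3 : (p.k₃ : ℂ) ≠ 0 := Complex.ofReal_ne_zero.2 p.k₃_pos.ne'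
    have u1 : H1.ev 1 Ψ.u = 0 := by simpa [pb, pk1, pk3] using k1
    have y1 : H1.ev 1 Ψ.y = 0 := by simpa [pb, pk1, pk3] using k2
    rw [u1, mul_zero, add_zero] at b1
    rw [y1, mul_zero, add_zero] at b2
    -- All Cauchy data of `Ψ` at `1` vanish, so `Ψ = 0` and the chain stops at length one.
    obtain ⟨hu, hy⟩ := hs.eq_zero_of_right u1 y1 ((mul_eq_zero.1 b1).resolve_left pk1)
      ((mul_eq_zero.1 b2).resolve_left pk3)
    have hΨ0 : Ψ = 0 := hlift.ext (isLift_zero (l w₀)) hu hy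
    exact mem_eigenspace_iff'.2 ⟨hdom, sub_eq_zero.1 hΨ0⟩
  have hroot := hinv.rootSpace_eq_of_kerPow_eq hker
  rw [LinearPMap.HasAlgMult, hroot, kerPow_one]
  exact ⟨Module.finite_of_finrank_eq_succ hfin, hfin⟩

end Simple

end Timoshenko
end

noncomputable section

/-! ### Zeros of perturbations of `sinh²` -/

namespace PerturbedSinh

open Complex Metric

/-- A holomorphic function without zeros on a disk has a holomorphic square root. -/
lemma exists_sqrt_on_ball {f : ℂ → ℂ} {z₀ : ℂ} {r : ℝ} (hr : 0 < r)
    (hf : DifferentiableOn ℂ f (ball z₀ r)) (h0 : ∀ z ∈ ball z₀ r, f z ≠ 0) :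
    ∃ s : ℂ → ℂ, DifferentiableOn ℂ s (ball z₀ r) ∧ ∀ z ∈ ball z₀ r, s z ^ 2 = f z := by
  have hf' : DifferentiableOn ℂ (fun z => deriv f z / f z) (ball z₀ r) :=
    (hf.deriv isOpen_ball).div hf h0
  -- A primitive of the logarithmic derivative: `f exp(-F)` is constant, and `exp(F/2)` gives the
  -- root.
  obtain ⟨F, hF⟩ := hf'.isExactOn_ball
  obtain ⟨s₀, hs₀⟩ := IsAlgClosed.exists_pow_nat_eq (f z₀) two_pos
  have hz₀ : z₀ ∈ ball z₀ r := mem_ball_self hr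
  have hd : ∀ z ∈ ball z₀ r, HasDerivAt (fun z => f z * exp (-F z)) 0 z := by
    intro z hz
    have h1 := ((hf.differentiableAt (isOpen_ball.mem_nhds hz)).hasDerivAt.mul (hF z hz).neg.cexp)
    refine h1.congr_deriv ?_
    have := h0 z hz
    simp only [Pi.neg_apply]
    field_simp
    ring
  have hconst : ∀ z ∈ ball z₀ r, f z * exp (-F z) = f z₀ * exp (-F z₀) := fun z hz =>
    isOpen_ball.is_const_of_deriv_eq_zero (convex_ball z₀ r).isPreconnected
      (fun z hz => (hd z hz).differentiableAt.differentiableWithinAt)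
      (fun z hz => (hd z hz).deriv) hz hz₀
  refine ⟨fun z => s₀ * exp ((F z - F z₀) / 2), fun z hz => ?_, fun z hz => ?_⟩
  · exact ((((hF z hz).differentiableAt.sub_const _).div_const 2).cexp.const_mul
      s₀).differentiableWithinAt
  · have h1 := hconst z hz
    rw [mul_pow, hs₀, ← exp_nat_mul]
    calc f z₀ * exp ((2 : ℕ) * ((F z - F z₀) / 2)) = (f z₀ * exp (-F z₀)) * exp (F z) := by
          rw [mul_assoc, ← exp_add]; congr 2; push_cast; ring
      _ = f z * (exp (-F z) * exp (F z)) := by rw [← h1, mul_assoc]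
      _ = f z := by rw [← exp_add, neg_add_cancel, exp_zero, mul_one]

lemma norm_deriv_le_of_ball {f : ℂ → ℂ} {z₀ : ℂ} {δ : ℝ} (hf : DifferentiableOn ℂ f (ball z₀ 1))
    (hδ : ∀ z ∈ ball z₀ 1, ‖f z‖ ≤ δ) {z : ℂ} (hz : z ∈ closedBall z₀ (1 / 2)) :
    ‖deriv f z‖ ≤ 4 * δ := by
  have hsub : closedBall z (1 / 4) ⊆ ball z₀ 1 := fun w hw => by
    rw [mem_closedBall] at hz hw
    rw [mem_ball]
    linarith [dist_triangle w z z₀]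
  have := norm_deriv_le_of_forall_mem_sphere_norm_le (c := z) (R := 1 / 4) (by norm_num)
    ((hf.mono hsub).diffContOnCl_ball subset_rfl)
    (fun w hw => hδ w (hsub (sphere_subset_closedBall hw)))
  linarith

/-- A small holomorphic perturbation of a constant has exactly one fixed point. -/
lemma exists_fixed_point {f : ℂ → ℂ} {z₀ : ℂ} {δ : ℝ} (hf : DifferentiableOn ℂ f (ball z₀ 1))
    (hδ : ∀ z ∈ ball z₀ 1, ‖f z‖ ≤ δ) (hδ' : δ ≤ 1 / 8) :
    ∃ z ∈ closedBall z₀ (1 / 2), z = z₀ + f z ∧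
      ∀ w ∈ closedBall z₀ (1 / 2), w = z₀ + f w → w = z := by
  have hsub : closedBall z₀ (1 / 2 : ℝ) ⊆ ball z₀ 1 := closedBall_subset_ball (by norm_num)
  -- Cauchy's estimate bounds `f'` by `4δ ≤ 1/2`, which makes `z ↦ z₀ + f z` a contraction of this
  -- ball.
  have hlip : ∀ z ∈ closedBall z₀ (1 / 2 : ℝ), ∀ w ∈ closedBall z₀ (1 / 2 : ℝ),
      ‖f z - f w‖ ≤ 1 / 2 * ‖z - w‖ := fun z hz w hw =>
    (convex_closedBall z₀ (1 / 2)).norm_image_sub_le_of_norm_deriv_le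
      (fun x hx => hf.differentiableAt (isOpen_ball.mem_nhds (hsub hx)))
      (fun x hx => (norm_deriv_le_of_ball hf hδ hx).trans (by linarith)) hw hz
  have hmaps : Set.MapsTo (fun z => z₀ + f z) (closedBall z₀ (1 / 2)) (closedBall z₀ (1 / 2)) := by
    intro z hz
    rw [mem_closedBall, dist_eq_norm, add_sub_cancel_left]
    exact (hδ z (hsub hz)).trans (by linarith)
  have hcontr : ContractingWith (1 / 2) (hmaps.restrict _ _ _) := by
    refine ⟨by norm_num [← NNReal.coe_lt_coe], LipschitzWith.of_dist_le_mul fun z w => ?_⟩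
    rw [Subtype.dist_eq, Subtype.dist_eq, dist_eq_norm, dist_eq_norm]
    change ‖z₀ + f z - (z₀ + f w)‖ ≤ _
    rw [add_sub_add_left_eq_sub]
    simpa using hlip z z.2 w w.2
  obtain ⟨z, hz, hfix, -⟩ := hcontr.exists_fixedPoint' isClosed_closedBall.isComplete hmaps
    (mem_closedBall_self (by norm_num)) (edist_ne_top _ _)
  refine ⟨z, hz, hfix.symm, fun w hw hwf => ?_⟩
  have h1 := hlip w hw z hz
  have hzf : z = z₀ + f z := hfix.symm
  have h2 : f w - f z = w - z := by linear_combination hzf - hwf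
  rw [h2] at h1
  have h3 := norm_nonneg (w - z)
  exact sub_eq_zero.1 (norm_eq_zero.1 (by linarith))

/-- The zeros `i k π` of `sinh`. -/
def center (k : ℤ) : ℂ := Complex.I * k * Real.pi

/-- The inverse hyperbolic tangent. -/
def halfLog (T : ℂ) : ℂ := (log (1 + T) - log (1 - T)) / 2

lemma norm_halfLog_le {T : ℂ} (hT : ‖T‖ ≤ 1 / 2) : ‖halfLog T‖ ≤ 3 / 2 * ‖T‖ := by
  have h1 := norm_log_one_add_half_le_self hT
  have h2 := norm_log_one_add_half_le_self (z := -T) (by rwa [norm_neg])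
  rw [← sub_eq_add_neg, norm_neg] at h2
  have h3 := norm_sub_le (log (1 + T)) (log (1 - T))
  rw [halfLog, norm_div, Complex.norm_ofNat]
  linarith

lemma differentiableAt_halfLog {T : ℂ} (hT : ‖T‖ < 1) : DifferentiableAt ℂ halfLog T := by
  have h1 : 1 + T ∈ slitPlane := mem_slitPlane_of_norm_lt_one hT
  have h2 : 1 - T ∈ slitPlane := by
    rw [sub_eq_add_neg]; exact mem_slitPlane_of_norm_lt_one (by rwa [norm_neg])
  unfold halfLog
  exact (((differentiableAt_id.const_add 1).clog h1).sub
    ((differentiableAt_id.const_sub 1).clog h2)).div_const 2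

/-- The equation reads `exp (2P) = (1 + T) / (1 - T)`, and `2 halfLog T` is one logarithm of the
right side; the period `2πi` becomes `πi` for `P`. -/
lemma sinh_eq_mul_cosh_iff {P T : ℂ} (hT : ‖T‖ < 1) :
    sinh P = T * cosh P ↔ ∃ k : ℤ, P = center k + halfLog T := by
  have n1 : 1 + T ≠ 0 := slitPlane_ne_zero (mem_slitPlane_of_norm_lt_one hT)
  have n2 : 1 - T ≠ 0 := by
    rw [sub_eq_add_neg]
    exact slitPlane_ne_zero (mem_slitPlane_of_norm_lt_one (by rwa [norm_neg]))
  have e1 : exp (2 * halfLog T) = (1 + T) / (1 - T) := by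
    rw [halfLog, mul_div_cancel₀ _ two_ne_zero, exp_sub, exp_log n1, exp_log n2]
  have e2 : sinh P = T * cosh P ↔ exp (2 * P) = (1 + T) / (1 - T) := by
    have e3 : exp (2 * P) = exp P * exp P := by rw [← exp_add, two_mul]
    have e4 : exp P * exp (-P) = 1 := by rw [← exp_add, add_neg_cancel, exp_zero]
    rw [sinh, cosh, eq_div_iff n2, e3]
    constructor
    · intro h
      linear_combination 2 * exp P * h + (1 + T) * e4
    · intro h
      linear_combination (1 / 2) * exp (-P) * h - (1 / 2) * (exp P * (1 - T)) * e4
  rw [e2, ← e1, exp_eq_exp_iff_exists_int]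
  refine exists_congr fun k => ⟨fun h => ?_, fun h => ?_⟩
  · rw [center]; linear_combination h / 2
  · rw [center] at h; linear_combination 2 * h

/-- The perturbation of `sinh² P` by a quadratic form in `sinh P` and `P⁻¹ cosh P`. -/
def sinhQuad (A B C : ℂ → ℂ) (P : ℂ) : ℂ :=
  A P⁻¹ * sinh P ^ 2 + P⁻¹ * B P⁻¹ * (sinh P * cosh P) + P⁻¹ ^ 2 * C P⁻¹ * cosh P ^ 2

/-- The coefficients are holomorphic on a disk about `0`, the leading one does not vanish, the
discriminant vanishes at most at `0`, and the roots are bounded. -/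
structure Admissible (A B C : ℂ → ℂ) (r L : ℝ) : Prop where
  r_pos : 0 < r
  L_pos : 0 < L
  diff_A : DifferentiableOn ℂ A (ball 0 r)
  diff_B : DifferentiableOn ℂ B (ball 0 r)
  diff_C : DifferentiableOn ℂ C (ball 0 r)
  A_ne : ∀ h ∈ ball (0 : ℂ) r, A h ≠ 0
  disc_ne : ∀ h ∈ ball (0 : ℂ) r, h ≠ 0 → B h ^ 2 - 4 * A h * C h ≠ 0
  bound : ∀ h ∈ ball (0 : ℂ) r, ∀ x, A h * x ^ 2 + B h * x + C h = 0 → ‖x‖ ≤ L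

/-- By continuity `|A| > a = |A(0)|/2` and `|B| + |C| < M` on a smaller disk. A root with `|x| > 1`
satisfies `a |x|² ≤ M |x|`, whence `L = 1 + M/a`. -/
lemma exists_admissible {A B C : ℂ → ℂ} {r : ℝ} (hr : 0 < r) (hA : DifferentiableOn ℂ A (ball 0 r))
    (hB : DifferentiableOn ℂ B (ball 0 r)) (hC : DifferentiableOn ℂ C (ball 0 r)) (hA0 : A 0 ≠ 0)
    (hdisc : ∀ᶠ h in 𝓝[≠] (0 : ℂ), B h ^ 2 - 4 * A h * C h ≠ 0) :
    ∃ r' L, Admissible A B C r' L := by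
  have hn : ball (0 : ℂ) r ∈ 𝓝 0 := ball_mem_nhds 0 hr
  have cA := (hA.differentiableAt hn).continuousAt
  have cB := (hB.differentiableAt hn).continuousAt
  have cC := (hC.differentiableAt hn).continuousAt
  set a := ‖A 0‖ / 2 with ha
  have ha0 : 0 < a := half_pos (norm_pos_iff.2 hA0)
  set M := ‖B 0‖ + ‖C 0‖ + 1 with hM
  have eA : ∀ᶠ h in 𝓝 (0 : ℂ), a < ‖A h‖ :=
    cA.norm.eventually (lt_mem_nhds (half_lt_self (norm_pos_iff.2 hA0)))
  have eM : ∀ᶠ h in 𝓝 (0 : ℂ), ‖B h‖ + ‖C h‖ < M :=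
    (cB.norm.add cC.norm).eventually (gt_mem_nhds (lt_add_one _))
  rw [eventually_nhdsWithin_iff] at hdisc
  obtain ⟨r', hr', H⟩ := Metric.eventually_nhds_iff_ball.1 (eA.and (eM.and (hdisc.and hn)))
  have hsub : ball (0 : ℂ) r' ⊆ ball 0 r := fun h hh => (H h hh).2.2.2
  refine ⟨r', 1 + M / a, hr', by positivity, hA.mono hsub, hB.mono hsub, hC.mono hsub,
    fun h hh => norm_pos_iff.1 (ha0.trans (H h hh).1), fun h hh h0 => (H h hh).2.2.1 h0, ?_⟩
  intro h hh x hx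
  obtain ⟨h1, h2, -⟩ := H h hh
  have hMa : 0 ≤ M / a := by positivity
  rcases le_or_gt ‖x‖ 1 with hx1 | hx1
  · linarith
  have hx2 : A h * x ^ 2 = -(B h * x + C h) := by linear_combination hx
  have h3 : ‖A h‖ * ‖x‖ ^ 2 ≤ ‖B h‖ * ‖x‖ + ‖C h‖ := by
    rw [← norm_pow, ← norm_mul, hx2, norm_neg, ← norm_mul]
    exact norm_add_le _ _
  have h4 : a * ‖x‖ ^ 2 ≤ M * ‖x‖ := by
    calc a * ‖x‖ ^ 2 ≤ ‖A h‖ * ‖x‖ ^ 2 := by gcongr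
      _ ≤ ‖B h‖ * ‖x‖ + ‖C h‖ := h3
      _ ≤ ‖B h‖ * ‖x‖ + ‖C h‖ * ‖x‖ := by
          have := mul_le_mul_of_nonneg_left hx1.le (norm_nonneg (C h)); linarith
      _ = (‖B h‖ + ‖C h‖) * ‖x‖ := by ring
      _ ≤ M * ‖x‖ := by gcongr
  have h5 : a * ‖x‖ ≤ M := by
    refine le_of_mul_le_mul_right ?_ (zero_lt_one.trans hx1)
    linarith [h4, sq ‖x‖, mul_assoc a ‖x‖ ‖x‖]
  have h6 : ‖x‖ ≤ M / a := by rw [le_div_iff₀ ha0]; linarith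
  linarith

/-! ### Zeros near a single point `ikπ` -/

section Local

variable {A B C : ℂ → ℂ} {r L : ℝ} {k : ℤ}

lemma two_mul_abs_le_norm (hk : 1 ≤ |k|) {P : ℂ} (hP : P ∈ ball (center k) 1) :
    2 * (|k| : ℝ) ≤ ‖P‖ := by
  rw [mem_ball, dist_eq_norm] at hP
  have h1 : ‖center k‖ = |(k : ℝ)| * Real.pi := by
    rw [center, norm_mul, norm_mul, norm_I, one_mul, Complex.norm_intCast, Complex.norm_real,
      Real.norm_of_nonneg Real.pi_pos.le]
  have h2 : ‖center k‖ ≤ ‖P - center k‖ + ‖P‖ := by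
    have := norm_sub_le P (P - center k)
    rw [sub_sub_cancel] at this
    linarith
  have h3 : (1 : ℝ) ≤ |(k : ℝ)| := by exact_mod_cast hk
  have h4 := Real.pi_gt_three
  have : |(k : ℝ)| * 3 ≤ |(k : ℝ)| * Real.pi := by gcongr
  linarith

lemma norm_inv_le (hk : 1 ≤ |k|) {P : ℂ} (hP : P ∈ ball (center k) 1) :
    ‖P⁻¹‖ ≤ 1 / (2 * |k|) := by
  have h1 := two_mul_abs_le_norm hk hP
  have h3 : (1 : ℝ) ≤ |(k : ℝ)| := by exact_mod_cast hk
  rw [norm_inv, inv_eq_one_div]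
  push_cast
  gcongr

lemma quadratic_root {a b c s : ℂ} (ha : a ≠ 0) (hs : s ^ 2 = b ^ 2 - 4 * a * c) :
    a * ((-b + s) / (2 * a)) ^ 2 + b * ((-b + s) / (2 * a)) + c = 0 := by
  field_simp
  linear_combination hs

lemma quadratic_factor {a b c s h T : ℂ} (ha : a ≠ 0) (hs : s ^ 2 = b ^ 2 - 4 * a * c) :
    a * T ^ 2 + h * b * T + h ^ 2 * c
      = a * (T - h * ((-b + s) / (2 * a))) * (T - h * ((-b - s) / (2 * a))) := by
  field_simp
  linear_combination h ^ 2 * hs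

/-- Factorization of the quadratic form near `i k π`. -/
lemma exists_factors (h : Admissible A B C r L) (hk : 1 ≤ |k|) (hk' : 1 / (2 * |k|) < r) :
    ∃ T₁ T₂ : ℂ → ℂ, DifferentiableOn ℂ T₁ (ball (center k) 1) ∧
      DifferentiableOn ℂ T₂ (ball (center k) 1) ∧
      ∀ P ∈ ball (center k) 1, T₁ P ≠ T₂ P ∧ ‖T₁ P‖ ≤ L / (2 * |k|) ∧
        ‖T₂ P‖ ≤ L / (2 * |k|) ∧ A P⁻¹ ≠ 0 ∧ DifferentiableAt ℂ (fun P => A P⁻¹) P ∧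
        ∀ T, A P⁻¹ * T ^ 2 + P⁻¹ * B P⁻¹ * T + P⁻¹ ^ 2 * C P⁻¹
          = A P⁻¹ * (T - T₁ P) * (T - T₂ P) := by
  set U := ball (center k) 1 with hU
  have hk3 : (1 : ℝ) ≤ |(k : ℝ)| := by exact_mod_cast hk
  have hP0 : ∀ P ∈ U, P ≠ 0 := fun P hP => by
    have := two_mul_abs_le_norm hk hP
    exact norm_pos_iff.1 (by linarith)
  have hmem : Set.MapsTo (fun P : ℂ => P⁻¹) U (ball 0 r) := fun P hP => by
    rw [mem_ball_zero_iff]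
    exact (norm_inv_le hk hP).trans_lt hk'
  have dinv : DifferentiableOn ℂ (fun P : ℂ => P⁻¹) U := fun P hP =>
    (differentiableAt_inv (hP0 P hP)).differentiableWithinAt
  have dA : DifferentiableOn ℂ (fun P => A P⁻¹) U := h.diff_A.comp dinv hmem
  have dB : DifferentiableOn ℂ (fun P => B P⁻¹) U := h.diff_B.comp dinv hmem
  have dC : DifferentiableOn ℂ (fun P => C P⁻¹) U := h.diff_C.comp dinv hmem
  -- The disk about `ikπ` omits `P = ∞`, that is `1/P = 0`, the only place where the discriminant
  -- may vanish. The `Tⱼ` are `P⁻¹` times the roots of `A x² + B x + C`.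
  obtain ⟨s, ds, hs⟩ := exists_sqrt_on_ball (z₀ := center k) one_pos
    ((dB.pow 2).sub ((dA.const_mul 4).mul dC))
    (fun P hP => h.disc_ne P⁻¹ (hmem hP) (inv_ne_zero (hP0 P hP)))
  have hs' : ∀ P ∈ U, s P ^ 2 = B P⁻¹ ^ 2 - 4 * A P⁻¹ * C P⁻¹ := hs
  have hA : ∀ P ∈ U, A P⁻¹ ≠ 0 := fun P hP => h.A_ne _ (hmem hP)
  have h2A : ∀ P ∈ U, 2 * A P⁻¹ ≠ 0 := fun P hP => mul_ne_zero two_ne_zero (hA P hP)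
  have hbd : ∀ P ∈ U, ∀ x, A P⁻¹ * x ^ 2 + B P⁻¹ * x + C P⁻¹ = 0 →
      ‖P⁻¹ * x‖ ≤ L / (2 * |k|) := fun P hP x hx => by
    rw [norm_mul]
    calc ‖P⁻¹‖ * ‖x‖ ≤ 1 / (2 * |k|) * L :=
          mul_le_mul (norm_inv_le hk hP) (h.bound _ (hmem hP) x hx) (norm_nonneg _) (by positivity)
      _ = L / (2 * |k|) := by ring
  refine ⟨fun P => P⁻¹ * ((-B P⁻¹ + s P) / (2 * A P⁻¹)),
    fun P => P⁻¹ * ((-B P⁻¹ - s P) / (2 * A P⁻¹)),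
    dinv.mul ((dB.neg.add ds).div (dA.const_mul 2) h2A),
    dinv.mul ((dB.neg.sub ds).div (dA.const_mul 2) h2A), fun P hP => ⟨?_, ?_, ?_, hA P hP,
      dA.differentiableAt (isOpen_ball.mem_nhds hP), fun T => ?_⟩⟩
  · intro heq
    have h1 := mul_left_cancel₀ (inv_ne_zero (hP0 P hP)) heq
    rw [div_left_inj' (h2A P hP)] at h1
    have h2 : s P = 0 := by linear_combination h1 / 2
    refine h.disc_ne P⁻¹ (hmem hP) (inv_ne_zero (hP0 P hP)) ?_
    rw [← hs' P hP, h2]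
    ring
  · refine hbd P hP _ ?_
    exact quadratic_root (hA P hP) (hs' P hP)
  · refine hbd P hP _ ?_
    rw [sub_eq_add_neg (-B P⁻¹)]
    exact quadratic_root (hA P hP) (by rw [neg_sq]; exact hs' P hP)
  · exact quadratic_factor (hA P hP) (hs' P hP)

/-- The form factors as `A (sinh - T₁ cosh) (sinh - T₂ cosh)`, and near `ikπ` the first factor
vanishes at the fixed point of `P = ikπ + halfLog (T₁ P)`. There its derivative is `(1 - T₁' - T₁²)
cosh`, nonzero because `|T₁'| ≤ 4δ ≤ 1/4`, while the other factors give `A (T₁ - T₂) cosh ≠ 0`. -/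
lemma exists_simple_zero {z₀ : ℂ} {δ : ℝ} (hδ' : δ ≤ 1 / 16)
    {T₁ T₂ : ℂ → ℂ} (hk : z₀ = center k) (d₁ : DifferentiableOn ℂ T₁ (ball z₀ 1))
    (d₂ : DifferentiableOn ℂ T₂ (ball z₀ 1))
    (hT : ∀ P ∈ ball z₀ 1, T₁ P ≠ T₂ P ∧ ‖T₁ P‖ ≤ δ ∧ ‖T₂ P‖ ≤ δ ∧ A P⁻¹ ≠ 0 ∧
      DifferentiableAt ℂ (fun P => A P⁻¹) P ∧ ∀ T, A P⁻¹ * T ^ 2 + P⁻¹ * B P⁻¹ * T + P⁻¹ ^ 2 * C P⁻¹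
          = A P⁻¹ * (T - T₁ P) * (T - T₂ P)) :
    ∃ z ∈ closedBall z₀ (1 / 2), ‖z - z₀‖ ≤ 3 / 2 * δ ∧ sinhQuad A B C z = 0 ∧
      (∃ d ≠ 0, HasDerivAt (sinhQuad A B C) d z) ∧ sinh z = T₁ z * cosh z ∧ cosh z ≠ 0 ∧
      ∀ P ∈ closedBall z₀ (1 / 2), P = z₀ + halfLog (T₁ P) → P = z := by
  have hsub : closedBall z₀ (1 / 2 : ℝ) ⊆ ball z₀ 1 := closedBall_subset_ball (by norm_num)
  obtain ⟨z, hz, hfix, huniq⟩ := exists_fixed_point (f := fun P => halfLog (T₁ P)) (z₀ := z₀)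
    (δ := 3 / 2 * δ) (fun P hP => (differentiableAt_halfLog
      ((hT P hP).2.1.trans_lt (by linarith))).comp_differentiableWithinAt P (d₁ P hP))
    (fun P hP => (norm_halfLog_le ((hT P hP).2.1.trans (by linarith))).trans
      (by linarith [(hT P hP).2.1])) (by linarith)
  have hzb := hsub hz
  obtain ⟨hne, hδ1, hδ2, hA, dA, -⟩ := hT z hzb
  have hsinh : sinh z = T₁ z * cosh z :=
    (sinh_eq_mul_cosh_iff (hδ1.trans_lt (by linarith))).2 ⟨k, by rw [← hk]; exact hfix⟩
  have hcosh : cosh z ≠ 0 := by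
    intro h0
    have := cosh_sq_sub_sinh_sq z
    rw [hsinh, h0] at this
    norm_num at this
  have hfac : ∀ P ∈ ball z₀ 1, sinhQuad A B C P
      = (sinh P - T₁ P * cosh P) * (A P⁻¹ * (sinh P - T₂ P * cosh P)) := by
    intro P hP
    have e : T₁ P + T₂ P = -(P⁻¹ * B P⁻¹) / A P⁻¹ ∧ T₁ P * T₂ P = P⁻¹ ^ 2 * C P⁻¹ / A P⁻¹ := by
      obtain ⟨-, -, -, hA', -, hq⟩ := hT P hP
      have q0 := hq 0
      have q1 := hq 1
      rw [eq_div_iff hA', eq_div_iff hA']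
      constructor
      · linear_combination q1 - q0
      · linear_combination -q0
    obtain ⟨e1, e2⟩ := e
    rw [eq_div_iff (hT P hP).2.2.2.1] at e1 e2
    rw [sinhQuad]
    linear_combination (sinh P * cosh P) * e1 - cosh P ^ 2 * e2
  refine ⟨z, hz, ?_, ?_, ?_, hsinh, hcosh, huniq⟩
  · have : z - z₀ = halfLog (T₁ z) := by linear_combination hfix
    rw [this]
    exact (norm_halfLog_le (hδ1.trans (by linarith))).trans (by linarith)
  · rw [hfac z hzb, hsinh, sub_self, zero_mul]
  · have hnb : ball z₀ 1 ∈ 𝓝 z := isOpen_ball.mem_nhds hzb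
    have D1 := (d₁.differentiableAt hnb).hasDerivAt
    have D2 := (d₂.differentiableAt hnb)
    have F1 := (hasDerivAt_sinh z).sub (D1.mul (hasDerivAt_cosh z))
    have F2 := (dA.mul (differentiableAt_sinh.sub (D2.mul differentiableAt_cosh))).hasDerivAt
    have F := (F1.mul F2).congr_of_eventuallyEq
      (f₁ := sinhQuad A B C) (by filter_upwards [hnb] with P hP using hfac P hP)
    refine ⟨_, ?_, F⟩
    simp only [Pi.sub_apply, Pi.mul_apply]
    rw [hsinh, sub_self, zero_mul, add_zero]
    have hder := norm_deriv_le_of_ball d₁ (fun P hP => (hT P hP).2.1) hz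
    refine mul_ne_zero ?_ (mul_ne_zero hA ?_)
    · have h1 : cosh z - (deriv T₁ z * cosh z + T₁ z * (T₁ z * cosh z))
          = (1 - (deriv T₁ z + T₁ z ^ 2)) * cosh z := by ring
      rw [h1]
      refine mul_ne_zero (fun h0 => ?_) hcosh
      have h2 : deriv T₁ z + T₁ z ^ 2 = 1 := by linear_combination -h0
      have h3 := norm_add_le (deriv T₁ z) (T₁ z ^ 2)
      rw [h2, norm_one, norm_pow] at h3
      have h4 : ‖T₁ z‖ ^ 2 ≤ (1 / 16) ^ 2 := by
        gcongr
        exact hδ1.trans hδ'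
      linarith
    · have h1 : T₁ z * cosh z - T₂ z * cosh z = (T₁ z - T₂ z) * cosh z := by ring
      rw [h1]
      exact mul_ne_zero (sub_ne_zero.2 hne) hcosh

/-- The two zeros near `i k π`. -/
lemma exists_two_zeros (h : Admissible A B C r L) (hk : 1 ≤ |k|) (hk' : 1 / (2 * |k|) < r)
    (hL : L / (2 * |k|) ≤ 1 / 16) :
    ∃ z : Fin 2 → ℂ, z 0 ≠ z 1 ∧ (∀ j, ‖z j - center k‖ ≤ 3 / 2 * (L / (2 * |k|)) ∧
      sinhQuad A B C (z j) = 0 ∧ ∃ d ≠ 0, HasDerivAt (sinhQuad A B C) d (z j)) ∧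
      ∀ P T, ‖T‖ ≤ 1 / 16 → sinh P = T * cosh P → P = center k + halfLog T →
        sinhQuad A B C P = 0 → ∃ j, P = z j := by
  obtain ⟨T₁, T₂, d₁, d₂, hT⟩ := exists_factors h hk hk'
  obtain ⟨z₁, -, n₁, q₁, D₁, s₁, c₁, u₁⟩ := exists_simple_zero hL rfl d₁ d₂ hT
  obtain ⟨z₂, -, n₂, q₂, D₂, s₂, c₂, u₂⟩ := exists_simple_zero hL rfl d₂ d₁ fun P hP => by
    obtain ⟨a1, a2, a3, a4, a5, a6⟩ := hT P hP
    exact ⟨a1.symm, a3, a2, a4, a5, fun T => by rw [a6]; ring⟩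
  refine ⟨![z₁, z₂], ?_, ?_, ?_⟩
  · intro heq
    change z₁ = z₂ at heq
    subst heq
    rw [s₁] at s₂
    refine (hT z₁ ?_).1 (mul_right_cancel₀ c₁ s₂)
    rw [mem_ball, dist_eq_norm]
    linarith
  · intro j
    fin_cases j
    · exact ⟨n₁, q₁, D₁⟩
    · exact ⟨n₂, q₂, D₂⟩
  · intro P T hT' hs hP hq
    have hPb : P ∈ closedBall (center k) (1 / 2) := by
      rw [mem_closedBall, dist_eq_norm, hP, add_sub_cancel_left]
      exact (norm_halfLog_le (hT'.trans (by norm_num))).trans (by linarith)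
    have hcosh : cosh P ≠ 0 := by
      intro h0
      have := cosh_sq_sub_sinh_sq P
      rw [hs, h0] at this
      norm_num at this
    obtain ⟨-, -, -, a4, -, a6⟩ := hT P (closedBall_subset_ball (by norm_num) hPb)
    have e : A P⁻¹ * (T - T₁ P) * (T - T₂ P) * cosh P ^ 2 = 0 := by
      rw [← a6, ← hq, sinhQuad, hs]; ring
    rcases mul_eq_zero.1 ((mul_eq_zero.1 e).resolve_right (pow_ne_zero 2 hcosh)) with h1 | h1
    · have h2 := sub_eq_zero.1 ((mul_eq_zero.1 h1).resolve_left a4)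
      exact ⟨0, u₁ P hPb (by rw [← h2]; exact hP)⟩
    · have h2 := sub_eq_zero.1 h1
      exact ⟨1, u₂ P hPb (by rw [← h2]; exact hP)⟩

end Local

/-- The large zeros of `sinhQuad` form two families of simple zeros close to `i k π`. -/
theorem exists_zeros {A B C : ℂ → ℂ} {r L : ℝ} (h : Admissible A B C r L) :
    ∃ (K : ℕ) (ζ : Fin 2 → ℤ → ℂ), 1 ≤ K ∧
      (∀ j, Tendsto (fun k : ℤ => ζ j k - center k) cofinite (𝓝 0)) ∧
      (∀ j k j' k', (K : ℤ) ≤ |k| → (K : ℤ) ≤ |k'| → ζ j k = ζ j' k' → j = j' ∧ k = k') ∧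
      (∀ j k, (K : ℤ) ≤ |k| → sinhQuad A B C (ζ j k) = 0 ∧
        ∃ d ≠ 0, HasDerivAt (sinhQuad A B C) d (ζ j k)) ∧
      ∃ R : ℝ, ∀ P, R < ‖P‖ → sinhQuad A B C P = 0 → ∃ j k, (K : ℤ) ≤ |k| ∧ P = ζ j k := by
  -- The terms ensure `1/(2|k|) < r`, `L/(2|k|) ≤ 1/16` and `|k| ≥ 1` for `|k| ≥ K`.
  obtain ⟨K, hK⟩ := exists_nat_gt (1 / (2 * r) + 8 * L + 1)
  have hr := h.r_pos
  have hLp := h.L_pos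
  have hr2 : 0 < 1 / (2 * r) := by positivity
  have hK1 : 1 ≤ K := by
    have : (1 : ℝ) < K := by linarith
    exact_mod_cast this.le
  have hcond : ∀ k : ℤ, (K : ℤ) ≤ |k| → 1 ≤ |k| ∧ 1 / (2 * (|k| : ℝ)) < r ∧
      L / (2 * (|k| : ℝ)) ≤ 1 / 16 := by
    intro k hk
    have hk' : (K : ℝ) ≤ |(k : ℝ)| := by exact_mod_cast hk
    have hpos : 0 < |(k : ℝ)| := by linarith
    refine ⟨by omega, ?_, ?_⟩
    · rw [div_lt_iff₀ (by positivity)]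
      have : 1 / (2 * r) < |(k : ℝ)| := by linarith
      rw [div_lt_iff₀ (by positivity)] at this
      linarith
    · rw [div_le_iff₀ (by positivity)]
      linarith
  have hloc : ∀ k : ℤ, ∃ z : Fin 2 → ℂ, (K : ℤ) ≤ |k| → z 0 ≠ z 1 ∧
      (∀ j, ‖z j - center k‖ ≤ 3 / 2 * (L / (2 * (|k| : ℝ))) ∧
      sinhQuad A B C (z j) = 0 ∧ ∃ d ≠ 0, HasDerivAt (sinhQuad A B C) d (z j)) ∧
      ∀ P T, ‖T‖ ≤ 1 / 16 → sinh P = T * cosh P → P = center k + halfLog T →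
        sinhQuad A B C P = 0 → ∃ j, P = z j := by
    intro k
    by_cases hk : (K : ℤ) ≤ |k|
    · obtain ⟨h1, h2, h3⟩ := hcond k hk
      obtain ⟨z, hz⟩ := exists_two_zeros h h1 (by exact_mod_cast h2) (by exact_mod_cast h3)
      exact ⟨z, fun _ => by exact_mod_cast hz⟩
    · exact ⟨0, fun h' => absurd h' hk⟩
  choose z hz using hloc
  have hdist : ∀ j k, (K : ℤ) ≤ |k| → ‖z k j - center k‖ ≤ 3 / 32 := fun j k hk => by
    have h1 := ((hz k hk).2.1 j).1
    have h2 := (hcond k hk).2.2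
    linarith
  refine ⟨K, fun j k => z k j, hK1, fun j => ?_, ?_, fun j k hk => ((hz k hk).2.1 j).2, ?_⟩
  · rw [tendsto_zero_iff_norm_tendsto_zero]
    have habs : Tendsto (fun k : ℤ => |(k : ℝ)|) cofinite atTop := by
      have := tendsto_norm_cocompact_atTop (E := ℤ)
      rw [cocompact_eq_cofinite] at this
      exact this.congr fun k => by rw [Int.norm_eq_abs]
    have hlim : Tendsto (fun k : ℤ => 3 / 2 * (L / (2 * |(k : ℝ)|))) cofinite (𝓝 0) := by
      have := ((habs.const_mul_atTop two_pos).const_div_atTop L).const_mul (3 / 2)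
      rwa [mul_zero] at this
    refine squeeze_zero' (Eventually.of_forall fun _ => norm_nonneg _) ?_ hlim
    filter_upwards [habs.eventually_ge_atTop (K : ℝ)] with k hk
    exact ((hz k (by exact_mod_cast hk)).2.1 j).1
  · intro j k j' k' hk hk' heq
    change z k j = z k' j' at heq
    -- Centers are at least `π` apart, while each zero is within `3/32` of its center.
    have hkk : k = k' := by
      by_contra hne
      have h1 := hdist j k hk
      have h2 := hdist j' k' hk'
      rw [← heq] at h2
      have h3 : ‖center k - center k'‖ = |((k - k' : ℤ) : ℝ)| * Real.pi := by
        rw [center, center, ← sub_mul, ← mul_sub, norm_mul, norm_mul, norm_I, one_mul,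
          ← Int.cast_sub, Complex.norm_intCast, Complex.norm_real,
          Real.norm_of_nonneg Real.pi_pos.le]
      have h4 : (1 : ℝ) ≤ |((k - k' : ℤ) : ℝ)| := by
        exact_mod_cast Int.one_le_abs (sub_ne_zero.2 hne)
      have h5 : ‖center k - center k'‖ ≤ ‖z k j - center k'‖ + ‖z k j - center k‖ := by
        have := norm_sub_le (z k j - center k') (z k j - center k)
        rwa [sub_sub_sub_cancel_left] at this
      have h6 : 1 * 3 ≤ |((k - k' : ℤ) : ℝ)| * Real.pi := by
        gcongr; exact Real.pi_gt_three.le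
      linarith
    subst hkk
    refine ⟨?_, rfl⟩
    have hne := (hz k hk).1
    fin_cases j <;> fin_cases j' <;> first | rfl | exact absurd heq hne | exact absurd heq.symm hne
  -- For larger `|P|` the point `1/P` lies in the disk, the bound `|P T| ≤ L` for `T = tanh P` gives
  -- `|T| ≤ 1/16`, and `|P| ≤ 4|k| + 3/32` forces `|k| ≥ K`.
  · refine ⟨1 / r + 16 * L + 4 * K + 1, fun P hP hq => ?_⟩
    have hr1 : 0 < 1 / r := by positivity
    have hK0 : (0 : ℝ) ≤ K := Nat.cast_nonneg K
    have hP0 : P ≠ 0 := norm_pos_iff.1 (by linarith)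
    have hPn : 0 < ‖P‖ := norm_pos_iff.2 hP0
    have hmem : P⁻¹ ∈ ball (0 : ℂ) r := by
      rw [mem_ball_zero_iff, norm_inv, inv_lt_comm₀ hPn hr, ← one_div]
      linarith
    have hcosh : cosh P ≠ 0 := by
      intro h0
      have h1 := cosh_sq_sub_sinh_sq P
      have h2 : A P⁻¹ * sinh P ^ 2 = 0 := by
        rw [sinhQuad, h0] at hq; linear_combination hq
      have h3 := (mul_eq_zero.1 h2).resolve_left (h.A_ne _ hmem)
      rw [h0, h3] at h1
      norm_num at h1
    set T := sinh P / cosh P with hT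
    have hs : sinh P = T * cosh P := (div_mul_cancel₀ _ hcosh).symm
    have hquad : A P⁻¹ * (P * T) ^ 2 + B P⁻¹ * (P * T) + C P⁻¹ = 0 := by
      have e : (A P⁻¹ * (P * T) ^ 2 + B P⁻¹ * (P * T) + C P⁻¹) * (P⁻¹ ^ 2 * cosh P ^ 2) = 0 := by
        rw [← hq, sinhQuad, hs]
        field_simp
      exact (mul_eq_zero.1 e).resolve_right
        (mul_ne_zero (pow_ne_zero 2 (inv_ne_zero hP0)) (pow_ne_zero 2 hcosh))
    have hTn : ‖T‖ ≤ 1 / 16 := by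
      have h1 := h.bound _ hmem _ hquad
      rw [norm_mul] at h1
      have h2 : 16 * L * ‖T‖ ≤ L := le_trans (by gcongr; linarith) h1
      have h3 : L * (16 * ‖T‖) ≤ L * 1 := by linarith
      have := le_of_mul_le_mul_left h3 hLp
      linarith
    obtain ⟨k, hk⟩ := (sinh_eq_mul_cosh_iff (hTn.trans_lt (by norm_num))).1 hs
    have hkK : (K : ℤ) ≤ |k| := by
      have h1 : ‖center k‖ = |(k : ℝ)| * Real.pi := by
        rw [center, norm_mul, norm_mul, norm_I, one_mul, Complex.norm_intCast, Complex.norm_real,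
          Real.norm_of_nonneg Real.pi_pos.le]
      have h2 := norm_add_le (center k) (halfLog T)
      rw [← hk, h1] at h2
      have h3 := norm_halfLog_le (hTn.trans (by norm_num))
      have h4 : |(k : ℝ)| * Real.pi ≤ |(k : ℝ)| * 4 := by
        gcongr; exact Real.pi_le_four
      have : (K : ℝ) ≤ |(k : ℝ)| := by linarith
      exact_mod_cast this
    obtain ⟨j, hj⟩ := (hz k hkK).2.2 P T hTn hs hk hq
    exact ⟨j, k, hkK, hj⟩

end PerturbedSinh
end

noncomputable section

namespace Timoshenko

open Complex Metric PerturbedSinh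

/-! ### The characteristic determinant as a perturbation of `sinh²` -/

section Coefficients

variable (p : Params) (k₂ k₄ : ℝ)

/-- The constant `√b / 2`. -/
def beta : ℝ := √p.b / 2

lemma beta_pos : 0 < beta p := half_pos (Real.sqrt_pos.2 p.b_pos)

/-- With this `β` the relation `4 P² Q² = -b c²` is solved by `P Q = iβ c`. Setting `c = g P` gives
`Q = iβ g`, and `c² = P² + Q²` becomes `g² (1 + β²/P²) = 1`. -/
lemma four_mul_beta_sq : (p.b : ℂ) = 4 * (beta p : ℂ) ^ 2 := by
  have : p.b = 4 * beta p ^ 2 := by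
    rw [beta, div_pow, Real.sq_sqrt p.b_pos.le]; ring
  exact_mod_cast this

/-- The function `(1 + β² h²) ^ (-1/2)`. -/
def gFun (h : ℂ) : ℂ := (1 + (beta p : ℂ) ^ 2 * h ^ 2) ^ (-(1 / 2) : ℂ)

/-- The bounded exponent, as a function of the inverse of the unbounded one. -/
def qFun (h : ℂ) : ℂ := Complex.I * beta p * gFun p h

variable {p} in
lemma one_add_mem_slitPlane {h : ℂ} (hh : h ∈ ball (0 : ℂ) (1 / beta p)) :
    1 + (beta p : ℂ) ^ 2 * h ^ 2 ∈ slitPlane := by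
  have hb := beta_pos p
  refine mem_slitPlane_of_norm_lt_one ?_
  rw [mem_ball_zero_iff, lt_div_iff₀ hb] at hh
  rw [← mul_pow, norm_pow, norm_mul, Complex.norm_real, Real.norm_of_nonneg hb.le, mul_comm]
  exact pow_lt_one₀ (by positivity) hh two_ne_zero

variable {p} in
lemma gFun_sq_mul {h : ℂ} (hh : h ∈ ball (0 : ℂ) (1 / beta p)) :
    gFun p h ^ 2 * (1 + (beta p : ℂ) ^ 2 * h ^ 2) = 1 := by
  have h0 := slitPlane_ne_zero (one_add_mem_slitPlane hh)
  rw [gFun, ← cpow_nat_mul]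
  have : ((2 : ℕ) : ℂ) * (-(1 / 2)) = -1 := by norm_num
  rw [this, cpow_neg_one, inv_mul_cancel₀ h0]

lemma gFun_zero : gFun p 0 = 1 := by simp [gFun]

lemma differentiableOn_gFun : DifferentiableOn ℂ (gFun p) (ball 0 (1 / beta p)) := by
  intro h hh
  have : DifferentiableAt ℂ (fun h : ℂ => 1 + (beta p : ℂ) ^ 2 * h ^ 2) h := by fun_prop
  exact (this.cpow_const (one_add_mem_slitPlane hh)).differentiableWithinAt

/-- The common factor of the leading terms. -/
def coefE (h : ℂ) : ℂ := gFun p h * (gFun p h + k₂ * h) * (gFun p h + k₄ * h)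

/-- The coefficient of the mixed terms. -/
def coefW (h : ℂ) : ℂ := p.k₃ * (gFun p h + k₂ * h) * (1 - h ^ 2 * qFun p h ^ 2)
  - p.k₁ * gFun p h ^ 2 * (gFun p h + k₄ * h)

/-- The coefficient of `sinh²`. -/
def coefA (h : ℂ) : ℂ :=
  coefE p k₂ k₄ h * (1 + h ^ 2 * (qFun p h ^ 2 * sinh (qFun p h) ^ 2))
  - coefW p k₂ k₄ h * h ^ 2 * (qFun p h * sinh (qFun p h) * cosh (qFun p h))
  + p.k₁ * p.k₃ * gFun p h * h ^ 4 * (qFun p h ^ 2 * cosh (qFun p h) ^ 2)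

/-- The coefficient of `sinh cosh`. -/
def coefB (h : ℂ) : ℂ := p.k₃ * (gFun p h + k₂ * h) * (1 - h ^ 2 * qFun p h ^ 2)
  + p.k₁ * gFun p h ^ 2 * (gFun p h + k₄ * h)

/-- The coefficient of `cosh²`. -/
def coefC (h : ℂ) : ℂ :=
  -coefE p k₂ k₄ h * (qFun p h ^ 2 * sinh (qFun p h) ^ 2)
  + coefW p k₂ k₄ h * (qFun p h * sinh (qFun p h) * cosh (qFun p h))
  + p.k₁ * p.k₃ * gFun p h * (1 - h ^ 2 * (qFun p h ^ 2 * cosh (qFun p h) ^ 2))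

lemma differentiableOn_coef :
    DifferentiableOn ℂ (coefA p k₂ k₄) (ball 0 (1 / beta p)) ∧
    DifferentiableOn ℂ (coefB p k₂ k₄) (ball 0 (1 / beta p)) ∧
    DifferentiableOn ℂ (coefC p k₂ k₄) (ball 0 (1 / beta p)) := by
  have hg := differentiableOn_gFun p
  have hq : DifferentiableOn ℂ (qFun p) (ball 0 (1 / beta p)) := hg.const_mul _
  have hE : DifferentiableOn ℂ (coefE p k₂ k₄) (ball 0 (1 / beta p)) := by
    unfold coefE; fun_prop
  have hW : DifferentiableOn ℂ (coefW p k₂ k₄) (ball 0 (1 / beta p)) := by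
    unfold coefW; fun_prop
  have hs : DifferentiableOn ℂ (fun h => sinh (qFun p h)) (ball 0 (1 / beta p)) := hq.csinh
  have hc : DifferentiableOn ℂ (fun h => cosh (qFun p h)) (ball 0 (1 / beta p)) := hq.ccosh
  refine ⟨?_, ?_, ?_⟩
  · unfold coefA; fun_prop
  · unfold coefB; fun_prop
  · unfold coefC; fun_prop

/-- The determinant for two exponents. -/
lemma charDet_eq {c P Q : ℂ} (hc : c ^ 2 = P ^ 2 + Q ^ 2) :
    charDet p k₂ k₄ c P Q = -2 * P * Q * c * (c * (c + k₂) * (c + k₄) *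
        (P ^ 2 * sinh P ^ 2 - Q ^ 2 * sinh Q ^ 2)
      + p.k₃ * (c + k₂) * (P ^ 2 - Q ^ 2) * (P * (sinh P * cosh P) + Q * (sinh Q * cosh Q))
      + p.k₁ * c ^ 2 * (c + k₄) * (P * (sinh P * cosh P) - Q * (sinh Q * cosh Q))
      + p.k₁ * p.k₃ * c * (P ^ 2 * cosh P ^ 2 - Q ^ 2 * cosh Q ^ 2)) := by
  have eP := cosh_sq_sub_sinh_sq P
  have eQ := cosh_sq_sub_sinh_sq Q
  simp only [charDet, bdU, bdY, solU, solY, solS, solQ, ofReal_one, mul_one, ← hc]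
  generalize sinh P = sP at *
  generalize cosh P = cP at *
  generalize sinh Q = sQ at *
  generalize cosh Q = cQ at *
  -- In the products of four hyperbolic functions the terms in `P` carry the factor `cosh² Q - sinh²
  -- Q`, and those in `Q` the factor `cosh² P - sinh² P`.
  linear_combination (-2 * P * Q) * (
    (p.k₁ * c ^ 2 * p.k₃) * (P ^ 2 * cP ^ 2 * eQ - Q ^ 2 * cQ ^ 2 * eP)
    + (p.k₁ * c ^ 2 * (c * (c + k₄))) * (P * sP * cP * eQ - Q * sQ * cQ * eP)
    + (c * (c + k₂) * p.k₃ * (P ^ 2 - Q ^ 2)) * (P * sP * cP * eQ + Q * sQ * cQ * eP)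
    + (c * (c + k₂) * (c * (c + k₄))) * (P ^ 2 * sP ^ 2 * eQ - Q ^ 2 * sQ ^ 2 * eP))

/-- The terms involving only `sinh Q` and `cosh Q` are multiplied by `cosh² P - sinh² P = 1`, which
makes the determinant homogeneous of degree two in `sinh P` and `cosh P`. -/
lemma sinhQuad_factor {P : ℂ} (hP : P ≠ 0)
    (hc : (gFun p P⁻¹ * P) ^ 2 = P ^ 2 + qFun p P⁻¹ ^ 2) :
    charDet p k₂ k₄ (gFun p P⁻¹ * P) P (qFun p P⁻¹) =
      -2 * P ^ 7 * qFun p P⁻¹ * gFun p P⁻¹ *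
        sinhQuad (coefA p k₂ k₄) (coefB p k₂ k₄) (coefC p k₂ k₄) P := by
  rw [charDet_eq p k₂ k₄ hc]
  have eP := cosh_sq_sub_sinh_sq P
  simp only [sinhQuad, coefA, coefB, coefC, coefE, coefW]
  generalize sinh P = sP at *
  generalize cosh P = cP at *
  generalize gFun p P⁻¹ = g at *
  generalize qFun p P⁻¹ = Q at *
  generalize sinh Q = sQ at *
  generalize cosh Q = cQ at *
  clear hc
  field_simp
  linear_combination (Q ^ 2 * sQ * cQ * (p.k₃ * g * (k₂ + g * P) * (P ^ 2 - Q ^ 2)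
    - p.k₁ * g ^ 3 * P ^ 2 * (k₄ + g * P))
    - Q ^ 3 * g ^ 2 * P * (sQ ^ 2 * (k₂ + g * P) * (k₄ + g * P) + p.k₁ * p.k₃ * cQ ^ 2)) * eP

/-- The exponents, parametrized by the unbounded one. -/
lemma isExponent_gFun {P : ℂ} (hP : 2 * beta p < ‖P‖) :
    IsExponent p.b (gFun p P⁻¹ * P) P (qFun p P⁻¹) := by
  have hb := beta_pos p
  have hP0 : P ≠ 0 := norm_pos_iff.1 (by linarith)
  have hmem : P⁻¹ ∈ ball (0 : ℂ) (1 / beta p) := by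
    rw [mem_ball_zero_iff, norm_inv, ← one_div]
    exact one_div_lt_one_div_of_lt hb (by linarith)
  have hbC : (beta p : ℂ) ≠ 0 := ofReal_ne_zero.2 hb.ne'
  have hg := gFun_sq_mul hmem
  have hg0 : gFun p P⁻¹ ≠ 0 := fun h0 => by rw [h0] at hg; norm_num at hg
  have hg' : gFun p P⁻¹ ^ 2 * (P ^ 2 + (beta p : ℂ) ^ 2) = P ^ 2 := by
    have e : P ^ 2 * (1 + (beta p : ℂ) ^ 2 * P⁻¹ ^ 2) = P ^ 2 + (beta p : ℂ) ^ 2 := by field_simp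
    rw [← e]
    linear_combination P ^ 2 * hg
  have hq : qFun p P⁻¹ ^ 2 = -((beta p : ℂ) ^ 2 * gFun p P⁻¹ ^ 2) := by
    rw [qFun, mul_pow, mul_pow, I_sq]; ring
  have hq0 : qFun p P⁻¹ ≠ 0 := mul_ne_zero (mul_ne_zero I_ne_zero hbC) hg0
  refine ⟨mul_ne_zero hg0 hP0, ?_, ?_, ?_⟩
  · rw [hq]; linear_combination hg'
  · rw [mul_assoc (-4 : ℂ), hq, four_mul_beta_sq]
    linear_combination -4 * (beta p : ℂ) ^ 2 * hg'
  -- The case `P² = Q²` would mean `P² = -2β²`, which `|P| > 2β` excludes.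
  · refine mul_ne_zero (mul_ne_zero (mul_ne_zero (by norm_num) hP0) hq0) fun h0 => ?_
    rw [hq] at h0
    have h1 : P ^ 2 * (P ^ 2 + 2 * (beta p : ℂ) ^ 2) = 0 := by
      linear_combination (P ^ 2 + (beta p : ℂ) ^ 2) * h0 - (beta p : ℂ) ^ 2 * hg'
    have h2 := (mul_eq_zero.1 h1).resolve_left (pow_ne_zero 2 hP0)
    have h3 : ‖P‖ ^ 2 = 2 * beta p ^ 2 := by
      rw [← norm_pow, eq_neg_of_add_eq_zero_left h2, norm_neg, norm_mul, norm_pow,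
        Complex.norm_real, Real.norm_of_nonneg hb.le, Complex.norm_ofNat]
    nlinarith

/-- The discriminant does not vanish identically. -/
lemma disc_eventually_ne_zero : ∀ᶠ h in 𝓝[≠] (0 : ℂ),
    coefB p k₂ k₄ h ^ 2 - 4 * coefA p k₂ k₄ h * coefC p k₂ k₄ h ≠ 0 := by
  obtain ⟨dA, dB, dC⟩ := differentiableOn_coef p k₂ k₄
  have hb := beta_pos p
  have hbC : (beta p : ℂ) ≠ 0 := ofReal_ne_zero.2 hb.ne'
  have hball : (0 : ℂ) ∈ ball (0 : ℂ) (1 / beta p) := mem_ball_self (by positivity)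
  have dD : DifferentiableOn ℂ (fun h => coefB p k₂ k₄ h ^ 2 - 4 * coefA p k₂ k₄ h *
      coefC p k₂ k₄ h) (ball 0 (1 / beta p)) := (dB.pow 2).sub ((dA.const_mul 4).mul dC)
  have hana := dD.analyticOnNhd isOpen_ball
  refine ((hana 0 hball).eventually_eq_zero_or_eventually_ne_zero).resolve_left fun hz => ?_
  -- The value at `0` is no help: it vanishes when `k₁ = k₃` and `sin β = 0`. If the discriminant
  -- vanished near `0` it would vanish on the whole disk, which is refuted near the boundary point
  -- `i/β`, where `gFun` blows up.
  have hzero := hana.eqOn_zero_of_preconnected_of_eventuallyEq_zero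
    (convex_ball _ _).isPreconnected hball hz
  -- At `h = η (ε m)` one has `gFun = 1/ε` and `qFun = iβ/ε`. This choice of `ε` gives `cosh (qFun)
  -- = 0`, so only algebraic terms remain.
  set ε : ℕ → ℝ := fun m => beta p / (m * Real.pi + Real.pi / 2) with hε
  have hden : Tendsto (fun m : ℕ => m * Real.pi + Real.pi / 2) atTop atTop :=
    tendsto_atTop_add_const_right _ _
      (tendsto_natCast_atTop_atTop.atTop_mul_const Real.pi_pos)
  have hε0 : Tendsto ε atTop (𝓝 0) := hden.const_div_atTop _
  set η : ℝ → ℂ := fun e => Complex.I * (√(1 - e ^ 2) / beta p : ℝ) with hη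
  have hηc : Continuous η := by
    have : Continuous fun e : ℝ => √(1 - e ^ 2) / beta p := by fun_prop
    exact continuous_const.mul (continuous_ofReal.comp this)
  -- At `e = ε m` this is `e ^ 10` times the discriminant at `η e`; as `e → 0` it tends to `-4β² ≠
  -- 0`.
  set Φ : ℝ → ℂ := fun e =>
    (e : ℂ) ^ 4 * (p.k₃ * (1 + k₂ * η e * e) * (2 * e ^ 2 - 1) + p.k₁ * (1 + k₄ * η e * e)) ^ 2
    - 4 * ((1 + k₂ * η e * e) * (1 + k₄ * η e * e) * (2 * e ^ 2 - 1)) *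
      (-(beta p : ℂ) ^ 2 * ((1 + k₂ * η e * e) * (1 + k₄ * η e * e)) + p.k₁ * p.k₃ * e ^ 4) with hΦ
  have hΦc : Continuous Φ := by fun_prop
  have hlim : Tendsto (fun m => Φ (ε m)) atTop (𝓝 (Φ 0)) := (hΦc.tendsto 0).comp hε0
  have hΦ0 : Φ 0 = -4 * (beta p : ℂ) ^ 2 := by
    simp only [hΦ, ofReal_zero]; ring
  have hev : ∀ᶠ m in atTop, Φ (ε m) = 0 := by
    filter_upwards [hε0.eventually (gt_mem_nhds one_pos)] with m hm
    have hd : 0 < m * Real.pi + Real.pi / 2 := by have := Real.pi_pos; positivity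
    have he : 0 < ε m := div_pos hb hd
    have heC : (ε m : ℂ) ≠ 0 := ofReal_ne_zero.2 he.ne'
    have h1e : 0 < 1 - ε m ^ 2 := by nlinarith
    have hη2 : (beta p : ℂ) ^ 2 * η (ε m) ^ 2 = (ε m : ℂ) ^ 2 - 1 := by
      have : ((√(1 - ε m ^ 2) : ℝ) : ℂ) ^ 2 = 1 - (ε m : ℂ) ^ 2 := by
        rw [← ofReal_pow, Real.sq_sqrt h1e.le]; push_cast; ring
      simp only [hη]
      push_cast
      rw [mul_pow, I_sq, div_pow, this]
      field_simp
      ring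
    have hmem : η (ε m) ∈ ball (0 : ℂ) (1 / beta p) := by
      rw [mem_ball_zero_iff, hη, norm_mul, norm_I, one_mul, Complex.norm_real,
        Real.norm_of_nonneg (by positivity)]
      have : √(1 - ε m ^ 2) < 1 := by
        rw [Real.sqrt_lt' one_pos]; nlinarith
      gcongr
    have hg : gFun p (η (ε m)) = (ε m : ℂ)⁻¹ := by
      have e1 : (1 : ℂ) + (ε m ^ 2 - 1) = ((ε m ^ 2 : ℝ) : ℂ) := by push_cast; ring
      rw [gFun, hη2, e1, show (-(1 / 2) : ℂ) = ((-(1 / 2) : ℝ) : ℂ) by push_cast; rfl,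
        ← ofReal_cpow (by positivity), ← ofReal_inv]
      congr 1
      rw [← Real.rpow_natCast, ← Real.rpow_mul he.le, ← Real.rpow_neg_one]
      norm_num
    have hq : qFun p (η (ε m)) = ((m * Real.pi + Real.pi / 2 : ℝ) : ℂ) * Complex.I := by
      rw [qFun, hg, hε]
      have : ((m * Real.pi + Real.pi / 2 : ℝ) : ℂ) ≠ 0 := ofReal_ne_zero.2 hd.ne'
      push_cast at this ⊢
      field_simp
    have hcosh : cosh (qFun p (η (ε m))) = 0 := by
      rw [hq, cosh_mul_I, ← ofReal_cos, add_comm, Real.cos_add_nat_mul_pi, Real.cos_pi_div_two,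
        mul_zero, ofReal_zero]
    have hsinh : sinh (qFun p (η (ε m))) ^ 2 = -1 := by
      have := cosh_sq_sub_sinh_sq (qFun p (η (ε m)))
      rw [hcosh] at this
      linear_combination -this
    have hq2 : qFun p (η (ε m)) ^ 2 = -((beta p : ℂ) ^ 2 * ((ε m : ℂ)⁻¹) ^ 2) := by
      rw [qFun, hg, mul_pow, mul_pow, I_sq]; ring
    have hhq : 1 - η (ε m) ^ 2 * qFun p (η (ε m)) ^ 2 = 2 - ((ε m : ℂ)⁻¹) ^ 2 := by
      rw [hq2]
      have : ((ε m : ℂ)⁻¹) ^ 2 * (ε m : ℂ) ^ 2 = 1 := by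
        rw [← mul_pow, inv_mul_cancel₀ heC, one_pow]
      linear_combination ((ε m : ℂ)⁻¹) ^ 2 * hη2 + this
    have vE : coefE p k₂ k₄ (η (ε m)) * (ε m : ℂ) ^ 3
        = (1 + k₂ * η (ε m) * ε m) * (1 + k₄ * η (ε m) * ε m) := by
      rw [coefE, hg]; field_simp
    have vA : coefA p k₂ k₄ (η (ε m)) * (ε m : ℂ) ^ 5
        = (1 + k₂ * η (ε m) * ε m) * (1 + k₄ * η (ε m) * ε m) * (2 * (ε m : ℂ) ^ 2 - 1) := by
      rw [← vE, coefA, hcosh, hsinh]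
      have : coefE p k₂ k₄ (η (ε m)) * (1 + η (ε m) ^ 2 * (qFun p (η (ε m)) ^ 2 * -1))
          = coefE p k₂ k₄ (η (ε m)) * (2 - ((ε m : ℂ)⁻¹) ^ 2) := by rw [← hhq]; ring
      rw [this]
      field_simp
      ring
    have vB : coefB p k₂ k₄ (η (ε m)) * (ε m : ℂ) ^ 3
        = p.k₃ * (1 + k₂ * η (ε m) * ε m) * (2 * (ε m : ℂ) ^ 2 - 1)
          + p.k₁ * (1 + k₄ * η (ε m) * ε m) := by
      rw [coefB, hhq, hg]
      field_simp
    have vC : coefC p k₂ k₄ (η (ε m)) * (ε m : ℂ) ^ 5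
        = -(beta p : ℂ) ^ 2 * ((1 + k₂ * η (ε m) * ε m) * (1 + k₄ * η (ε m) * ε m))
          + p.k₁ * p.k₃ * (ε m : ℂ) ^ 4 := by
      rw [← vE, coefC, hcosh, hsinh, hq2, hg]
      field_simp
      ring
    have hz := hzero hmem
    simp only [Pi.zero_apply] at hz
    simp only [hΦ]
    rw [← vA, ← vB, ← vC]
    linear_combination (ε m : ℂ) ^ 10 * hz
  have := tendsto_nhds_unique hlim (tendsto_const_nhds.congr' (hev.mono fun _ h => h.symm))
  rw [hΦ0] at this
  simp [hbC] at this

lemma exists_admissible_coef :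
    ∃ r L, Admissible (coefA p k₂ k₄) (coefB p k₂ k₄) (coefC p k₂ k₄) r L := by
  obtain ⟨dA, dB, dC⟩ := differentiableOn_coef p k₂ k₄
  refine exists_admissible (one_div_pos.2 (beta_pos p)) dA dB dC ?_ (disc_eventually_ne_zero p k₂ k₄)
  simp [coefA, coefE, gFun_zero]

end Coefficients

end Timoshenko
end

noncomputable section

namespace Timoshenko

open Complex Metric PerturbedSinh InverseOperator

/-! ### The large eigenvalues -/

lemma exists_forall_abs_ge {q : ℤ → Prop} (h : ∀ᶠ k in cofinite, q k) :
    ∃ K : ℕ, ∀ k : ℤ, (K : ℤ) ≤ |k| → q k := by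
  rw [Filter.eventually_cofinite] at h
  obtain ⟨M, hM⟩ := (h.image fun k : ℤ => |k|).bddAbove
  refine ⟨(M + 1).toNat, fun k hk => ?_⟩
  by_contra hq
  have h1 : |k| ≤ M := hM ⟨k, hq, rfl⟩
  have h2 := Int.self_le_toNat (M + 1)
  omega

section Families

variable (p : Params)

/-- The spectral parameter as a function of the unbounded exponent. -/
def lam (P : ℂ) : ℂ := gFun p P⁻¹ * P

variable {p}

lemma inv_mem_ball {P : ℂ} (hP : 2 * beta p < ‖P‖) : P⁻¹ ∈ ball (0 : ℂ) (1 / beta p) := by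
  have hb := beta_pos p
  rw [mem_ball_zero_iff, norm_inv, ← one_div]
  exact one_div_lt_one_div_of_lt hb (by linarith)

lemma lam_sq_mul {P : ℂ} (hP : 2 * beta p < ‖P‖) :
    lam p P ^ 2 * (P ^ 2 + (beta p : ℂ) ^ 2) = (P ^ 2) ^ 2 := by
  have hb := beta_pos p
  have hP0 : P ≠ 0 := norm_pos_iff.1 (by linarith)
  have e : P ^ 2 * (1 + (beta p : ℂ) ^ 2 * P⁻¹ ^ 2) = P ^ 2 + (beta p : ℂ) ^ 2 := by field_simp
  rw [← e, lam]
  linear_combination P ^ 4 * gFun_sq_mul (inv_mem_ball hP)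

lemma lam_neg (P : ℂ) : lam p (-P) = -lam p P := by
  simp only [lam, gFun, inv_neg, neg_sq]
  ring

lemma lam_ne_zero {P : ℂ} (hP : 2 * beta p < ‖P‖) : lam p P ≠ 0 := (isExponent_gFun p hP).ne_zero

lemma four_beta_sq_lt {P : ℂ} (hP : 2 * beta p < ‖P‖) : 4 * beta p ^ 2 < ‖P ^ 2‖ := by
  have hb := beta_pos p
  rw [norm_pow]
  nlinarith

/-- For given `c`, both `P²` and `P'²` solve `w² = c² (w + β²)`. Distinct roots satisfy `w w' = -β²
(w + w')`, impossible if both exceed `4β²` in modulus. The sign is settled because `lam` is odd and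
nonzero. -/
lemma lam_injective {P P' : ℂ} (hP : 2 * beta p < ‖P‖) (hP' : 2 * beta p < ‖P'‖)
    (h : lam p P = lam p P') : P = P' := by
  have hb := beta_pos p
  have h1 := lam_sq_mul hP
  have h2 := lam_sq_mul hP'
  rw [← h] at h2
  have h3 : (P ^ 2 - P' ^ 2) * (lam p P ^ 2 - (P ^ 2 + P' ^ 2)) = 0 := by
    linear_combination h1 - h2
  rcases mul_eq_zero.1 h3 with h4 | h4
  · have h5 : (P - P') * (P + P') = 0 := by linear_combination h4
    rcases mul_eq_zero.1 h5 with h6 | h6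
    · exact sub_eq_zero.1 h6
    · rw [eq_neg_of_add_eq_zero_left h6, lam_neg] at h
      exact absurd (by linear_combination (-1 / 2 : ℂ) * h) (lam_ne_zero hP')
  · exfalso
    have n1 := four_beta_sq_lt hP
    have n2 := four_beta_sq_lt hP'
    have h5 : P ^ 2 * P' ^ 2 = -((beta p : ℂ) ^ 2 * (P ^ 2 + P' ^ 2)) := by
      linear_combination h1 - (P ^ 2 + (beta p : ℂ) ^ 2) * h4
    have h6 : ‖P ^ 2‖ * ‖P' ^ 2‖ ≤ beta p ^ 2 * (‖P ^ 2‖ + ‖P' ^ 2‖) := by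
      rw [← norm_mul, h5, norm_neg, norm_mul, norm_pow (beta p : ℂ), Complex.norm_real,
        Real.norm_of_nonneg hb.le]
      gcongr
      exact norm_add_le _ _
    have hb2 : 0 < beta p ^ 2 := by positivity
    nlinarith

/-- The roots of `w² = c² (w + β²)` have sum `c²`, so one has modulus at least `|c|²/2`. A square
root of it, with the right sign, is the required `P`. -/
lemma exists_lam_eq {c : ℂ} {R : ℝ} (hR : 2 * beta p ≤ R) (hc : 2 * R < ‖c‖) :
    ∃ P, R < ‖P‖ ∧ lam p P = c := by
  have hb := beta_pos p
  have hR0 : 0 < R := by linarith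
  obtain ⟨w, hw, hwn⟩ : ∃ w : ℂ, c ^ 2 * (w + (beta p : ℂ) ^ 2) = w ^ 2 ∧ ‖c‖ ^ 2 / 2 ≤ ‖w‖ := by
    obtain ⟨s, hs⟩ := IsAlgClosed.exists_pow_nat_eq (c ^ 4 + 4 * c ^ 2 * (beta p : ℂ) ^ 2) two_pos
    have hsum : ‖c‖ ^ 2 ≤ ‖(c ^ 2 + s) / 2‖ + ‖(c ^ 2 - s) / 2‖ := by
      have := norm_add_le ((c ^ 2 + s) / 2) ((c ^ 2 - s) / 2)
      rwa [show (c ^ 2 + s) / 2 + (c ^ 2 - s) / 2 = c ^ 2 by ring, norm_pow] at this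
    rcases le_total (‖c‖ ^ 2 / 2) ‖(c ^ 2 + s) / 2‖ with h | h
    · exact ⟨_, by linear_combination (-1 / 4 : ℂ) * hs, h⟩
    · exact ⟨(c ^ 2 - s) / 2, by linear_combination (-1 / 4 : ℂ) * hs, by linarith⟩
  obtain ⟨P, hP⟩ := IsAlgClosed.exists_pow_nat_eq w two_pos
  have hPR : R < ‖P‖ := by
    rw [← hP, norm_pow] at hwn
    by_contra hle
    have : ‖P‖ ^ 2 ≤ R ^ 2 := by
      have := norm_nonneg P
      gcongr
      exact not_lt.1 hle
    nlinarith
  have hPb : 2 * beta p < ‖P‖ := by linarith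
  have h1 := lam_sq_mul hPb
  rw [hP] at h1
  have hne : w + (beta p : ℂ) ^ 2 ≠ 0 := by
    intro h0
    have h2 := four_beta_sq_lt hPb
    rw [hP, eq_neg_of_add_eq_zero_left h0, norm_neg, norm_pow, Complex.norm_real,
      Real.norm_of_nonneg hb.le] at h2
    nlinarith
  have h3 : lam p P ^ 2 = c ^ 2 := mul_right_cancel₀ hne (h1.trans hw.symm)
  rcases sq_eq_sq_iff_eq_or_eq_neg.1 h3 with h4 | h4
  · exact ⟨P, hPR, h4⟩
  · exact ⟨-P, by rwa [norm_neg], by rw [lam_neg, h4, neg_neg]⟩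

/-- With `h = 1/P`, the relation `g² (1 + β² h²) = 1` turns `P (g - 1)` into `-β² h g² / (g + 1)`,
which tends to `0` with `h`. -/
lemma tendsto_lam_sub {α : Type*} {l : Filter α} {ζ : α → ℂ}
    (hζ : Tendsto (fun a => ‖ζ a‖) l atTop) : Tendsto (fun a => lam p (ζ a) - ζ a) l (𝓝 0) := by
  have hb := beta_pos p
  have hg : ContinuousAt (gFun p) 0 :=
    ((differentiableOn_gFun p).differentiableAt (ball_mem_nhds 0 (by positivity))).continuousAt
  have hm : ContinuousAt (fun h => -((beta p : ℂ) ^ 2 * h * gFun p h ^ 2) / (gFun p h + 1)) 0 := by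
    refine ContinuousAt.div ?_ (hg.add continuousAt_const) ?_
    · exact ((continuousAt_const.mul continuousAt_id).mul (hg.pow 2)).neg
    · rw [gFun_zero]; norm_num
  have hinv : Tendsto (fun a => (ζ a)⁻¹) l (𝓝 0) := by
    rw [tendsto_zero_iff_norm_tendsto_zero]
    simp only [norm_inv]
    exact tendsto_inv_atTop_zero.comp hζ
  have h1 := hm.tendsto.comp hinv
  simp only [mul_zero, zero_mul, neg_zero, zero_div] at h1
  refine h1.congr' ?_
  have hg1 : ∀ᶠ a in l, gFun p (ζ a)⁻¹ ≠ -1 :=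
    (hg.tendsto.comp hinv).eventually_ne (by rw [gFun_zero]; norm_num)
  filter_upwards [hg1, hζ.eventually_gt_atTop (2 * beta p)] with a ha1 ha2
  have hne : gFun p (ζ a)⁻¹ + 1 ≠ 0 := fun h0 => ha1 (eq_neg_of_add_eq_zero_left h0)
  have hP0 : ζ a ≠ 0 := norm_pos_iff.1 (by linarith)
  have h2 := gFun_sq_mul (inv_mem_ball ha2)
  have h3 : ζ a * (ζ a)⁻¹ = 1 := mul_inv_cancel₀ hP0
  simp only [Function.comp, lam]
  rw [div_eq_iff hne]
  linear_combination (beta p : ℂ) ^ 2 * gFun p (ζ a)⁻¹ ^ 2 * (ζ a)⁻¹ * h3 - ζ a * h2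

variable (k₂ k₄ : ℝ)

lemma charDet_lam {P : ℂ} (hP : 2 * beta p < ‖P‖) :
    charDet p k₂ k₄ (lam p P) P (qFun p P⁻¹) = -2 * P ^ 7 * qFun p P⁻¹ * gFun p P⁻¹ *
      sinhQuad (coefA p k₂ k₄) (coefB p k₂ k₄) (coefC p k₂ k₄) P := by
  have hb := beta_pos p
  exact sinhQuad_factor p k₂ k₄ (norm_pos_iff.1 (by linarith)) (isExponent_gFun p hP).sq_eq

lemma factor_ne_zero {P : ℂ} (hP : 2 * beta p < ‖P‖) :
    -2 * P ^ 7 * qFun p P⁻¹ * gFun p P⁻¹ ≠ 0 := by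
  have hb := beta_pos p
  have hP0 : P ≠ 0 := norm_pos_iff.1 (by linarith)
  have hg0 : gFun p P⁻¹ ≠ 0 := fun h0 => by
    have := gFun_sq_mul (inv_mem_ball hP)
    rw [h0] at this
    norm_num at this
  have hq0 : qFun p P⁻¹ ≠ 0 :=
    mul_ne_zero (mul_ne_zero I_ne_zero (ofReal_ne_zero.2 hb.ne')) hg0
  exact mul_ne_zero (mul_ne_zero (mul_ne_zero (by norm_num) (pow_ne_zero 7 hP0)) hq0) hg0

lemma eigenspace_lam_ne_bot_iff {P : ℂ} (hP : 2 * beta p < ‖P‖) :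
    (op p k₂ k₄).eigenspace (lam p P) ≠ ⊥ ↔
      sinhQuad (coefA p k₂ k₄) (coefB p k₂ k₄) (coefC p k₂ k₄) P = 0 := by
  rw [eigenspace_ne_bot_iff (c := lam p P) (isExponent_gFun p hP), charDet_lam k₂ k₄ hP, mul_eq_zero,
    or_iff_right (factor_ne_zero hP)]

lemma hasAlgMult_lam {P d : ℂ} (hP : 2 * beta p < ‖P‖)
    (h0 : sinhQuad (coefA p k₂ k₄) (coefB p k₂ k₄) (coefC p k₂ k₄) P = 0) (hd : d ≠ 0)
    (hD : HasDerivAt (sinhQuad (coefA p k₂ k₄) (coefB p k₂ k₄) (coefC p k₂ k₄)) d P) :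
    (op p k₂ k₄).HasAlgMult (lam p P) 1 := by
  have hb := beta_pos p
  have hP0 : P ≠ 0 := norm_pos_iff.1 (by linarith)
  have hev : ∀ᶠ w in 𝓝 P, 2 * beta p < ‖w‖ := continuous_norm.continuousAt.eventually (lt_mem_nhds hP)
  have dinv : DifferentiableAt ℂ (fun w : ℂ => w⁻¹) P := differentiableAt_inv hP0
  have dg : DifferentiableAt ℂ (fun w : ℂ => gFun p w⁻¹) P :=
    ((differentiableOn_gFun p).differentiableAt
      (isOpen_ball.mem_nhds (inv_mem_ball hP))).comp P dinv
  have dq : DifferentiableAt ℂ (fun w : ℂ => qFun p w⁻¹) P := dg.const_mul _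
  have dF : DifferentiableAt ℂ (fun w : ℂ => -2 * w ^ 7 * qFun p w⁻¹ * gFun p w⁻¹) P := by
    fun_prop
  have hder := (dF.hasDerivAt.mul hD).congr_of_eventuallyEq
    (f₁ := fun w => charDet p k₂ k₄ (lam p w) w (qFun p w⁻¹))
    (by filter_upwards [hev] with w hw using charDet_lam k₂ k₄ hw)
  refine algMult_of_simple_zero (P := fun w => w) (Q := fun w => qFun p w⁻¹) (l := lam p)
    (by filter_upwards [hev] with w hw using isExponent_gFun p hw) (dg.mul differentiableAt_id)
    differentiableAt_id dq ?_ hder ?_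
  · rw [charDet_lam k₂ k₄ hP, h0, mul_zero]
  · rw [h0, mul_zero, zero_add]
    exact mul_ne_zero (factor_ne_zero hP) hd

variable (p) in
/-- All but finitely many eigenvalues form two families of simple eigenvalues. -/
theorem exists_eigenvalue_families : ∃ (K : ℕ) (μ : Fin 2 → ℤ → ℂ),
    (∀ j, Tendsto (fun k : ℤ => μ j k - Complex.I * k * Real.pi) cofinite (𝓝 0)) ∧
    (∀ j k j' k', (K : ℤ) ≤ |k| → (K : ℤ) ≤ |k'| → μ j k = μ j' k' → j = j' ∧ k = k') ∧
    (∀ j k, (K : ℤ) ≤ |k| → (op p k₂ k₄).eigenspace (μ j k) ≠ ⊥ ∧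
      (op p k₂ k₄).HasAlgMult (μ j k) 1) ∧
    {c | (op p k₂ k₄).eigenspace c ≠ ⊥ ∧ ∀ j k, (K : ℤ) ≤ |k| → c ≠ μ j k}.Finite := by
  obtain ⟨r, L, hadm⟩ := exists_admissible_coef p k₂ k₄
  obtain ⟨K₁, ζ, -, hasy, hinj, hsimple, R, hR⟩ := exists_zeros hadm
  have hcenter : Tendsto (fun k : ℤ => ‖center k‖) cofinite atTop := by
    have := tendsto_norm_cocompact_atTop (E := ℤ)
    rw [cocompact_eq_cofinite] at this
    refine (this.atTop_mul_const Real.pi_pos).congr fun k => ?_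
    rw [center, norm_mul, norm_mul, norm_I, one_mul, Complex.norm_intCast, Complex.norm_real,
      Real.norm_of_nonneg Real.pi_pos.le, Int.norm_eq_abs]
  have hnorm : ∀ j, Tendsto (fun k => ‖ζ j k‖) cofinite atTop := by
    intro j
    have h1 : ∀ᶠ k in cofinite, ‖ζ j k - center k‖ ≤ 1 :=
      (hasy j).norm.eventually_le_const (by rw [norm_zero]; exact one_pos)
    refine tendsto_atTop_mono' _ ?_ (tendsto_atTop_add_const_right _ (-1) hcenter)
    filter_upwards [h1] with k hk
    have := norm_sub_norm_le (center k) (center k - ζ j k)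
    rw [sub_sub_cancel, norm_sub_rev] at this
    linarith
  have hlarge : ∀ j, ∃ K : ℕ, ∀ k : ℤ, (K : ℤ) ≤ |k| → 2 * beta p < ‖ζ j k‖ := fun j =>
    exists_forall_abs_ge ((hnorm j).eventually_gt_atTop _)
  choose K₂ hK₂ using hlarge
  set K := K₁ + K₂ 0 + K₂ 1 with hK
  have hK₁ : ∀ k : ℤ, (K : ℤ) ≤ |k| → (K₁ : ℤ) ≤ |k| := fun k hk => by omega
  have hb : ∀ j, ∀ k : ℤ, (K : ℤ) ≤ |k| → 2 * beta p < ‖ζ j k‖ := fun j k hk => by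
    refine hK₂ j k ?_
    fin_cases j
    · change (K₂ 0 : ℤ) ≤ _; omega
    · change (K₂ 1 : ℤ) ≤ _; omega
  refine ⟨K, fun j k => lam p (ζ j k), fun j => ?_, ?_, ?_, ?_⟩
  · have := (tendsto_lam_sub (p := p) (hnorm j)).add (hasy j)
    rw [add_zero] at this
    refine this.congr fun k => ?_
    rw [center]; ring
  · intro j k j' k' hk hk' heq
    exact hinj j k j' k' (hK₁ k hk) (hK₁ k' hk') (lam_injective (hb j k hk) (hb j' k' hk') heq)
  · intro j k hk
    obtain ⟨h0, d, hd, hD⟩ := hsimple j k (hK₁ k hk)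
    exact ⟨(eigenspace_lam_ne_bot_iff k₂ k₄ (hb j k hk)).2 h0,
      hasAlgMult_lam k₂ k₄ (hb j k hk) h0 hd hD⟩
  -- Eigenvalues of modulus at most `2R'` are finitely many by compactness. The others come from
  -- large zeros, of which only those with `|k| < K` are outside the families.
  · set R' := max R (2 * beta p) with hR'
    have hfin1 := (hasBoundedInverse_op p k₂ k₄).finite_eigenvalues
      (isCompactOperator_opInv p k₂ k₄) (2 * R')
    have hfin2 : (⋃ j : Fin 2, (fun k => lam p (ζ j k)) '' Set.Icc (-(K : ℤ)) K).Finite :=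
      Set.finite_iUnion fun j => (Set.finite_Icc _ _).image _
    refine (hfin1.union hfin2).subset fun c hc => ?_
    obtain ⟨hc1, hc2⟩ := hc
    rcases le_or_gt ‖c‖ (2 * R') with h | h
    · exact Or.inl ⟨hc1, h⟩
    · right
      obtain ⟨P, hP, rfl⟩ := exists_lam_eq (le_max_right _ _) h
      have hPb : 2 * beta p < ‖P‖ := (le_max_right _ _).trans_lt hP
      obtain ⟨j, k, -, rfl⟩ := hR P ((le_max_left _ _).trans_lt hP)
        ((eigenspace_lam_ne_bot_iff k₂ k₄ hPb).1 hc1)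
      refine Set.mem_iUnion.2 ⟨j, k, ?_, rfl⟩
      have hk : ¬ (K : ℤ) ≤ |k| := fun hk => hc2 j k hk rfl
      exact abs_le.1 (not_le.1 hk).le

end Families

end Timoshenko
end

noncomputable section

namespace Timoshenko

open InverseOperator

/-! ### The splitting of the spectrum -/

/-- Splitting of the spectrum for all large `k₀`. -/
theorem exists_spectrumSplits (p : Params) (k₂ k₄ : ℝ) : ∃ K : ℕ, ∀ k₀ : ℕ, K ≤ k₀ →
    ∃ (N : ℕ) (κ : Fin N → ℂ) (μ : Fin 2 → ℤ → ℂ),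
      (op p k₂ k₄).SpectrumSplits k₀ κ
        (fun i => Module.finrank ℂ ((op p k₂ k₄).rootSpace (κ i))) μ ∧
      (∀ i, (op p k₂ k₄).eigenspace (κ i) ≠ ⊥) ∧
      ∀ j k, (k₀ : ℤ) ≤ |k| → (op p k₂ k₄).eigenspace (μ j k) ≠ ⊥ := by
  obtain ⟨K, μ, hasy, hinj, hsimple, hfin⟩ := exists_eigenvalue_families p k₂ k₄
  refine ⟨K, fun k₀ hk₀ => ?_⟩
  have hK : ∀ k : ℤ, (k₀ : ℤ) ≤ |k| → (K : ℤ) ≤ |k| := fun k hk => by omega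
  have hinv := hasBoundedInverse_op p k₂ k₄
  have hcomp := isCompactOperator_opInv p k₂ k₄
  -- Raising `k₀` moves finitely many family members into the exceptional set. This freedom is what
  -- allows one `k₀` for both operators.
  set S := {c | (op p k₂ k₄).eigenspace c ≠ ⊥ ∧ ∀ j k, (k₀ : ℤ) ≤ |k| → c ≠ μ j k} with hS
  have hSfin : S.Finite := by
    have hfin2 : (⋃ j : Fin 2, μ j '' Set.Icc (-(k₀ : ℤ)) k₀).Finite :=
      Set.finite_iUnion fun j => (Set.finite_Icc _ _).image _
    refine (hfin.union hfin2).subset fun c hc => ?_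
    by_cases h : ∀ j k, (K : ℤ) ≤ |k| → c ≠ μ j k
    · exact Or.inl ⟨hc.1, h⟩
    · push Not at h
      obtain ⟨j, k, -, rfl⟩ := h
      refine Or.inr (Set.mem_iUnion.2 ⟨j, k, ?_, rfl⟩)
      have hk : ¬ (k₀ : ℤ) ≤ |k| := fun hk => hc.2 j k hk rfl
      exact abs_le.1 (not_le.1 hk).le
  have := hSfin.to_subtype
  obtain ⟨N, ⟨e⟩⟩ := Finite.exists_equiv_fin S
  have hmem : ∀ i, (e.symm i : ℂ) ∈ S := fun i => (e.symm i).2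
  refine ⟨N, fun i => e.symm i, μ, ⟨?_, ?_, ?_, ?_, ?_, ?_, ?_, hasy⟩, fun i => (hmem i).1,
    fun j k hk => (hsimple j k (hK k hk)).1⟩
  · ext c
    rw [hinv.mem_spectrum_iff hcomp]
    constructor
    · intro hc
      by_cases h : ∀ j k, (k₀ : ℤ) ≤ |k| → c ≠ μ j k
      · exact Or.inl ⟨e ⟨c, hc, h⟩, congrArg Subtype.val (e.symm_apply_apply _)⟩
      · push Not at h
        exact Or.inr h
    · rintro (⟨i, rfl⟩ | ⟨j, k, hk, rfl⟩)
      · exact (hmem i).1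
      · exact (hsimple j k (hK k hk)).1
  · exact Subtype.val_injective.comp e.symm.injective
  · exact fun j k j' k' hk hk' => hinj j k j' k' (hK k hk) (hK k' hk')
  · exact fun i j k hk => (hmem i).2 j k hk
  · intro i
    have := hinv.finite_rootSpace hcomp (e.symm i : ℂ)
    refine Submodule.one_le_finrank_iff.2 fun h => (hmem i).1 ?_
    exact le_bot_iff.1 (h ▸ HasBoundedInverse.eigenspace_le_rootSpace (T := op p k₂ k₄) (e.symm i : ℂ))
  · exact fun i => ⟨hinv.finite_rootSpace hcomp _, rfl⟩
  · exact fun j k hk => (hsimple j k (hK k hk)).2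

/-- The index set of the eigenvectors as a disjoint union over the eigenvalues. -/
def indexEquiv {N : ℕ} (m : Fin N → ℕ) (X : Type) :
    (Σ i, Fin (m i)) ⊕ X ≃ Σ i : Fin N ⊕ X, Fin (Sum.elim m (fun _ => 1) i) :=
  ((Equiv.refl _).sumCongr (Equiv.sigmaUnique X fun _ => Fin 1).symm).trans
    (Equiv.sumSigmaDistrib fun i : Fin N ⊕ X => Fin (Sum.elim m (fun _ => 1) i)).symm

end Timoshenko

end

open Timoshenko InverseOperator in
theorem theorem3p1 (p : Timoshenko.Params) (k₂ k₄ : ℝ) (hk₂ : 0 < k₂) (hk₄ : 0 < k₄) :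
    ∃ k₀ : ℕ,
      -- the conservative operator
      ((Timoshenko.op p 0 0).IsSkewAdjoint ∧
        ∃ (N : ℕ) (κ : Fin N → ℂ) (m : Fin N → ℕ) (μ : Fin 2 → ℤ → ℂ),
          (Timoshenko.op p 0 0).SpectrumSplits k₀ κ m μ ∧
          (∀ i, (Timoshenko.op p 0 0).HasGeomMult (κ i) (m i)) ∧
          ∃ φ : HilbertBasis ((Σ i : Fin N, Fin (m i)) ⊕ (Fin 2 × {k : ℤ // (k₀ : ℤ) ≤ |k|})) ℂ
              (Timoshenko.Energy p),
            (∀ i l, φ (Sum.inl ⟨i, l⟩) ∈ (Timoshenko.op p 0 0).eigenspace (κ i)) ∧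
            ∀ (j : Fin 2) (k : {k : ℤ // (k₀ : ℤ) ≤ |k|}),
              φ (Sum.inr (j, k)) ∈ (Timoshenko.op p 0 0).eigenspace (μ j k)) ∧
      -- the dissipative operator
      ∃ (N : ℕ) (κ : Fin N → ℂ) (m n : Fin N → ℕ) (μ : Fin 2 → ℤ → ℂ),
        (Timoshenko.op p k₂ k₄).SpectrumSplits k₀ κ m μ ∧
        (∀ i, (Timoshenko.op p k₂ k₄).HasGeomMult (κ i) (n i) ∧ 1 ≤ n i ∧ n i ≤ m i) ∧
        (∃ (δ : (i : Fin N) → Fin (n i) → ℕ)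
            (ψ : (i : Fin N) → Fin (n i) → ℕ → Timoshenko.Energy p),
          ∀ i, (∀ r, 1 ≤ δ i r) ∧ ∑ r, δ i r = m i ∧
            (∀ r, (Timoshenko.op p k₂ k₄).IsJordanChain (κ i) (δ i r) (ψ i r)) ∧
            LinearIndependent ℂ (fun q : (Σ r : Fin (n i), Fin (δ i r)) => ψ i q.1 (q.2 + 1))) ∧
        ∃ ψ : Fin 2 → ℤ → Timoshenko.Energy p, ∀ j k, (k₀ : ℤ) ≤ |k| →
          ψ j k ∈ (Timoshenko.op p k₂ k₄).eigenspace (μ j k) ∧ ‖ψ j k‖ = 1 := by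
  obtain ⟨K, hK⟩ := exists_spectrumSplits p 0 0
  obtain ⟨K', hK'⟩ := exists_spectrumSplits p k₂ k₄
  refine ⟨max K K', ⟨?_, ?_⟩, ?_⟩
  · exact (hasBoundedInverse_op p 0 0).isSkewAdjoint (inner_opInv_add p)
  · obtain ⟨N, κ, μ, hsplit, hκ, hμ⟩ := hK _ (le_max_left K K')
    have hinv := hasBoundedInverse_op p 0 0
    have hcomp := isCompactOperator_opInv p 0 0
    -- Skewness stops the kernels at the first power, so algebraic and geometric multiplicities
    -- agree.
    have hroot : ∀ c, (op p 0 0).rootSpace c = (op p 0 0).eigenspace c := fun c =>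
      hinv.rootSpace_eq_of_kerPow_eq (n := 1) (hinv.kerPow_two_of_skew (inner_opInv_add p) c)
    refine ⟨N, κ, _, μ, hsplit, fun i => ⟨hinv.finite_eigenspace hcomp _, by rw [hroot]⟩, ?_⟩
    set e : Fin N ⊕ (Fin 2 × {k : ℤ // ((max K K' : ℕ) : ℤ) ≤ |k|}) → ℂ :=
      Sum.elim κ fun x => μ x.1 x.2
    have he : Function.Injective e := by
      refine hsplit.finite_injective.sumElim ?_ fun i x => hsplit.disjoint i x.1 x.2 x.2.2
      rintro ⟨j, k, hk⟩ ⟨j', k', hk'⟩ heq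
      obtain ⟨rfl, rfl⟩ := hsplit.family_injective j k j' k' hk hk' heq
      rfl
    have hsurj : ∀ c, (op p 0 0).eigenspace c ≠ ⊥ → ∃ i, e i = c := by
      intro c hc
      have := (hinv.mem_spectrum_iff hcomp).2 hc
      rw [hsplit.spectrum_eq] at this
      obtain ⟨i, rfl⟩ | ⟨j, k, hk, rfl⟩ := this
      · exact ⟨Sum.inl i, rfl⟩
      · exact ⟨Sum.inr (j, ⟨k, hk⟩), rfl⟩
    have hd : ∀ i, Module.finrank ℂ ((op p 0 0).eigenspace (e i)) =
        Sum.elim (fun i => Module.finrank ℂ ((op p 0 0).rootSpace (κ i))) (fun _ => 1) i := by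
      rintro (i | ⟨j, k, hk⟩)
      · exact congrArg (fun V : Submodule ℂ (Energy p) => Module.finrank ℂ V) (hroot (κ i)).symm
      · exact (congrArg (fun V : Submodule ℂ (Energy p) => Module.finrank ℂ V)
          (hroot (μ j k)).symm).trans (hsplit.family_simple j k hk).2
    obtain ⟨φ, hφ⟩ := hinv.exists_hilbertBasis hcomp (inner_opInv_add p) e he hsurj _ hd
      (indexEquiv _ _)
    exact ⟨φ, fun i l => hφ (Sum.inl ⟨i, l⟩), fun j k => hφ (Sum.inr (j, k))⟩
  · obtain ⟨N, κ, μ, hsplit, hκ, hμ⟩ := hK' _ (le_max_right K K')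
    have hinv := hasBoundedInverse_op p k₂ k₄
    have hcomp := isCompactOperator_opInv p k₂ k₄
    refine ⟨N, κ, _, fun i => Module.finrank ℂ ((op p k₂ k₄).eigenspace (κ i)), μ, hsplit,
      fun i => ?_, ?_, ?_⟩
    · have := hinv.finite_eigenspace hcomp (κ i)
      have := hinv.finite_rootSpace hcomp (κ i)
      exact ⟨⟨inferInstance, rfl⟩, Submodule.one_le_finrank_iff.2 (hκ i),
        Submodule.finrank_mono (HasBoundedInverse.eigenspace_le_rootSpace (κ i))⟩
    · choose δ ψ h using fun i => hinv.exists_isJordanChain hcomp (κ i) rfl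
      exact ⟨δ, ψ, h⟩
    · have hex : ∀ j k, ∃ x : Energy p, ((max K K' : ℕ) : ℤ) ≤ |k| →
          x ∈ (op p k₂ k₄).eigenspace (μ j k) ∧ ‖x‖ = 1 := by
        intro j k
        by_cases hk : ((max K K' : ℕ) : ℤ) ≤ |k|
        · obtain ⟨x, hx, hx0⟩ := (Submodule.ne_bot_iff _).1 (hμ j k hk)
          exact ⟨((‖x‖ : ℂ)⁻¹) • x, fun _ => ⟨Submodule.smul_mem _ _ hx, norm_smul_inv_norm hx0⟩⟩
        · exact ⟨0, fun h => absurd h hk⟩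
      choose ψ hψ using hex
      exact ⟨ψ, hψ⟩
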